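/- **Setting.** Manifolds are smooth, Hausdorff and second countable. Let $m\ge 2$, and let $\mathbb L^{m+2}$ be $\mathbb R^{m+2}$ with a basis $(\ell,e_1,\dots,e_m,n)$ and the Lorentzian product with $\langle \ell,n\rangle=1$, $\langle e_i,e_j\rangle=\delta_{ij}$ and all other products of basis vectors zero. Let $O^+(m+1,1)$ be the group of linear isometries preserving the future lightlike cone (the one containing $\ell$), $\mathfrak g$ its Lie algebra, $H$ the isotropy subgroup of $\ell$, and $\mathfrak h$ its Lie algebra. Identify $\mathfrak g/\mathfrak h\cong\mathbb R\times\mathbb R^m$ by $A+\mathfrak h\mapsto (a,X)$, where $A\ell=a\ell+\sum_i X_ie_i$; put $q((a,X),(b,Y))=\langle X,Y\rangle_{\mathbb R^m}$ and let $E\in\mathfrak g$ be the element with $E\ell=\ell$, $Ee_i=0$, $En=-n$. A *lightlike Cartan geometry* $(p:\mathcal P\to N,\omega)$ on an $(m+1)$-manifold $N$ is a Cartan geometry of type $(O^+(m+1,1),H)$: a principal $H$-bundle with a smooth $\mathfrak g$-valued $1$-form $\omega$ such that each $\omega(u):T_u\mathcal P\to\mathfrak g$ is an isomorphism, $(r^a)^*\omega=\mathrm{Ad}(a^{-1})\circ\omega$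 for $a\in H$, and $\omega(\zeta_A)=A$ for every fundamental vector field $\zeta_A$, $A\in\mathfrak h$. Its standard tractor bundle is $\mathcal T=\mathcal P\times_H\mathbb L^{m+2}$, with metric $\mathbf h([u,v],[u,v'])=\langle v,v'\rangle$ and tractor connection $\nabla^{\mathcal T}_W[s,f]=[s,\,W(f)+\omega(Ts\cdot W)f]$ for local sections $s$ of $\mathcal P$. Let $R^{\mathcal T}$ be its curvature, $\xi=[u,\ell]$ and $\Phi=\nabla^{\mathcal T}\xi:TN\to\mathcal T$. Given $h^\omega$ and $Z^\omega$ as in (1) below, let $S$ be the set of smooth $1$-forms $\tau$ on $N$ with $\tau(Z^\omega)=1$. For $\tau\in S$ put $\mathrm{An}(\tau)=\ker\tau$ and $P^\tau(v)=v-\tau(v)Z^\omega$, and let $\eta^\tau$ be the unique lightlike section of $\mathcal T$ with $\mathbf h(\xi,\eta^\tau)=1$ and $\mathbf h(\Phi(\mathrm{An}(\tau)),\eta^\tau)=0$, so that $\mathcal T=\mathbb R\xi\oplus\Phi(\mathrm{An}(\tau))\oplus\mathbb R\eta^\tau$. For vector fields $V$ and sections $X$ of $\mathrm{An}(\tau)$,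 let $\nabla^\tau_VX$ and $D^\tau(V)$ be the $\mathrm{An}(\tau)$-components of $\nabla^{\mathcal T}_V\Phi(X)$ and of $\nabla^{\mathcal T}_V\eta^\tau$, and put $$\widetilde\nabla^\tau_VW=V(\tau(W))Z^\omega+\tau(W)P^\tau(V)+\nabla^\tau_V(P^\tau(W)).$$ For $\tau,\bar\tau\in S$ let $L_{\tau,\bar\tau}=\sum_{i=1}^m\tau(E_i)E_i$ for any local $h^\omega$-orthonormal frame $(E_1,\dots,E_m)$ of $\mathrm{An}(\bar\tau)$; it is a smooth vector field independent of the frame. A *Galilean connection* on $(N,\tau,h^\omega|_{\mathrm{An}(\tau)})$ is a smooth linear connection $\nabla$ on $TN$ with $\nabla\tau=0$ and $V(h^\omega(X,Y))=h^\omega(\nabla_VX,Y)+h^\omega(X,\nabla_VY)$ for all $V\in\mathfrak X(N)$ and all sections $X,Y$ of $\mathrm{An}(\tau)$. **Theorem.** Let $(p:\mathcal P\to N,\omega)$ be a lightlike Cartan geometry. Then $N$ is endowed with the following structures. 1. A lightlike metric $h^\omega$ (a smooth symmetric positive semidefinite $(0,2)$-tensor field with one-dimensional radical) and a smooth vector field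 $Z^\omega$ spanning its radical, determined by $h^\omega(T_up\cdot X,T_up\cdot Y)=q(\omega(X)+\mathfrak h,\omega(Y)+\mathfrak h)$ for $X,Y\in T_u\mathcal P$ and $Z^\omega_{p(u)}=T_up\cdot\omega(u)^{-1}(E)$. 2. A tensor field $\mathbf T^\omega\in\Gamma(\Lambda^2T^*N\otimes TN)$, with $R^{\mathcal T}(V,W)\xi=\Phi(\mathbf T^\omega(V,W))$ for all $V,W\in\mathfrak X(N)$, which for each $\tau\in S$ determines $\widetilde\nabla^\tau$: the latter is the unique Galilean connection $\nabla$ on $(N,\tau,h^\omega|_{\mathrm{An}(\tau)})$ such that $$\nabla_{Z^\omega}Z^\omega=0,\qquad h^\omega(\nabla_XZ^\omega,Y)-h^\omega(X,\nabla_YZ^\omega)=0\ \ (X,Y\in\Gamma(\mathrm{An}(\tau))),\qquad \mathrm{Tor}^\nabla=P^\tau\circ\mathbf T^\omega+d\tau\otimes Z^\omega,$$ where $d\tau(V,W)=V(\tau(W))-W(\tau(V))-\tau([V,W])$. 3. A map $D^\omega$ assigning to each $\tau\in S$ the smooth vector bundle morphism $D^\tau:TN\to\mathrm{An}(\tau)$,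 such that for all $\tau,\bar\tau\in S$ and every tangent vector $W$ $$D^{\bar\tau}(W)=P^{\bar\tau}\Big(D^\tau(W)+\tfrac12h^\omega(L_{\tau,\bar\tau},L_{\tau,\bar\tau})W\Big)-\tau(W)L_{\tau,\bar\tau}-\widetilde\nabla^{\bar\tau}_WL_{\tau,\bar\tau}.$$ -/

import Mathlib

open scoped Manifold ContDiff Topology

noncomputable section

set_option linter.unusedSectionVars false

namespace Lightlike

/-! ### The Klein geometry of the future lightlike cone -/

/-- `ℝ^{m+2}`, written in coordinates `(a, x, b)` with respect to the basis
`(ℓ, e₁, …, e_m, n)`. -/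
abbrev LorentzSpace (m : ℕ) : Type := ℝ × EuclideanSpace ℝ (Fin m) × ℝ

variable (m : ℕ)

/-- The Lorentzian inner product whose Gram matrix in the basis `(ℓ, e₁, …, e_m, n)` has
`⟨ℓ, n⟩ = 1`, `⟨e_i, e_j⟩ = δ_ij` and all other entries zero. -/
def lor : LorentzSpace m →ₗ[ℝ] LorentzSpace m →ₗ[ℝ] ℝ :=
  LinearMap.mk₂ ℝ (fun v w => v.1 * w.2.2 + inner ℝ v.2.1 w.2.1 + v.2.2 * w.1)
    (fun u v w => by simp [inner_add_left]; ring)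
    (fun c v w => by simp [inner_smul_left]; ring)
    (fun u v w => by simp [inner_add_right]; ring)
    (fun c v w => by simp [inner_smul_right]; ring)

/-- The basis vector `ℓ`. -/
def ell : LorentzSpace m := (1, 0, 0)

/-- The basis vector `n`. -/
def nvec : LorentzSpace m := (0, 0, 1)

/-- The future lightlike cone: nonzero null vectors in the time cone of the timelike
vector `ℓ - n`; it contains `ℓ`. -/
def futureCone : Set (LorentzSpace m) :=
  {v | v ≠ 0 ∧ lor m v v = 0 ∧ lor m v (ell m - nvec m) < 0}

/-- The orthochronous Lorentz group `O⁺(m+1,1)`. -/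
def orthochronousLorentz : Subgroup (LorentzSpace m ≃L[ℝ] LorentzSpace m) where
  carrier := {g | (∀ v w, lor m (g v) (g w) = lor m v w) ∧
    ∀ v, g v ∈ futureCone m ↔ v ∈ futureCone m}
  mul_mem' {a b} ha hb := ⟨fun v w => by
      rw [show (a * b) v = a (b v) from rfl, show (a * b) w = a (b w) from rfl, ha.1, hb.1],
    fun v => by rw [show (a * b) v = a (b v) from rfl, ha.2, hb.2]⟩
  one_mem' := ⟨fun _ _ => rfl, fun _ => Iff.rfl⟩
  inv_mem' {a} ha := ⟨fun v w => by
      rw [← ha.1, show a (a⁻¹ v) = v from a.apply_symm_apply v,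
        show a (a⁻¹ w) = w from a.apply_symm_apply w],
    fun v => by rw [← ha.2, show a (a⁻¹ v) = v from a.apply_symm_apply v]⟩

/-- The isotropy subgroup `H` of `ℓ` in `O⁺(m+1,1)`. -/
def isotropy : Subgroup (LorentzSpace m ≃L[ℝ] LorentzSpace m) where
  carrier := {g | g ∈ orthochronousLorentz m ∧ g (ell m) = ell m}
  mul_mem' {a b} ha hb := ⟨mul_mem ha.1 hb.1, by
    rw [show (a * b) (ell m) = a (b (ell m)) from rfl, hb.2, ha.2]⟩
  one_mem' := ⟨one_mem _, rfl⟩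
  inv_mem' {a} ha := ⟨inv_mem ha.1, by
    conv_lhs => rw [← ha.2]
    exact a.symm_apply_apply _⟩

/-- An element of `H` as an endomorphism of `ℝ^{m+2}`. -/
def toEnd (a : isotropy m) : LorentzSpace m →L[ℝ] LorentzSpace m :=
  (a.1 : LorentzSpace m →L[ℝ] LorentzSpace m)

/-- The Lie algebra `𝔤` of `O⁺(m+1,1)`: skew-adjoint endomorphisms. -/
def lieG : Submodule ℝ (LorentzSpace m →L[ℝ] LorentzSpace m) where
  carrier := {A | ∀ v w, lor m (A v) w + lor m v (A w) = 0}
  add_mem' {A B} hA hB v w := by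
    have h1 := hA v w
    have h2 := hB v w
    simp only [add_apply, map_add, LinearMap.add_apply]
    linarith
  zero_mem' v w := by simp
  smul_mem' c A hA v w := by
    have h1 := hA v w
    simp only [smul_apply, map_smul, LinearMap.smul_apply, smul_eq_mul]
    linear_combination c * h1

/-- The Lie algebra `𝔥` of `H`: the elements of `𝔤` that annihilate `ℓ`. -/
def lieH : Submodule ℝ (LorentzSpace m →L[ℝ] LorentzSpace m) where
  carrier := {A | A ∈ lieG m ∧ A (ell m) = 0}
  add_mem' hA hB := ⟨add_mem hA.1 hB.1, by simp [hA.2, hB.2]⟩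
  zero_mem' := ⟨zero_mem _, by simp⟩
  smul_mem' c A hA := ⟨Submodule.smul_mem _ c hA.1, by simp [hA.2]⟩

/-- The grading element `E = diag(1, 0, -1)`. -/
def gradingElement : lieG m :=
  ⟨(ContinuousLinearMap.fst ℝ ℝ (EuclideanSpace ℝ (Fin m) × ℝ)).prod
    ((0 : LorentzSpace m →L[ℝ] EuclideanSpace ℝ (Fin m)).prod
      (-((ContinuousLinearMap.snd ℝ (EuclideanSpace ℝ (Fin m)) ℝ).comp
        (ContinuousLinearMap.snd ℝ ℝ (EuclideanSpace ℝ (Fin m) × ℝ))))), by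
    intro v w
    simp [lor]; ring⟩

/-- The projection `𝔤 → 𝔤/𝔥 ≅ ℝ × ℝ^m`, sending a matrix to the entries `(a, X)` of its
first column. -/
def projGH : lieG m →ₗ[ℝ] ℝ × EuclideanSpace ℝ (Fin m) where
  toFun A := ((A.1 (ell m)).1, (A.1 (ell m)).2.1)
  map_add' A B := by simp
  map_smul' c A := by simp

/-- The degenerate `H`-invariant metric `q((a, X), (b, Y)) = ⟨X, Y⟩` on `𝔤/𝔥`. -/
def qform : (ℝ × EuclideanSpace ℝ (Fin m)) →ₗ[ℝ] (ℝ × EuclideanSpace ℝ (Fin m)) →ₗ[ℝ] ℝ :=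
  LinearMap.mk₂ ℝ (fun v w => inner ℝ v.2 w.2)
    (fun u v w => by simp [inner_add_left])
    (fun c v w => by simp [inner_smul_left])
    (fun u v w => by simp [inner_add_right])
    (fun c v w => by simp [inner_smul_right])


theorem mem_isotropy_of_isometry (g : LorentzSpace m ≃L[ℝ] LorentzSpace m)
    (hg : ∀ v w, lor m (g v) (g w) = lor m v w) (hl : g (ell m) = ell m) : g ∈ isotropy m := by
  have key : ∀ f : LorentzSpace m ≃L[ℝ] LorentzSpace m,
      (∀ v w, lor m (f v) (f w) = lor m v w) → f (ell m) = ell m →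
      ∀ v, v ∈ futureCone m → f v ∈ futureCone m := by
    intro f hf hfl v hv
    obtain ⟨h0, h1, h2⟩ := hv
    have hb : (f v).2.2 = v.2.2 := by
      have := hf v (ell m)
      rw [hfl] at this
      simpa [lor, ell] using this
    have hnull : lor m (f v) (f v) = 0 := by rw [hf, h1]
    refine ⟨by simpa using h0, hnull, ?_⟩
    have sq1 : 0 ≤ ‖v.2.1‖ ^ 2 := sq_nonneg _
    have sq2 : 0 ≤ ‖(f v).2.1‖ ^ 2 := sq_nonneg _
    have h1' : 2 * (v.1 * v.2.2) + ‖v.2.1‖ ^ 2 = 0 := by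
      rw [← h1]; simp [lor]; ring
    have hn' : 2 * ((f v).1 * v.2.2) + ‖(f v).2.1‖ ^ 2 = 0 := by
      rw [← hnull, ← hb]; simp [lor]; ring
    have h2' : v.2.2 < v.1 := by
      have : lor m v (ell m - nvec m) = v.2.2 - v.1 := by simp [lor, ell, nvec]; ring
      linarith [this ▸ h2]
    have goal' : v.2.2 < (f v).1 := by
      rcases lt_trichotomy v.2.2 0 with hneg | hz | hpos
      · by_contra hcon
        have : 0 < (f v).1 * v.2.2 := mul_pos_of_neg_of_neg (by linarith) hneg
        linarith
      · have hx : v.2.1 = 0 := by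
          rw [hz] at h1'
          simpa using h1'
        have hv' : v = v.1 • ell m := by
          ext1
          · simp [ell]
          ext1
          · simp [ell, hx]
          · simp [ell, hz]
        have h3 : f v = v := by
          conv_lhs => rw [hv', map_smul, hfl, ← hv']
        rw [h3]; exact h2'
      · have : 0 < v.1 * v.2.2 := mul_pos (by linarith) hpos
        linarith
    have : lor m (f v) (ell m - nvec m) = (f v).2.2 - (f v).1 := by simp [lor, ell, nvec]; ring
    rw [this, hb]; linarith
  refine ⟨⟨hg, fun v => ⟨fun h => ?_, key g hg hl v⟩⟩, hl⟩
  have := key g.symm (fun v w => by rw [← hg, g.apply_symm_apply, g.apply_symm_apply])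
    (by conv_lhs => rw [← hl]
        exact g.symm_apply_apply _) _ h
  simpa using this

theorem lor_exp (A : lieH m) (v w : LorentzSpace m) :
    lor m (NormedSpace.exp A.1 v) (NormedSpace.exp A.1 w) = lor m v w := by
  have hd : ∀ (u : LorentzSpace m) (t : ℝ), HasDerivAt (fun t : ℝ => NormedSpace.exp (t • A.1) u)
      (A.1 (NormedSpace.exp (t • A.1) u)) t := fun u t =>
    (hasDerivAt_exp_smul_const' A.1 t).clm_apply (hasDerivAt_const t u) |>.congr_deriv (by simp)
  let B : LorentzSpace m →L[ℝ] LorentzSpace m →L[ℝ] ℝ :=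
    LinearMap.toContinuousLinearMap
      ((LinearMap.toContinuousLinearMap : (LorentzSpace m →ₗ[ℝ] ℝ) ≃ₗ[ℝ] _).toLinearMap ∘ₗ lor m)
  have hB : ∀ v w, B v w = lor m v w := fun _ _ => rfl
  have hf : ∀ t : ℝ, HasDerivAt
      (fun t : ℝ => B (NormedSpace.exp (t • A.1) v) (NormedSpace.exp (t • A.1) w)) 0 t := by
    intro t
    have h1 := (B.hasFDerivAt.comp_hasDerivAt t (hd v t)).clm_apply (hd w t)
    refine h1.congr_deriv ?_
    have := A.2.1 (NormedSpace.exp (t • A.1) v) (NormedSpace.exp (t • A.1) w)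
    simpa [hB] using this
  have := is_const_of_deriv_eq_zero (fun t => (hf t).differentiableAt) (fun t => (hf t).deriv) 1 0
  rw [zero_smul ℝ A.1, NormedSpace.exp_zero] at this
  simpa [hB] using this

theorem exp_ell (A : lieH m) : NormedSpace.exp A.1 (ell m) = ell m := by
  have hf : ∀ t : ℝ, HasDerivAt (fun t : ℝ => NormedSpace.exp (t • A.1) (ell m)) 0 t := fun t =>
    (hasDerivAt_exp_smul_const A.1 t).clm_apply (hasDerivAt_const t (ell m)) |>.congr_deriv
      (by simp [A.2.2])
  have := is_const_of_deriv_eq_zero (fun t => (hf t).differentiableAt) (fun t => (hf t).deriv) 1 0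
  rw [zero_smul ℝ A.1, NormedSpace.exp_zero] at this
  simpa using this

/-- The exponential map `𝔥 → H`. -/
def expH (A : lieH m) : isotropy m :=
  ⟨ContinuousLinearEquiv.equivOfInverse (NormedSpace.exp A.1) (NormedSpace.exp (-A.1))
    (fun v => by
      let _ := NormedAlgebra.restrictScalars ℚ ℝ (LorentzSpace m →L[ℝ] LorentzSpace m)
      rw [← mul_apply_eq_comp, ← NormedSpace.exp_add_of_commute
        ((Commute.refl A.1).neg_left)]
      simp)
    (fun v => by
      let _ := NormedAlgebra.restrictScalars ℚ ℝ (LorentzSpace m →L[ℝ] LorentzSpace m)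
      rw [← mul_apply_eq_comp, ← NormedSpace.exp_add_of_commute
        ((Commute.refl A.1).neg_right)]
      simp),
    mem_isotropy_of_isometry m _ (lor_exp m A) (exp_ell m A)⟩

variable (N P : Type*) [TopologicalSpace N] [ChartedSpace (EuclideanSpace ℝ (Fin (m + 1))) N]
  {F : Type*} [NormedAddCommGroup F] [NormedSpace ℝ F] [TopologicalSpace P] [ChartedSpace F P]
  [IsManifold (𝓡 (m + 1)) ∞ N] [IsManifold 𝓘(ℝ, F) ∞ P]

/-! ### Lightlike Cartan geometries -/

/-- A Cartan geometry `(p : P → N, ω)` of type `(O⁺(m+1,1), H)` on an `(m+1)`-manifold `N`.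
The group `H` is a closed, hence embedded, submanifold of `End(ℝ^{m+2})`; a map into `H` is
smooth when it is smooth as a map into `End(ℝ^{m+2})`, and a map defined on `P × H` is smooth when
it extends locally to a smooth map on an open subset of `P × End(ℝ^{m+2})`. -/
structure CartanGeometry where
  /-- the bundle projection -/
  proj : P → N
  smooth_proj : ContMDiff 𝓘(ℝ, F) (𝓡 (m + 1)) ∞ proj
  /-- the principal right action of `H` -/
  act : P → isotropy m → P
  act_one : ∀ u, act u 1 = u
  act_mul : ∀ u a b, act u (a * b) = act (act u a) b
  act_free : ∀ u a, act u a = u → a = 1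
  proj_act : ∀ u a, proj (act u a) = proj u
  smooth_act : ∀ (u₀ : P) (a₀ : isotropy m),
    ∃ (O : Set (P × (LorentzSpace m →L[ℝ] LorentzSpace m)))
      (f : P × (LorentzSpace m →L[ℝ] LorentzSpace m) → P),
      IsOpen O ∧ (u₀, toEnd m a₀) ∈ O ∧
      ContMDiffOn (𝓘(ℝ, F).prod 𝓘(ℝ, LorentzSpace m →L[ℝ] LorentzSpace m)) 𝓘(ℝ, F) ∞ f O ∧
      ∀ u a, (u, toEnd m a) ∈ O → f (u, toEnd m a) = act u a
  /-- Local triviality: over `U` the map `(x, a) ↦ s(x) · a` is an `H`-equivariant diffeomorphism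
  from `U × H` onto `p⁻¹(U)`, with inverse `u ↦ (p(u), ψ(u))`. -/
  locally_trivial : ∀ x : N, ∃ U : Set N, IsOpen U ∧ x ∈ U ∧
    ∃ (s : N → P) (ψ : P → isotropy m),
      ContMDiffOn (𝓡 (m + 1)) 𝓘(ℝ, F) ∞ s U ∧ (∀ y ∈ U, proj (s y) = y) ∧
      ContMDiffOn 𝓘(ℝ, F) 𝓘(ℝ, LorentzSpace m →L[ℝ] LorentzSpace m) ∞
        (fun u => toEnd m (ψ u)) (proj ⁻¹' U) ∧
      ∀ u ∈ proj ⁻¹' U, act (s (proj u)) (ψ u) = u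
  /-- the Cartan connection `ω` -/
  conn : ∀ u : P, TangentSpace 𝓘(ℝ, F) u →ₗ[ℝ] lieG m
  smooth_conn : ContMDiff 𝓘(ℝ, F).tangent 𝓘(ℝ, lieG m) ∞
    (fun X : TangentBundle 𝓘(ℝ, F) P => conn X.1 X.2)
  conn_bijective : ∀ u, Function.Bijective (conn u)
  /-- `(r^a)^* ω = Ad(a⁻¹) ∘ ω` -/
  conn_equivariant : ∀ (u : P) (a : isotropy m) (X : TangentSpace 𝓘(ℝ, F) u),
    (conn (act u a) (mfderiv 𝓘(ℝ, F) 𝓘(ℝ, F) (fun u' => act u' a) u X)).1 =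
      toEnd m a⁻¹ ∘L (conn u X).1 ∘L toEnd m a
  /-- `ω(ζ_A) = A`, where `ζ_A(u)` is the velocity of `t ↦ u · exp(tA)` at `t = 0`. -/
  conn_fundamental : ∀ (u : P) (A : lieH m),
    (conn u (mfderiv 𝓘(ℝ, ℝ) 𝓘(ℝ, F) (fun t : ℝ => act u (expH m (t • A))) 0 (1 : ℝ))).1 = A.1

variable {m N}

/-- Smooth vector fields. -/
def IsSmoothField (V : ∀ x : N, TangentSpace (𝓡 (m + 1)) x) : Prop :=
  ContMDiff (𝓡 (m + 1)) (𝓡 (m + 1)).tangent ∞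
    (fun x => (⟨x, V x⟩ : TangentBundle (𝓡 (m + 1)) N))

/-- Vector fields that are smooth on a subset. -/
def IsSmoothFieldOn (V : ∀ x : N, TangentSpace (𝓡 (m + 1)) x) (U : Set N) : Prop :=
  ContMDiffOn (𝓡 (m + 1)) (𝓡 (m + 1)).tangent ∞
    (fun x => (⟨x, V x⟩ : TangentBundle (𝓡 (m + 1)) N)) U

/-- The directional derivative `v(f)` of a function along a tangent vector. -/
def dirDeriv {W : Type*} [NormedAddCommGroup W] [NormedSpace ℝ W] (f : N → W) (x : N)
    (v : TangentSpace (𝓡 (m + 1)) x) : W :=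
  mvfderiv (𝓡 (m + 1)) f x v

/-- `h` is a lightlike metric: a smooth symmetric positive semidefinite `(0,2)`-tensor field with
one-dimensional radical. -/
structure IsLightlikeMetric
    (h : ∀ x : N, TangentSpace (𝓡 (m + 1)) x →ₗ[ℝ] TangentSpace (𝓡 (m + 1)) x →ₗ[ℝ] ℝ) :
    Prop where
  smooth : ∀ (U : Set N) (V W : ∀ x : N, TangentSpace (𝓡 (m + 1)) x), IsOpen U →
    IsSmoothFieldOn V U → IsSmoothFieldOn W U →
    ContMDiffOn (𝓡 (m + 1)) 𝓘(ℝ, ℝ) ∞ (fun x => h x (V x) (W x)) U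
  symm : ∀ x v w, h x v w = h x w v
  nonneg : ∀ x v, 0 ≤ h x v v
  radical : ∀ x, Module.finrank ℝ (LinearMap.ker (h x)) = 1

/-- `T` is a smooth section of `Λ²T*N ⊗ TN`. -/
structure IsVectorValuedTwoForm
    (T : ∀ x : N, TangentSpace (𝓡 (m + 1)) x →ₗ[ℝ] TangentSpace (𝓡 (m + 1)) x →ₗ[ℝ]
      TangentSpace (𝓡 (m + 1)) x) : Prop where
  smooth : ∀ (U : Set N) (V W : ∀ x : N, TangentSpace (𝓡 (m + 1)) x), IsOpen U →
    IsSmoothFieldOn V U → IsSmoothFieldOn W U → IsSmoothFieldOn (fun x => T x (V x) (W x)) U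
  alternating : ∀ x v, T x v v = 0

/-- Smooth `1`-forms. -/
def IsSmoothOneForm (τ : ∀ x : N, TangentSpace (𝓡 (m + 1)) x →ₗ[ℝ] ℝ) : Prop :=
  ContMDiff (𝓡 (m + 1)).tangent 𝓘(ℝ, ℝ) ∞
    (fun v : TangentBundle (𝓡 (m + 1)) N => τ v.1 v.2)

/-- `(dτ)(V, W) = V(τ(W)) - W(τ(V)) - τ([V, W])`. -/
def extDerivOneForm (τ : ∀ x : N, TangentSpace (𝓡 (m + 1)) x →ₗ[ℝ] ℝ)
    (V W : ∀ x : N, TangentSpace (𝓡 (m + 1)) x) (x : N) : ℝ :=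
  dirDeriv (fun y => τ y (W y)) x (V x) - dirDeriv (fun y => τ y (V y)) x (W x) -
    τ x (VectorField.mlieBracket (𝓡 (m + 1)) V W x)

/-- `D` is a smooth vector bundle endomorphism of `TN`. -/
def IsBundleMorphism
    (D : ∀ x : N, TangentSpace (𝓡 (m + 1)) x → TangentSpace (𝓡 (m + 1)) x) : Prop :=
  (∀ x, IsLinearMap ℝ (D x)) ∧
  ContMDiff (𝓡 (m + 1)).tangent (𝓡 (m + 1)).tangent ∞
    (fun v : TangentBundle (𝓡 (m + 1)) N =>
      (⟨v.1, D v.1 v.2⟩ : TangentBundle (𝓡 (m + 1)) N))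

variable {P}

namespace CartanGeometry

variable (𝒢 : CartanGeometry m N P (F := F))

/-! ### The induced lightlike structure -/

/-- A smooth section of `p` defined near `x`. All notions below that are expressed through it are
independent of the choice. -/
def localSection (x : N) : N → P := (𝒢.locally_trivial x).choose_spec.2.2.choose

theorem proj_localSection (x : N) : 𝒢.proj (𝒢.localSection x x) = x :=
  (𝒢.locally_trivial x).choose_spec.2.2.choose_spec.choose_spec.2.1 x
    (𝒢.locally_trivial x).choose_spec.2.1

/-- The isomorphism `φ_u : T_xN → 𝔤/𝔥`, `φ_u ∘ T_u p = proj ∘ ω(u)`, for `u = s(x)`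
with `s` a local section: `φ_u = proj ∘ ω(u) ∘ T_x s`. -/
def solder (x : N) : TangentSpace (𝓡 (m + 1)) x →ₗ[ℝ] ℝ × EuclideanSpace ℝ (Fin m) :=
  projGH m ∘ₗ 𝒢.conn (𝒢.localSection x x) ∘ₗ
    (mfderiv (𝓡 (m + 1)) 𝓘(ℝ, F) (𝒢.localSection x) x).toLinearMap

/-- The metric `h^ω(v, w) = q(φ_u(v), φ_u(w))`. -/
def h (x : N) : TangentSpace (𝓡 (m + 1)) x →ₗ[ℝ] TangentSpace (𝓡 (m + 1)) x →ₗ[ℝ] ℝ :=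
  (qform m).compl₁₂ (𝒢.solder x) (𝒢.solder x)

/-- The vector field `Z^ω = T_u p · ω(u)⁻¹(E)`. -/
def Z (x : N) : TangentSpace (𝓡 (m + 1)) x :=
  (mfderiv 𝓘(ℝ, F) (𝓡 (m + 1)) 𝒢.proj (𝒢.localSection x x)
    ((LinearEquiv.ofBijective (𝒢.conn (𝒢.localSection x x))
      (𝒢.conn_bijective (𝒢.localSection x x))).symm (gradingElement m)) :
    EuclideanSpace ℝ (Fin (m + 1)))

/-! ### The standard tractor bundle -/

/-- The fibre `P_x` of the principal bundle. -/
abbrev Fib (x : N) : Type _ := {u : P // 𝒢.proj u = x}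

/-- The right action of `H` on the fibre `P_x`. -/
def fibAct {x : N} (u : 𝒢.Fib x) (a : isotropy m) : 𝒢.Fib x :=
  ⟨𝒢.act u.1 a, (𝒢.proj_act u.1 a).trans u.2⟩

/-- The fibre at `x` of the standard tractor bundle `𝒯 = P ×_H ℝ^{m+2}`. A class `[u, v]`, with
`[u · a, a⁻¹ v] = [u, v]`, is recorded as the `H`-equivariant map `P_x → ℝ^{m+2}` which assigns
to each frame `u` the coordinate vector `v` of that class. -/
def Tractor (x : N) : Submodule ℝ (𝒢.Fib x → LorentzSpace m) where
  carrier := {t | ∀ u a, t (𝒢.fibAct u a) = toEnd m a⁻¹ (t u)}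
  add_mem' hs ht u a := by simp [hs u a, ht u a]
  zero_mem' u a := by simp
  smul_mem' c t ht u a := by simp [ht u a]

theorem exists_fibAct_eq {x : N} (u u' : 𝒢.Fib x) : ∃ a, 𝒢.fibAct u a = u' := by
  obtain ⟨U, -, hx, s, ψ, -, -, -, hψ⟩ := 𝒢.locally_trivial x
  have h1 := hψ u.1 (show 𝒢.proj u.1 ∈ U by rw [u.2]; exact hx)
  have h2 := hψ u'.1 (show 𝒢.proj u'.1 ∈ U by rw [u'.2]; exact hx)
  have h3 : 𝒢.act u.1 ((ψ u.1)⁻¹ * ψ u'.1) = u'.1 := by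
    calc 𝒢.act u.1 ((ψ u.1)⁻¹ * ψ u'.1)
        = 𝒢.act (𝒢.act (s (𝒢.proj u.1)) (ψ u.1)) ((ψ u.1)⁻¹ * ψ u'.1) := by rw [h1]
      _ = u'.1 := by
        rw [← 𝒢.act_mul, mul_inv_cancel_left, u.2]
        simpa only [u'.2] using h2
  refine ⟨(ψ u.1)⁻¹ * ψ u'.1, Subtype.ext ?_⟩
  exact h3

/-- The class `[u, v]` in the fibre of the standard tractor bundle. -/
def cls {x : N} (u : 𝒢.Fib x) (v : LorentzSpace m) : 𝒢.Tractor x :=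
  ⟨fun u' => toEnd m (𝒢.exists_fibAct_eq u u').choose⁻¹ v, fun u' a => by
    have hb := congrArg Subtype.val (𝒢.exists_fibAct_eq u u').choose_spec
    have hc := congrArg Subtype.val (𝒢.exists_fibAct_eq u (𝒢.fibAct u' a)).choose_spec
    set b := (𝒢.exists_fibAct_eq u u').choose
    set c := (𝒢.exists_fibAct_eq u (𝒢.fibAct u' a)).choose
    change 𝒢.act u.1 b = u'.1 at hb
    change 𝒢.act u.1 c = 𝒢.act u'.1 a at hc
    have hcb : c = b * a := by
      rw [← hb, ← 𝒢.act_mul] at hc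
      have h1 : 𝒢.act u.1 (c * (b * a)⁻¹) = u.1 := by
        rw [𝒢.act_mul, hc, ← 𝒢.act_mul, mul_inv_cancel, 𝒢.act_one]
      exact mul_inv_eq_one.mp (𝒢.act_free _ _ h1)
    change toEnd m c⁻¹ v = toEnd m a⁻¹ (toEnd m b⁻¹ v)
    rw [hcb, mul_inv_rev]
    rfl⟩

/-- The coordinates of a section `σ` of `𝒯` in the frame `u`: `σ = [u, coord σ u]` at `p(u)`. -/
def coord (σ : ∀ x, 𝒢.Tractor x) (u : P) : LorentzSpace m := (σ (𝒢.proj u)).1 ⟨u, rfl⟩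

/-- The tractor connection: if `σ = [s, f]` for a local section `s` of `P`, then
`∇_w σ = [s(x), w(f) + ω(s(x))(T_x s · w) f(x)]`. -/
def covDeriv (σ : ∀ x, 𝒢.Tractor x) (x : N) (w : TangentSpace (𝓡 (m + 1)) x) : 𝒢.Tractor x :=
  𝒢.cls ⟨𝒢.localSection x x, 𝒢.proj_localSection x⟩
    (dirDeriv (fun y => 𝒢.coord σ (𝒢.localSection x y)) x w +
      (𝒢.conn (𝒢.localSection x x)
        (mfderiv (𝓡 (m + 1)) 𝓘(ℝ, F) (𝒢.localSection x) x w)).1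
        (𝒢.coord σ (𝒢.localSection x x)))

/-- The bundle metric `𝐡([u, v], [u, v']) = ⟨v, v'⟩` on `𝒯`. -/
def tractorMetric (x : N) (t t' : 𝒢.Tractor x) : ℝ :=
  lor m (t.1 ⟨𝒢.localSection x x, 𝒢.proj_localSection x⟩)
    (t'.1 ⟨𝒢.localSection x x, 𝒢.proj_localSection x⟩)

/-- The canonical lightlike section `ξ = [u, ℓ]`. -/
def xi (x : N) : 𝒢.Tractor x := ⟨fun _ => ell m, fun _ a => (a⁻¹).2.2.symm⟩

/-- The morphism `Φ = ∇ξ : TN → 𝒯`. -/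
def Phi (x : N) (w : TangentSpace (𝓡 (m + 1)) x) : 𝒢.Tractor x := 𝒢.covDeriv 𝒢.xi x w

/-- The curvature `R(V, W)σ = ∇_V ∇_W σ - ∇_W ∇_V σ - ∇_{[V, W]} σ` of the tractor connection. -/
def curvature (V W : ∀ x : N, TangentSpace (𝓡 (m + 1)) x) (σ : ∀ x, 𝒢.Tractor x) (x : N) :
    𝒢.Tractor x :=
  𝒢.covDeriv (fun y => 𝒢.covDeriv σ y (W y)) x (V x) -
    𝒢.covDeriv (fun y => 𝒢.covDeriv σ y (V y)) x (W x) -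
    𝒢.covDeriv σ x (VectorField.mlieBracket (𝓡 (m + 1)) V W x)

/-! ### Screen forms and the decomposition of the tractor connection -/

/-- The set `S(N, h^ω, Z^ω)` of smooth `1`-forms `τ` with `τ(Z^ω) = 1`. -/
structure ScreenForm where
  /-- the underlying `1`-form -/
  form : ∀ x : N, TangentSpace (𝓡 (m + 1)) x →ₗ[ℝ] ℝ
  smooth : IsSmoothOneForm form
  form_Z : ∀ x, form x (𝒢.Z x) = 1

variable {𝒢}

namespace ScreenForm

variable (τ : 𝒢.ScreenForm)

/-- The spacelike projection `P^τ(v) = v - τ(v) Z^ω`. -/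
def proj (x : N) (v : TangentSpace (𝓡 (m + 1)) x) : TangentSpace (𝓡 (m + 1)) x :=
  v - τ.form x v • 𝒢.Z x

/-- The lightlike section `η^τ` of `𝒯`, uniquely determined by `𝐡(η^τ, η^τ) = 0`,
`𝐡(ξ, η^τ) = 1` and `𝐡(Φ(An τ), η^τ) = 0`. -/
def eta (x : N) : 𝒢.Tractor x :=
  Classical.epsilon fun t : 𝒢.Tractor x =>
    𝒢.tractorMetric x t t = 0 ∧ 𝒢.tractorMetric x (𝒢.xi x) t = 1 ∧
      ∀ v, τ.form x v = 0 → 𝒢.tractorMetric x (𝒢.Phi x v) t = 0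

/-- The component in `An τ` of an element of `𝒯`: the unique `X` with `τ(X) = 0` and
`t = 𝐡(t, η^τ) ξ + Φ(X) + 𝐡(t, ξ) η^τ`. -/
def screenPart (x : N) (t : 𝒢.Tractor x) : TangentSpace (𝓡 (m + 1)) x :=
  Classical.epsilon fun X : TangentSpace (𝓡 (m + 1)) x =>
    τ.form x X = 0 ∧
      t = 𝒢.tractorMetric x t (τ.eta x) • 𝒢.xi x + 𝒢.Phi x X +
        𝒢.tractorMetric x t (𝒢.xi x) • τ.eta x

/-- The connection `∇^τ` on `An τ`: `∇^τ_V X` is the `An τ`-component of `∇_V Φ(X)`. -/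
def screenConnection (V X : ∀ x : N, TangentSpace (𝓡 (m + 1)) x) (x : N) :
    TangentSpace (𝓡 (m + 1)) x :=
  τ.screenPart x (𝒢.covDeriv (fun y => 𝒢.Phi y (X y)) x (V x))

/-- The extension of `∇^τ` to vector fields on `N`:
`V(τ(W)) Z^ω + τ(W) P^τ(V) + ∇^τ_V (P^τ W)`. -/
def extendedConnection (V W : ∀ x : N, TangentSpace (𝓡 (m + 1)) x) (x : N) :
    TangentSpace (𝓡 (m + 1)) x :=
  dirDeriv (fun y => τ.form y (W y)) x (V x) • 𝒢.Z x + τ.form x (W x) • τ.proj x (V x) +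
    τ.screenConnection V (fun y => τ.proj y (W y)) x

/-- The map `D^τ : TN → An τ`: `D^τ(w)` is the `An τ`-component of `∇_w η^τ`. -/
def D (x : N) (w : TangentSpace (𝓡 (m + 1)) x) : TangentSpace (𝓡 (m + 1)) x :=
  τ.screenPart x (𝒢.covDeriv τ.eta x w)

/-- `(E₁, …, E_m)` is an `h^ω`-orthonormal basis of `An τ` at `x`. -/
def IsOrthonormalFrame (x : N) (E : Fin m → TangentSpace (𝓡 (m + 1)) x) : Prop :=
  (∀ i, τ.form x (E i) = 0) ∧ ∀ i j, 𝒢.h x (E i) (E j) = if i = j then 1 else 0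

/-- The vector field `L_{τ,τ'} = ∑ᵢ τ(Eᵢ) Eᵢ`, for any `h^ω`-orthonormal basis `(Eᵢ)` of
`An τ'`. -/
def L (τ' : 𝒢.ScreenForm) (x : N) : TangentSpace (𝓡 (m + 1)) x :=
  let E := Classical.epsilon (τ'.IsOrthonormalFrame x)
  ∑ i, τ.form x (E i) • E i

/-! ### Galilean connections -/

/-- `∇` is a Galilean connection on the Leibnizian spacetime `(N, τ, h^ω|An τ)`: a smooth linear
connection on `TN` with `∇τ = 0` that is metric on sections of `An τ`. Mathlib's argument order is
`∇ W x v` for `(∇_v W)(x)`. -/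
structure IsGalilean
    (nab : CovariantDerivative (𝓡 (m + 1)) (EuclideanSpace ℝ (Fin (m + 1)))
      (TangentSpace (𝓡 (m + 1)) : N → Type _)) : Prop where
  smooth : CovariantDerivative.ContMDiffCovariantDerivative nab ∞
  parallel : ∀ W, IsSmoothField W → ∀ x v,
    dirDeriv (fun y => τ.form y (W y)) x v = τ.form x (nab W x v)
  metric : ∀ X Y, IsSmoothField X → IsSmoothField Y →
    (∀ x, τ.form x (X x) = 0) → (∀ x, τ.form x (Y x) = 0) → ∀ x v,
    dirDeriv (fun y => 𝒢.h y (X y) (Y y)) x v =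
      𝒢.h x (nab X x v) (Y x) + 𝒢.h x (X x) (nab Y x v)

/-- The conditions imposed on `∇` by a vector-valued `2`-form `T`: vanishing gravitational field
`∇_Z Z = 0`, vanishing vorticity `rot Z = 0`, and torsion `P^τ ∘ T + dτ ⊗ Z`, where
`Z = Z^ω`. -/
structure SatisfiesConditions
    (T : ∀ x : N, TangentSpace (𝓡 (m + 1)) x →ₗ[ℝ] TangentSpace (𝓡 (m + 1)) x →ₗ[ℝ]
      TangentSpace (𝓡 (m + 1)) x)
    (nab : CovariantDerivative (𝓡 (m + 1)) (EuclideanSpace ℝ (Fin (m + 1)))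
      (TangentSpace (𝓡 (m + 1)) : N → Type _)) : Prop where
  gravitational : ∀ x, nab 𝒢.Z x (𝒢.Z x) = 0
  vorticity : ∀ x v w, τ.form x v = 0 → τ.form x w = 0 →
    𝒢.h x (nab 𝒢.Z x v) w - 𝒢.h x v (nab 𝒢.Z x w) = 0
  torsion : ∀ V W, IsSmoothField V → IsSmoothField W → ∀ x,
    nab.torsion x (V x) (W x) =
      τ.proj x (T x (V x) (W x)) + extDerivOneForm τ.form V W x • 𝒢.Z x

end ScreenForm

end CartanGeometry

end Lightlike

end

/-!
Everything on `N` is read off from the tractor bundle `𝒯` with its metric `𝐡`, its null section `ξ`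
and the soldering `Φ = ∇ξ`.

*Gauges.* In a local section `s` of the principal bundle, a section of `𝒯` becomes an
`ℝ^{m+2}`-valued function and `∇` becomes `d + s^*ω`. The axioms of a Cartan geometry give
`ω = Ad(ψ⁻¹) p^*(s^*ω) + ψ⁻¹ dψ` in a trivialization `u = s(p(u)) · ψ(u)` (`conn_eq_of_trivialization`),
hence the transformation law of `s^*ω`, so that `∇` may be computed in every gauge
(`covDeriv_apply_fib`). Leibniz rule and metricity of `∇` and all smoothness statements are then
calculus of functions with values in `ℝ^{m+2}`.

*The lightlike metric.* `Φ` is injective with image `ξ^⊥`, and `h^ω` is the pullback of `𝐡` by `Φ`,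
while `Φ(Z^ω) = ξ` (`h_eq`, `PhiL_Z`). So `h^ω` is positive semidefinite with radical `ℝ Z^ω`.

*The tensor `T^ω`.* For a vector field `W`, differentiating `𝐡(Φ(W), ξ) = 0` gives
`𝐡(∇_V Φ(W), ξ) = -h(V, W)`. Hence, if `𝐡(ξ, e) = 1`, the section `∇_V Φ(W) + h(V, W) e` lies in the
image of `Φ`, and so does its sum with any multiple of `ξ`; this defines linear connections on `TN`
(`connOp`). Since `h` is symmetric, the torsion `T` of such a connection (without multiple of `ξ`)
satisfies `Φ(T(V, W)) = ∇_V Φ(W) - ∇_W Φ(V) - Φ([V, W]) = R(V, W) ξ`; in particular `R(V, W) ξ` is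
tensorial and takes values in the image of `Φ`.

*The Galilean connection.* For `e = η^τ` and the multiple `(h(D^τ V, W) - τ(V) τ(W)) ξ` one obtains
a connection with `τ(∇_V W) = V(τ(W))` and with screen part equal to that of `∇_V Φ(W)`, i.e.
`∇̃^τ` (`galileanConnection_eq_extendedConnection`). Metricity of the tractor connection makes it
Galilean; `∇_V Z^ω = P^τ(V)`, and the torsion is computed from `R ξ` and from `∇τ = 0`. Two
solutions differ by a tensor with values in `An τ` which is symmetric (equal torsions) and skew
with respect to `h^ω` on `An τ` (metricity), and the conditions on `∇Z^ω` deal with the direction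
`Z^ω`: it vanishes by the argument that proves uniqueness of the Levi-Civita connection
(`eq_zero_of_skew_of_symm`).

*Change of `τ`.* The field `L = L_{τ,τ'}` represents `τ - τ'` with respect to `h^ω`, so
`η^{τ'} = η^τ - Φ(L) + ½ h(L, L) ξ` (`eta_change`); the law for `D` is the screen part of the
derivative of this identity.
-/

noncomputable section

set_option linter.unusedSectionVars false

namespace Lightlike

variable {m : ℕ}
variable {N P : Type*} [TopologicalSpace N] [ChartedSpace (EuclideanSpace ℝ (Fin (m + 1))) N]
  {F : Type*} [NormedAddCommGroup F] [NormedSpace ℝ F] [TopologicalSpace P] [ChartedSpace F P]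
  [IsManifold (𝓡 (m + 1)) ∞ N] [IsManifold 𝓘(ℝ, F) ∞ P]

/-! ### The Lorentzian product and the isotropy group -/

theorem lor_apply (v w : LorentzSpace m) :
    lor m v w = v.1 * w.2.2 + inner ℝ v.2.1 w.2.1 + v.2.2 * w.1 := rfl

theorem lor_comm (v w : LorentzSpace m) : lor m v w = lor m w v := by
  rw [lor_apply, lor_apply, real_inner_comm]; ring

theorem lor_ell_right (v : LorentzSpace m) : lor m v (ell m) = v.2.2 := by
  simp [lor_apply, ell]

theorem lor_toEnd (a : isotropy m) (v w : LorentzSpace m) :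
    lor m (toEnd m a v) (toEnd m a w) = lor m v w := a.2.1.1 v w

theorem toEnd_ell (a : isotropy m) : toEnd m a (ell m) = ell m := a.2.2

theorem toEnd_inv_apply_toEnd (a : isotropy m) (v : LorentzSpace m) :
    toEnd m a⁻¹ (toEnd m a v) = v := a.1.symm_apply_apply v

theorem toEnd_apply_toEnd_inv (a : isotropy m) (v : LorentzSpace m) :
    toEnd m a (toEnd m a⁻¹ v) = v := a.1.apply_symm_apply v

theorem toEnd_expH (A : lieH m) : toEnd m (expH m A) = NormedSpace.exp A.1 := rfl

/-- The Lorentzian product as a continuous bilinear map. -/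
def lorL (m : ℕ) : LorentzSpace m →L[ℝ] LorentzSpace m →L[ℝ] ℝ :=
  LinearMap.toContinuousLinearMap
    ((LinearMap.toContinuousLinearMap : (LorentzSpace m →ₗ[ℝ] ℝ) ≃ₗ[ℝ] _).toLinearMap ∘ₗ lor m)

theorem lorL_apply (v w : LorentzSpace m) : lorL m v w = lor m v w := rfl

section Calculus

variable {E' : Type*} [NormedAddCommGroup E'] [NormedSpace ℝ E']
  {H' : Type*} [TopologicalSpace H'] {I' : ModelWithCorners ℝ E' H'}
  {M : Type*} [TopologicalSpace M] [ChartedSpace H' M]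
  {E₁ E₂ E₃ : Type*} [NormedAddCommGroup E₁] [NormedSpace ℝ E₁] [NormedAddCommGroup E₂]
  [NormedSpace ℝ E₂] [NormedAddCommGroup E₃] [NormedSpace ℝ E₃]

/-- The Leibniz rule for a continuous bilinear pairing of vector-valued functions on a manifold. -/
theorem mvfderiv_bilinear (B : E₁ →L[ℝ] E₂ →L[ℝ] E₃) {f : M → E₁} {g : M → E₂} {x : M}
    (hf : MDifferentiableAt I' 𝓘(ℝ, E₁) f x) (hg : MDifferentiableAt I' 𝓘(ℝ, E₂) g x)
    (X : TangentSpace I' x) :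
    mvfderiv I' (fun y => B (f y) (g y)) x X =
      B (mvfderiv I' f x X) (g x) + B (f x) (mvfderiv I' g x X) := by
  have h : HasMFDerivAt I' 𝓘(ℝ, E₃) (fun y => B (f y) (g y)) x
      ((B.precompR E' (f x) (mvfderiv I' g x) + B.precompL E' (mvfderiv I' f x) (g x) :
        E' →L[ℝ] E₃)) := by
    refine ⟨B.continuous₂.continuousAt.comp (hf.continuousAt.prodMk hg.continuousAt), ?_⟩
    have := B.hasFDerivWithinAt_of_bilinear hf.hasMFDerivAt.2 hg.hasMFDerivAt.2
    simp only [writtenInExtChartAt, extChartAt_model_space_eq_id, PartialEquiv.refl_coe,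
      Function.comp_def, id, extChartAt_to_inv] at this ⊢
    exact this
  have h2 := h.mfderiv
  have h3 : mvfderiv I' (fun y => B (f y) (g y)) x X =
      (B.precompR E' (f x) (mvfderiv I' g x) + B.precompL E' (mvfderiv I' f x) (g x) :
        E' →L[ℝ] E₃) X := congrArg (fun L : E' →L[ℝ] E₃ => L X) h2
  rw [h3, add_comm]
  rfl

theorem MDifferentiableAt.bilinear (B : E₁ →L[ℝ] E₂ →L[ℝ] E₃) {f : M → E₁} {g : M → E₂} {x : M}
    (hf : MDifferentiableAt I' 𝓘(ℝ, E₁) f x) (hg : MDifferentiableAt I' 𝓘(ℝ, E₂) g x) :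
    MDifferentiableAt I' 𝓘(ℝ, E₃) (fun y => B (f y) (g y)) x :=
  (B.isBoundedBilinearMap.differentiableAt (f x, g x)).mdifferentiableAt.comp x
    (hf.prodMk_space hg)

theorem ContMDiffOn.bilinear {n : WithTop ℕ∞} {S : Set M} (B : E₁ →L[ℝ] E₂ →L[ℝ] E₃) {f : M → E₁}
    {g : M → E₂} (hf : ContMDiffOn I' 𝓘(ℝ, E₁) n f S) (hg : ContMDiffOn I' 𝓘(ℝ, E₂) n g S) :
    ContMDiffOn I' 𝓘(ℝ, E₃) n (fun y => B (f y) (g y)) S :=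
  (ContMDiffOn.clm_apply contMDiffOn_const hf).clm_apply hg

theorem mvfderiv_clm_apply {f : M → E₁ →L[ℝ] E₂} {g : M → E₁} {x : M}
    (hf : MDifferentiableAt I' 𝓘(ℝ, E₁ →L[ℝ] E₂) f x) (hg : MDifferentiableAt I' 𝓘(ℝ, E₁) g x)
    (X : TangentSpace I' x) :
    mvfderiv I' (fun y => f y (g y)) x X = mvfderiv I' f x X (g x) + f x (mvfderiv I' g x X) := by
  have h := mvfderiv_bilinear (ContinuousLinearMap.id ℝ (E₁ →L[ℝ] E₂)) hf hg X
  simpa only [ContinuousLinearMap.id_apply] using h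

theorem mvfderiv_clm_apply_const {f : M → E₁ →L[ℝ] E₂} {x : M}
    (hf : MDifferentiableAt I' 𝓘(ℝ, E₁ →L[ℝ] E₂) f x) (v : E₁) (X : TangentSpace I' x) :
    mvfderiv I' (fun y => f y v) x X = mvfderiv I' f x X v := by
  rw [mvfderiv_clm_apply hf mdifferentiableAt_const, mvfderiv_const]
  simp

theorem mvfderiv_congr_of_eventuallyEq {f g : M → E₁} {x : M} (h : f =ᶠ[𝓝 x] g) :
    mvfderiv I' f x = (mvfderiv I' g x : E' →L[ℝ] E₁) := by
  have : (mfderiv I' 𝓘(ℝ, E₁) f x : E' →L[ℝ] E₁) = mfderiv I' 𝓘(ℝ, E₁) g x := h.mfderiv_eq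
  exact this

end Calculus

/-- The logarithmic derivative `a⁻¹ da` of a differentiable family of elements of `H` takes values
in `𝔥`. -/
theorem inv_comp_mvfderiv_mem_lieH {E' : Type*} [NormedAddCommGroup E'] [NormedSpace ℝ E']
    {H' : Type*} [TopologicalSpace H'] {I' : ModelWithCorners ℝ E' H'}
    {M : Type*} [TopologicalSpace M] [ChartedSpace H' M]
    (a : M → isotropy m) (x : M)
    (ha : MDifferentiableAt I' 𝓘(ℝ, LorentzSpace m →L[ℝ] LorentzSpace m)
      (fun y => toEnd m (a y)) x) (X : TangentSpace I' x) :
    toEnd m (a x)⁻¹ ∘L (mvfderiv I' (fun y => toEnd m (a y)) x X) ∈ lieH m := by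
  have hlor : ∀ v w, lor m (mvfderiv I' (fun y => toEnd m (a y)) x X v) (toEnd m (a x) w) +
      lor m (toEnd m (a x) v) (mvfderiv I' (fun y => toEnd m (a y)) x X w) = 0 := by
    intro v w
    have hd : ∀ v, MDifferentiableAt I' 𝓘(ℝ, LorentzSpace m) (fun y => toEnd m (a y) v) x :=
      fun v => MDifferentiableAt.bilinear (ContinuousLinearMap.id ℝ _) ha mdifferentiableAt_const
    have h1 := mvfderiv_bilinear (lorL m) (hd v) (hd w) X
    rw [mvfderiv_clm_apply_const ha, mvfderiv_clm_apply_const ha] at h1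
    simp only [lorL_apply, lor_toEnd] at h1
    rw [mvfderiv_const] at h1
    exact h1.symm
  refine ⟨fun v w => ?_, ?_⟩
  · have := hlor v w
    rw [← lor_toEnd (a x)⁻¹, ← lor_toEnd (a x)⁻¹ (toEnd m (a x) v), toEnd_inv_apply_toEnd,
      toEnd_inv_apply_toEnd] at this
    exact this
  · have h1 : mvfderiv I' (fun y => toEnd m (a y)) x X (ell m) = 0 := by
      rw [← mvfderiv_clm_apply_const ha]
      simp only [toEnd_ell, mvfderiv_const]
      rfl
    simp [h1]
namespace CartanGeometry

variable (𝒢 : CartanGeometry m N P (F := F))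

/-! ### Local gauges and the gauge transformation of the Cartan connection -/

/-- A local gauge: a smooth section `s` of the bundle projection over an open set `U`. -/
structure IsGauge (s : N → P) (U : Set N) : Prop where
  isOpen : IsOpen U
  smooth : ContMDiffOn (𝓡 (m + 1)) 𝓘(ℝ, F) ∞ s U
  proj_eq : ∀ y ∈ U, 𝒢.proj (s y) = y

/-- The pullback `s^*ω` of the Cartan connection along a local gauge. -/
def gaugeForm (s : N → P) (x : N) : TangentSpace (𝓡 (m + 1)) x →ₗ[ℝ] lieG m :=
  𝒢.conn (s x) ∘ₗ (mfderiv (𝓡 (m + 1)) 𝓘(ℝ, F) s x).toLinearMap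

theorem gaugeForm_apply (s : N → P) (x : N) (w : TangentSpace (𝓡 (m + 1)) x) :
    𝒢.gaugeForm s x w = 𝒢.conn (s x) (mfderiv (𝓡 (m + 1)) 𝓘(ℝ, F) s x w) := rfl

variable {𝒢} in
theorem IsGauge.mdifferentiableAt {s : N → P} {U : Set N} (hs : 𝒢.IsGauge s U) {x : N}
    (hx : x ∈ U) : MDifferentiableAt (𝓡 (m + 1)) 𝓘(ℝ, F) s x :=
  (hs.smooth.contMDiffAt (hs.isOpen.mem_nhds hx)).mdifferentiableAt (by simp)

variable {𝒢} in
theorem IsGauge.mono {s : N → P} {U V : Set N} (hs : 𝒢.IsGauge s U) (hV : IsOpen V)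
    (hVU : V ⊆ U) : 𝒢.IsGauge s V :=
  ⟨hV, hs.smooth.mono hVU, fun y hy => hs.proj_eq y (hVU hy)⟩

variable {𝒢} in
theorem IsGauge.mfderiv_proj {s : N → P} {U : Set N} (hs : 𝒢.IsGauge s U) {x : N}
    (hx : x ∈ U) (w : TangentSpace (𝓡 (m + 1)) x) :
    mfderiv 𝓘(ℝ, F) (𝓡 (m + 1)) 𝒢.proj (s x) (mfderiv (𝓡 (m + 1)) 𝓘(ℝ, F) s x w) = w := by
  have h1 := mfderiv_comp_apply x ((𝒢.smooth_proj (s x)).mdifferentiableAt (by simp))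
    (hs.mdifferentiableAt hx) w
  have h2 : 𝒢.proj ∘ s =ᶠ[𝓝 x] id :=
    Filter.eventually_of_mem (hs.isOpen.mem_nhds hx) fun y hy => hs.proj_eq y hy
  rw [h2.mfderiv_eq, mfderiv_id] at h1
  exact h1.symm

/-- The neighbourhood on which the distinguished local section at `x` is a gauge. -/
theorem exists_localSection (x : N) : ∃ U : Set N, x ∈ U ∧ 𝒢.IsGauge (𝒢.localSection x) U ∧
    ∃ ψ : P → isotropy m,
      ContMDiffOn 𝓘(ℝ, F) 𝓘(ℝ, LorentzSpace m →L[ℝ] LorentzSpace m) ∞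
        (fun u => toEnd m (ψ u)) (𝒢.proj ⁻¹' U) ∧
      ∀ u ∈ 𝒢.proj ⁻¹' U, 𝒢.act (𝒢.localSection x (𝒢.proj u)) (ψ u) = u := by
  have h := (𝒢.locally_trivial x).choose_spec
  obtain ⟨ψ, h1, h2, h3, h4⟩ := h.2.2.choose_spec
  exact ⟨_, h.2.1, ⟨h.1, h1, h2⟩, ψ, h3, h4⟩

/-- The velocity of the fundamental curve `t ↦ u · exp(tA)` is the image of `A` under the partial
derivative of any smooth extension of the action. -/
theorem hasMFDerivAt_fundamental (u : P) (a : isotropy m) (A : lieH m)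
    {f : (LorentzSpace m →L[ℝ] LorentzSpace m) → P}
    (hf : MDifferentiableAt 𝓘(ℝ, LorentzSpace m →L[ℝ] LorentzSpace m) 𝓘(ℝ, F) f (toEnd m a))
    (hfa : ∀ᶠ b in 𝓝 (toEnd m a), ∀ c : isotropy m, toEnd m c = b → f b = 𝒢.act u c) :
    HasMFDerivAt 𝓘(ℝ, ℝ) 𝓘(ℝ, F) (fun t : ℝ => 𝒢.act (𝒢.act u a) (expH m (t • A))) 0
      ((mfderiv 𝓘(ℝ, LorentzSpace m →L[ℝ] LorentzSpace m) 𝓘(ℝ, F) f (toEnd m a)).comp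
        (ContinuousLinearMap.toSpanSingleton ℝ (toEnd m a ∘L A.1))) := by
  set γ : ℝ → (LorentzSpace m →L[ℝ] LorentzSpace m) :=
    fun t => toEnd m a ∘L toEnd m (expH m (t • A)) with hγ
  have h0 : γ 0 = toEnd m a := by
    simp only [hγ, toEnd_expH, zero_smul]
    rw [show ((0 : lieH m) : LorentzSpace m →L[ℝ] LorentzSpace m) = 0 from rfl,
      NormedSpace.exp_zero]
    rfl
  have hd : HasDerivAt γ (toEnd m a ∘L A.1) 0 := by
    have h1 := hasDerivAt_exp_smul_const A.1 (0 : ℝ)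
    rw [zero_smul ℝ A.1, NormedSpace.exp_zero, one_mul] at h1
    have h2 := ((ContinuousLinearMap.compL ℝ _ _ _ (toEnd m a)).hasFDerivAt
      (x := NormedSpace.exp ((0 : ℝ) • A.1))).comp_hasDerivAt (0 : ℝ) h1
    exact h2
  have hm : HasMFDerivAt 𝓘(ℝ, ℝ) 𝓘(ℝ, LorentzSpace m →L[ℝ] LorentzSpace m) γ 0
      (ContinuousLinearMap.toSpanSingleton ℝ (toEnd m a ∘L A.1)) := hd.hasFDerivAt.hasMFDerivAt
  rw [← h0] at hf hfa hm ⊢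
  have h3 := hf.hasMFDerivAt.comp 0 hm
  refine h3.congr_of_eventuallyEq ?_
  filter_upwards [hd.continuousAt.eventually hfa] with t ht
  rw [← 𝒢.act_mul]
  exact (ht _ rfl).symm

end CartanGeometry

theorem expH_zero_smul (A : lieH m) : expH m ((0 : ℝ) • A) = 1 := by
  refine Subtype.ext (ContinuousLinearEquiv.ext (funext fun v => ?_))
  change NormedSpace.exp ((0 : ℝ) • A.1) v = v
  rw [zero_smul ℝ A.1, NormedSpace.exp_zero]
  rfl

namespace CartanGeometry

variable (𝒢 : CartanGeometry m N P (F := F))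

/-- In a trivialization `u = s(p(u)) · ψ(u)` the Cartan connection is
`ω = Ad(ψ⁻¹) p^*(s^*ω) + ψ⁻¹ dψ`. -/
theorem conn_eq_of_trivialization {s : N → P} {U : Set N} (hs : 𝒢.IsGauge s U) {ψ : P → isotropy m}
    (hψ : ContMDiffOn 𝓘(ℝ, F) 𝓘(ℝ, LorentzSpace m →L[ℝ] LorentzSpace m) ∞
        (fun u => toEnd m (ψ u)) (𝒢.proj ⁻¹' U))
    (hact : ∀ u ∈ 𝒢.proj ⁻¹' U, 𝒢.act (s (𝒢.proj u)) (ψ u) = u)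
    {u : P} (hu : 𝒢.proj u ∈ U) (X : TangentSpace 𝓘(ℝ, F) u) :
    (𝒢.conn u X).1 = toEnd m (ψ u)⁻¹ ∘L
        (𝒢.gaugeForm s (𝒢.proj u) (mfderiv 𝓘(ℝ, F) (𝓡 (m + 1)) 𝒢.proj u X)).1 ∘L toEnd m (ψ u) +
      toEnd m (ψ u)⁻¹ ∘L mvfderiv 𝓘(ℝ, F) (fun u => toEnd m (ψ u)) u X := by
  have hUo : IsOpen (𝒢.proj ⁻¹' U) := hs.isOpen.preimage 𝒢.smooth_proj.continuous
  have hψd : MDifferentiableAt 𝓘(ℝ, F) 𝓘(ℝ, LorentzSpace m →L[ℝ] LorentzSpace m)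
      (fun u => toEnd m (ψ u)) u := (hψ.contMDiffAt (hUo.mem_nhds hu)).mdifferentiableAt (by simp)
  have hp : MDifferentiableAt 𝓘(ℝ, F) (𝓡 (m + 1)) 𝒢.proj u :=
    (𝒢.smooth_proj u).mdifferentiableAt (by simp)
  have hsp : MDifferentiableAt 𝓘(ℝ, F) 𝓘(ℝ, F) (fun u => s (𝒢.proj u)) u :=
    (hs.mdifferentiableAt hu).comp u hp
  set u₁ := s (𝒢.proj u) with hu₁
  obtain ⟨O, f, hO, hmem, hf, hfact⟩ := 𝒢.smooth_act u₁ (ψ u)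
  have hfd : MDifferentiableAt (𝓘(ℝ, F).prod 𝓘(ℝ, LorentzSpace m →L[ℝ] LorentzSpace m)) 𝓘(ℝ, F) f
      (u₁, toEnd m (ψ u)) :=
    (hf.contMDiffAt (hO.mem_nhds hmem)).mdifferentiableAt (by simp)
  have hfd1 : MDifferentiableAt 𝓘(ℝ, F) 𝓘(ℝ, F) (fun z => f (z, toEnd m (ψ u))) u₁ :=
    hfd.comp u₁ (mdifferentiableAt_id.prodMk mdifferentiableAt_const)
  have hfd2 : MDifferentiableAt 𝓘(ℝ, LorentzSpace m →L[ℝ] LorentzSpace m) 𝓘(ℝ, F)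
      (fun z => f (u₁, z)) (toEnd m (ψ u)) :=
    hfd.comp (toEnd m (ψ u)) (mdifferentiableAt_const.prodMk mdifferentiableAt_id)
  have hGd := hsp.prodMk hψd
  -- the identity of `P` near `u` is the composition of `f` with the trivialization
  have hid : (fun v => f (s (𝒢.proj v), toEnd m (ψ v))) =ᶠ[𝓝 u] id := by
    filter_upwards [hUo.mem_nhds hu, hGd.continuousAt.eventually (hO.mem_nhds hmem)] with v hv hv'
    rw [hfact _ _ hv', hact v hv]
    rfl
  set B : lieH m := ⟨_, inv_comp_mvfderiv_mem_lieH ψ u hψd X⟩ with hB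
  -- the first summand is a right translate of a vector tangent to `s`, the second is vertical
  have hX : X = mfderiv 𝓘(ℝ, F) 𝓘(ℝ, F) (fun z => f (z, toEnd m (ψ u))) u₁
        (mfderiv (𝓡 (m + 1)) 𝓘(ℝ, F) s (𝒢.proj u) (mfderiv 𝓘(ℝ, F) (𝓡 (m + 1)) 𝒢.proj u X)) +
      mfderiv 𝓘(ℝ, LorentzSpace m →L[ℝ] LorentzSpace m) 𝓘(ℝ, F) (fun z => f (u₁, z)) (toEnd m (ψ u))
        (mvfderiv 𝓘(ℝ, F) (fun u => toEnd m (ψ u)) u X) := by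
    have h1 := mfderiv_comp_apply u (g := f) hfd hGd X
    rw [show f ∘ (fun v => (s (𝒢.proj v), toEnd m (ψ v))) =
      (fun v => f (s (𝒢.proj v), toEnd m (ψ v))) from rfl, hid.mfderiv_eq, mfderiv_id,
      mfderiv_prod_eq_add_apply hfd, hsp.mfderiv_prod hψd] at h1
    have h2 := mfderiv_comp_apply u (hs.mdifferentiableAt hu) hp X
    rw [show (fun v => s (𝒢.proj v)) = s ∘ 𝒢.proj from rfl] at h1
    refine h1.trans ?_
    rw [← h2]
    rfl
  -- `TangentSpace` is unfolded here so that `conn` can be transported along equalities of points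
  let c : P → F →ₗ[ℝ] lieG m := fun v => 𝒢.conn v
  have hua : 𝒢.act u₁ (ψ u) = u := hact u hu
  have hev1 : (fun z => f (z, toEnd m (ψ u))) =ᶠ[𝓝 u₁] fun z => 𝒢.act z (ψ u) := by
    have hc : ContinuousAt (fun z : P => (z, toEnd m (ψ u))) u₁ := by fun_prop
    filter_upwards [hc.eventually (hO.mem_nhds hmem)] with z hz
    exact hfact _ _ hz
  have hev2 : ∀ᶠ b in 𝓝 (toEnd m (ψ u)), ∀ a : isotropy m, toEnd m a = b →
      f (u₁, b) = 𝒢.act u₁ a := by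
    have hc : ContinuousAt (fun b : LorentzSpace m →L[ℝ] LorentzSpace m => (u₁, b))
      (toEnd m (ψ u)) := by fun_prop
    filter_upwards [hc.eventually (hO.mem_nhds hmem)] with b hb
    rintro a rfl
    exact hfact _ _ hb
  set Y : TangentSpace 𝓘(ℝ, F) u₁ := mfderiv (𝓡 (m + 1)) 𝓘(ℝ, F) s (𝒢.proj u)
    (mfderiv 𝓘(ℝ, F) (𝓡 (m + 1)) 𝒢.proj u X) with hY
  -- `ω` of the two summands, by equivariance and by the normalization on fundamental fields
  have hhor := 𝒢.conn_equivariant u₁ (ψ u) Y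
  have hver := 𝒢.conn_fundamental (𝒢.act u₁ (ψ u)) B
  rw [(𝒢.hasMFDerivAt_fundamental u₁ (ψ u) B hfd2 hev2).mfderiv] at hver
  rw [← hev1.mfderiv_eq] at hhor
  change (c (𝒢.act u₁ (ψ u)) _).1 = _ at hhor hver
  rw [hua] at hhor hver
  have hBB : toEnd m (ψ u) ∘L B.1 = mvfderiv 𝓘(ℝ, F) (fun u => toEnd m (ψ u)) u X :=
    ContinuousLinearMap.ext fun v => toEnd_apply_toEnd_inv _ _
  have hver' : (c u (mfderiv 𝓘(ℝ, LorentzSpace m →L[ℝ] LorentzSpace m) 𝓘(ℝ, F)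
      (fun z => f (u₁, z)) (toEnd m (ψ u))
        (mvfderiv 𝓘(ℝ, F) (fun u => toEnd m (ψ u)) u X))).1 = B.1 := by
    refine Eq.trans ?_ hver
    rw [← hBB]
    congr 2
    change _ = mfderiv 𝓘(ℝ, LorentzSpace m →L[ℝ] LorentzSpace m) 𝓘(ℝ, F)
      (fun z => f (u₁, z)) (toEnd m (ψ u)) ((1 : ℝ) • (toEnd m (ψ u) ∘L B.1))
    rw [one_smul]
  calc (𝒢.conn u X).1 = (c u X).1 := rfl
    _ = _ := by
      conv_lhs => rw [hX]
      refine (congrArg Subtype.val (map_add (c u) _ _)).trans ?_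
      exact congrArg₂ (· + ·) hhor hver'

theorem mfderiv_proj_fundamental (u : P) (A : lieH m) :
    mfderiv 𝓘(ℝ, F) (𝓡 (m + 1)) 𝒢.proj u
      (mfderiv 𝓘(ℝ, ℝ) 𝓘(ℝ, F) (fun t : ℝ => 𝒢.act u (expH m (t • A))) 0 (1 : ℝ)) = 0 := by
  obtain ⟨O, f, hO, hmem, hf, hfact⟩ := 𝒢.smooth_act u 1
  have hfd : MDifferentiableAt (𝓘(ℝ, F).prod 𝓘(ℝ, LorentzSpace m →L[ℝ] LorentzSpace m)) 𝓘(ℝ, F) f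
      (u, toEnd m 1) :=
    (hf.contMDiffAt (hO.mem_nhds hmem)).mdifferentiableAt (by simp)
  have hfd2 : MDifferentiableAt 𝓘(ℝ, LorentzSpace m →L[ℝ] LorentzSpace m) 𝓘(ℝ, F)
      (fun z => f (u, z)) (toEnd m 1) :=
    hfd.comp (toEnd m 1) (mdifferentiableAt_const.prodMk mdifferentiableAt_id)
  have hev2 : ∀ᶠ b in 𝓝 (toEnd m 1), ∀ a : isotropy m, toEnd m a = b →
      f (u, b) = 𝒢.act u a := by
    have hc : ContinuousAt (fun b : LorentzSpace m →L[ℝ] LorentzSpace m => (u, b))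
      (toEnd m 1) := by fun_prop
    filter_upwards [hc.eventually (hO.mem_nhds hmem)] with b hb
    rintro a rfl
    exact hfact _ _ hb
  have hd := (𝒢.hasMFDerivAt_fundamental u 1 A hfd2 hev2).mdifferentiableAt
  simp only [𝒢.act_one] at hd
  have h0 : 𝒢.act u (expH m ((0 : ℝ) • A)) = u := by
    rw [expH_zero_smul, 𝒢.act_one]
  have h1 := mfderiv_comp_apply_of_eq (0 : ℝ) (y := u)
    ((𝒢.smooth_proj u).mdifferentiableAt (by simp)) hd h0 (1 : ℝ)
  rw [show 𝒢.proj ∘ (fun t : ℝ => 𝒢.act u (expH m (t • A))) = fun _ => 𝒢.proj u from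
    funext fun t => 𝒢.proj_act _ _, mfderiv_const] at h1
  exact h1.symm

/-- The kernel of `T_u p` contains `ω(u)⁻¹(𝔥)`. -/
theorem mfderiv_proj_eq_zero {u : P} {X : TangentSpace 𝓘(ℝ, F) u}
    (hX : (𝒢.conn u X).1 (ell m) = 0) : mfderiv 𝓘(ℝ, F) (𝓡 (m + 1)) 𝒢.proj u X = 0 := by
  set A : lieH m := ⟨(𝒢.conn u X).1, (𝒢.conn u X).2, hX⟩
  have h1 := 𝒢.conn_fundamental u A
  have h2 : X = mfderiv 𝓘(ℝ, ℝ) 𝓘(ℝ, F) (fun t : ℝ => 𝒢.act u (expH m (t • A))) 0 (1 : ℝ) :=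
    (𝒢.conn_bijective u).1 (Subtype.ext h1.symm)
  rw [h2]
  exact 𝒢.mfderiv_proj_fundamental u A

/-- The gauge transformation `s'^*ω = Ad(a⁻¹) s^*ω + a⁻¹ da` for `s' = s · a`. -/
theorem gaugeForm_of_trivialization {s : N → P} {U : Set N} (hs : 𝒢.IsGauge s U)
    {ψ : P → isotropy m}
    (hψ : ContMDiffOn 𝓘(ℝ, F) 𝓘(ℝ, LorentzSpace m →L[ℝ] LorentzSpace m) ∞
        (fun u => toEnd m (ψ u)) (𝒢.proj ⁻¹' U))
    (hact : ∀ u ∈ 𝒢.proj ⁻¹' U, 𝒢.act (s (𝒢.proj u)) (ψ u) = u)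
    {s' : N → P} {U' : Set N} (hs' : 𝒢.IsGauge s' U') {y : N} (hy : y ∈ U) (hy' : y ∈ U')
    (w : TangentSpace (𝓡 (m + 1)) y) :
    (𝒢.gaugeForm s' y w).1 = toEnd m (ψ (s' y))⁻¹ ∘L (𝒢.gaugeForm s y w).1 ∘L toEnd m (ψ (s' y)) +
      toEnd m (ψ (s' y))⁻¹ ∘L mvfderiv (𝓡 (m + 1)) (fun z => toEnd m (ψ (s' z))) y w := by
  have hpy : 𝒢.proj (s' y) = y := hs'.proj_eq y hy'
  have hu : 𝒢.proj (s' y) ∈ U := hpy.symm ▸ hy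
  have hUo : IsOpen (𝒢.proj ⁻¹' U) := hs.isOpen.preimage 𝒢.smooth_proj.continuous
  have hψd : MDifferentiableAt 𝓘(ℝ, F) 𝓘(ℝ, LorentzSpace m →L[ℝ] LorentzSpace m)
      (fun u => toEnd m (ψ u)) (s' y) :=
    (hψ.contMDiffAt (hUo.mem_nhds hu)).mdifferentiableAt (by simp)
  have h1 := 𝒢.conn_eq_of_trivialization hs hψ hact hu (mfderiv (𝓡 (m + 1)) 𝓘(ℝ, F) s' y w)
  have h2 : mvfderiv (𝓡 (m + 1)) (fun z => toEnd m (ψ (s' z))) y w =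
      mvfderiv 𝓘(ℝ, F) (fun u => toEnd m (ψ u)) (s' y) (mfderiv (𝓡 (m + 1)) 𝓘(ℝ, F) s' y w) :=
    mfderiv_comp_apply y hψd (hs'.mdifferentiableAt hy') w
  rw [h2]
  refine h1.trans ?_
  congr 3
  rw [hs'.mfderiv_proj hy' w]
  let c : N → EuclideanSpace ℝ (Fin (m + 1)) →ₗ[ℝ] lieG m := fun v => 𝒢.gaugeForm s v
  change (c (𝒢.proj (s' y)) w).1 = (c y w).1
  rw [hpy]

/-! ### The tractor bundle in a frame -/

variable {𝒢}

theorem fibAct_injective {x : N} (u : 𝒢.Fib x) {a b : isotropy m}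
    (h : 𝒢.fibAct u a = 𝒢.fibAct u b) : a = b := by
  have h1 : 𝒢.act u.1 a = 𝒢.act u.1 b := congrArg Subtype.val h
  have h2 : 𝒢.act u.1 (a * b⁻¹) = u.1 := by
    rw [𝒢.act_mul, h1, ← 𝒢.act_mul, mul_inv_cancel, 𝒢.act_one]
  exact mul_inv_eq_one.mp (𝒢.act_free _ _ h2)

theorem fibAct_one {x : N} (u : 𝒢.Fib x) : 𝒢.fibAct u 1 = u := Subtype.ext (𝒢.act_one u.1)

theorem cls_apply_fibAct {x : N} (u : 𝒢.Fib x) (v : LorentzSpace m) (a : isotropy m) :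
    (𝒢.cls u v).1 (𝒢.fibAct u a) = toEnd m a⁻¹ v := by
  have h := fibAct_injective u (𝒢.exists_fibAct_eq u (𝒢.fibAct u a)).choose_spec
  change toEnd m (𝒢.exists_fibAct_eq u (𝒢.fibAct u a)).choose⁻¹ v = _
  rw [h]

theorem cls_apply_self {x : N} (u : 𝒢.Fib x) (v : LorentzSpace m) : (𝒢.cls u v).1 u = v := by
  have h := cls_apply_fibAct u v 1
  rwa [fibAct_one, inv_one] at h

theorem Tractor.ext_at {x : N} (u : 𝒢.Fib x) {t t' : 𝒢.Tractor x} (h : t.1 u = t'.1 u) :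
    t = t' := by
  refine Subtype.ext (funext fun u' => ?_)
  obtain ⟨a, rfl⟩ := 𝒢.exists_fibAct_eq u u'
  rw [t.2, t'.2, h]

theorem tractorMetric_eq {x : N} (u : 𝒢.Fib x) (t t' : 𝒢.Tractor x) :
    𝒢.tractorMetric x t t' = lor m (t.1 u) (t'.1 u) := by
  obtain ⟨a, ha⟩ := 𝒢.exists_fibAct_eq u ⟨𝒢.localSection x x, 𝒢.proj_localSection x⟩
  rw [tractorMetric, ← ha, t.2, t'.2, lor_toEnd]

theorem coord_eq (σ : ∀ x, 𝒢.Tractor x) {u : P} {x : N} (h : 𝒢.proj u = x) :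
    𝒢.coord σ u = (σ x).1 ⟨u, h⟩ := by
  subst h; rfl

theorem coord_act (σ : ∀ x, 𝒢.Tractor x) (u : P) (a : isotropy m) :
    𝒢.coord σ (𝒢.act u a) = toEnd m a⁻¹ (𝒢.coord σ u) := by
  rw [coord_eq σ (𝒢.proj_act u a)]
  exact (σ (𝒢.proj u)).2 ⟨u, rfl⟩ a

theorem coord_xi (u : P) : 𝒢.coord 𝒢.xi u = ell m := rfl

/-- The point of the fibre over `y` selected by a gauge. -/
def IsGauge.fib {s : N → P} {U : Set N} (hs : 𝒢.IsGauge s U) {y : N} (hy : y ∈ U) : 𝒢.Fib y :=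
  ⟨s y, hs.proj_eq y hy⟩

theorem IsGauge.apply_fib {s : N → P} {U : Set N} (hs : 𝒢.IsGauge s U) {y : N} (hy : y ∈ U)
    (σ : ∀ x, 𝒢.Tractor x) : (σ y).1 (hs.fib hy) = 𝒢.coord σ (s y) :=
  (coord_eq σ _).symm

/-- The tractor connection may be computed in every gauge in which the section is
differentiable. -/
theorem covDeriv_apply_fib {s : N → P} {U : Set N} (hs : 𝒢.IsGauge s U) {y : N} (hy : y ∈ U)
    (σ : ∀ x, 𝒢.Tractor x)
    (hσ : MDifferentiableAt (𝓡 (m + 1)) 𝓘(ℝ, LorentzSpace m) (fun z => 𝒢.coord σ (s z)) y)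
    (w : TangentSpace (𝓡 (m + 1)) y) :
    (𝒢.covDeriv σ y w).1 (hs.fib hy) = mvfderiv (𝓡 (m + 1)) (fun z => 𝒢.coord σ (s z)) y w +
      (𝒢.gaugeForm s y w).1 (𝒢.coord σ (s y)) := by
  obtain ⟨U₀, hy₀, hs₀, ψ, hψ, hact⟩ := 𝒢.exists_localSection y
  set s₀ := 𝒢.localSection y with hs₀def
  have hpy : 𝒢.proj (s y) = y := hs.proj_eq y hy
  have hUo : IsOpen (𝒢.proj ⁻¹' U₀) := hs₀.isOpen.preimage 𝒢.smooth_proj.continuous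
  have hψd : MDifferentiableAt 𝓘(ℝ, F) 𝓘(ℝ, LorentzSpace m →L[ℝ] LorentzSpace m)
      (fun u => toEnd m (ψ u)) (s y) :=
    (hψ.contMDiffAt (hUo.mem_nhds (show 𝒢.proj (s y) ∈ U₀ from hpy.symm ▸ hy₀))).mdifferentiableAt
      (by simp)
  have had : MDifferentiableAt (𝓡 (m + 1)) 𝓘(ℝ, LorentzSpace m →L[ℝ] LorentzSpace m)
      (fun z => toEnd m (ψ (s z))) y := hψd.comp y (hs.mdifferentiableAt hy)
  have hact' : ∀ z ∈ U, z ∈ U₀ → 𝒢.act (s₀ z) (ψ (s z)) = s z := fun z hz hz₀ => by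
    have h := hact (s z) (show 𝒢.proj (s z) ∈ U₀ from (hs.proj_eq z hz).symm ▸ hz₀)
    rwa [hs.proj_eq z hz] at h
  have hev : (fun z => 𝒢.coord σ (s₀ z)) =ᶠ[𝓝 y]
      fun z => toEnd m (ψ (s z)) (𝒢.coord σ (s z)) := by
    filter_upwards [hs.isOpen.mem_nhds hy, hs₀.isOpen.mem_nhds hy₀] with z hz hz₀
    rw [← hact' z hz hz₀, coord_act, hact' z hz hz₀, toEnd_apply_toEnd_inv]
  have hfib : hs.fib hy = 𝒢.fibAct ⟨s₀ y, 𝒢.proj_localSection y⟩ (ψ (s y)) :=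
    Subtype.ext (hact' y hy hy₀).symm
  rw [hfib, covDeriv, cls_apply_fibAct, 𝒢.gaugeForm_of_trivialization hs₀ hψ hact hs hy₀ hy w]
  have hd : dirDeriv (fun z => 𝒢.coord σ (s₀ z)) y w =
      mvfderiv (𝓡 (m + 1)) (fun z => toEnd m (ψ (s z))) y w (𝒢.coord σ (s y)) +
      toEnd m (ψ (s y)) (mvfderiv (𝓡 (m + 1)) (fun z => 𝒢.coord σ (s z)) y w) := by
    rw [← mvfderiv_clm_apply had hσ, dirDeriv, mvfderiv_congr_of_eventuallyEq hev]
  have h0 : 𝒢.coord σ (s₀ y) = toEnd m (ψ (s y)) (𝒢.coord σ (s y)) := hev.self_of_nhds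
  rw [hd, h0, map_add, map_add, toEnd_inv_apply_toEnd]
  simp only [gaugeForm_apply, add_apply, ContinuousLinearMap.comp_apply]
  abel

theorem dirDeriv_eq {W : Type*} [NormedAddCommGroup W] [NormedSpace ℝ W] (f : N → W) (x : N)
    (v : TangentSpace (𝓡 (m + 1)) x) : dirDeriv f x v = mvfderiv (𝓡 (m + 1)) f x v := rfl

/-- The covariant derivative at `x` in the distinguished gauge at `x`; no differentiability is
needed. -/
theorem covDeriv_apply_localSection (σ : ∀ x, 𝒢.Tractor x) (x : N)
    (w : TangentSpace (𝓡 (m + 1)) x) :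
    (𝒢.covDeriv σ x w).1 ⟨𝒢.localSection x x, 𝒢.proj_localSection x⟩ =
      mvfderiv (𝓡 (m + 1)) (fun z => 𝒢.coord σ (𝒢.localSection x z)) x w +
      (𝒢.gaugeForm (𝒢.localSection x) x w).1 (𝒢.coord σ (𝒢.localSection x x)) :=
  cls_apply_self _ _

theorem Phi_apply_fib {s : N → P} {U : Set N} (hs : 𝒢.IsGauge s U) {y : N} (hy : y ∈ U)
    (w : TangentSpace (𝓡 (m + 1)) y) :
    (𝒢.Phi y w).1 (hs.fib hy) = (𝒢.gaugeForm s y w).1 (ell m) := by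
  rw [Phi, covDeriv_apply_fib hs hy _ (by simpa only [coord_xi] using mdifferentiableAt_const)]
  simp only [coord_xi, mvfderiv_const]
  simp

/-! ### The soldering of the tangent bundle to the tractor bundle -/

/-- The tractor metric as a bilinear form. -/
def metricForm (𝒢 : CartanGeometry m N P (F := F)) (x : N) :
    𝒢.Tractor x →ₗ[ℝ] 𝒢.Tractor x →ₗ[ℝ] ℝ :=
  (lor m).compl₁₂
    ((LinearMap.proj ⟨𝒢.localSection x x, 𝒢.proj_localSection x⟩ :
      (𝒢.Fib x → LorentzSpace m) →ₗ[ℝ] LorentzSpace m) ∘ₗ (𝒢.Tractor x).subtype)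
    ((LinearMap.proj ⟨𝒢.localSection x x, 𝒢.proj_localSection x⟩ :
      (𝒢.Fib x → LorentzSpace m) →ₗ[ℝ] LorentzSpace m) ∘ₗ (𝒢.Tractor x).subtype)

theorem tractorMetric_eq_metricForm (x : N) (t t' : 𝒢.Tractor x) :
    𝒢.tractorMetric x t t' = 𝒢.metricForm x t t' := rfl

theorem metricForm_eq {x : N} (u : 𝒢.Fib x) (t t' : 𝒢.Tractor x) :
    𝒢.metricForm x t t' = lor m (t.1 u) (t'.1 u) := tractorMetric_eq u t t'

theorem metricForm_comm {x : N} (t t' : 𝒢.Tractor x) :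
    𝒢.metricForm x t t' = 𝒢.metricForm x t' t := lor_comm _ _

theorem exists_fib (𝒢 : CartanGeometry m N P (F := F)) (x : N) : Nonempty (𝒢.Fib x) :=
  ⟨⟨𝒢.localSection x x, 𝒢.proj_localSection x⟩⟩

theorem metricForm_xi_right {x : N} (u : 𝒢.Fib x) (t : 𝒢.Tractor x) :
    𝒢.metricForm x t (𝒢.xi x) = (t.1 u).2.2 := by
  rw [metricForm_eq u]; exact lor_ell_right _

theorem metricForm_xi_xi (x : N) : 𝒢.metricForm x (𝒢.xi x) (𝒢.xi x) = 0 := by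
  obtain ⟨u⟩ := 𝒢.exists_fib x
  rw [metricForm_xi_right u]; rfl

theorem lieG_ell (A : lieG m) : (A.1 (ell m)).2.2 = 0 := by
  have h := A.2 (ell m) (ell m)
  rw [lor_comm (ell m), lor_ell_right] at h
  linarith

/-- The tractor connection in a fixed section, as a linear map of the direction. -/
def covDerivL (σ : ∀ x, 𝒢.Tractor x) (x : N) : TangentSpace (𝓡 (m + 1)) x →ₗ[ℝ] 𝒢.Tractor x where
  toFun w := 𝒢.covDeriv σ x w
  map_add' v w := by
    refine Tractor.ext_at ⟨𝒢.localSection x x, 𝒢.proj_localSection x⟩ ?_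
    change _ = (𝒢.covDeriv σ x v).1 _ + (𝒢.covDeriv σ x w).1 _
    simp only [covDeriv_apply_localSection, map_add]
    change _ + (_ + _ : LorentzSpace m) = _
    abel
  map_smul' c w := by
    refine Tractor.ext_at ⟨𝒢.localSection x x, 𝒢.proj_localSection x⟩ ?_
    change _ = c • (𝒢.covDeriv σ x w).1 _
    simp only [covDeriv_apply_localSection, map_smul, smul_add]
    rfl

/-- The soldering `Φ : T_xN → 𝒯_x` as a linear map. -/
def PhiL (𝒢 : CartanGeometry m N P (F := F)) (x : N) :
    TangentSpace (𝓡 (m + 1)) x →ₗ[ℝ] 𝒢.Tractor x := covDerivL 𝒢.xi x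

theorem PhiL_apply (x : N) (w : TangentSpace (𝓡 (m + 1)) x) : 𝒢.PhiL x w = 𝒢.Phi x w := rfl

theorem PhiL_apply_fib {s : N → P} {U : Set N} (hs : 𝒢.IsGauge s U) {y : N} (hy : y ∈ U)
    (w : TangentSpace (𝓡 (m + 1)) y) :
    (𝒢.PhiL y w).1 (hs.fib hy) = (𝒢.gaugeForm s y w).1 (ell m) := Phi_apply_fib hs hy w

/-- `Φ ∘ T_u p = ω(u) ℓ` in the frame `u`. -/
theorem PhiL_mfderiv_proj {u : P} {x : N} (h : 𝒢.proj u = x) (X : TangentSpace 𝓘(ℝ, F) u) :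
    (𝒢.PhiL x (mfderiv 𝓘(ℝ, F) (𝓡 (m + 1)) 𝒢.proj u X : EuclideanSpace ℝ (Fin (m + 1)))).1 ⟨u, h⟩ =
      (𝒢.conn u X).1 (ell m) := by
  subst h
  obtain ⟨U₀, hy₀, hs₀, ψ, hψ, hact⟩ := 𝒢.exists_localSection (𝒢.proj u)
  have hfib : (⟨u, rfl⟩ : 𝒢.Fib (𝒢.proj u)) = 𝒢.fibAct (hs₀.fib hy₀) (ψ u) :=
    Subtype.ext (hact u hy₀).symm
  have hUo : IsOpen (𝒢.proj ⁻¹' U₀) := hs₀.isOpen.preimage 𝒢.smooth_proj.continuous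
  have hψd : MDifferentiableAt 𝓘(ℝ, F) 𝓘(ℝ, LorentzSpace m →L[ℝ] LorentzSpace m)
      (fun u => toEnd m (ψ u)) u := (hψ.contMDiffAt (hUo.mem_nhds hy₀)).mdifferentiableAt (by simp)
  rw [𝒢.conn_eq_of_trivialization hs₀ hψ hact hy₀ X, add_apply,
    (inv_comp_mvfderiv_mem_lieH ψ u hψd X).2, add_zero, ContinuousLinearMap.comp_apply,
    ContinuousLinearMap.comp_apply, toEnd_ell, hfib, (𝒢.PhiL _ _).2]
  congr 1
  exact PhiL_apply_fib hs₀ hy₀ _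

theorem metricForm_PhiL_xi (x : N) (w : TangentSpace (𝓡 (m + 1)) x) :
    𝒢.metricForm x (𝒢.PhiL x w) (𝒢.xi x) = 0 := by
  obtain ⟨U₀, hy₀, hs₀, -⟩ := 𝒢.exists_localSection x
  rw [metricForm_xi_right (hs₀.fib hy₀), PhiL_apply_fib, lieG_ell]

theorem PhiL_injective (x : N) : Function.Injective (𝒢.PhiL x) := by
  rw [injective_iff_map_eq_zero]
  intro w hw
  obtain ⟨U₀, hy₀, hs₀, -⟩ := 𝒢.exists_localSection x
  have h := PhiL_apply_fib hs₀ hy₀ w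
  rw [hw, gaugeForm_apply] at h
  rw [← hs₀.mfderiv_proj hy₀ w]
  exact 𝒢.mfderiv_proj_eq_zero h.symm

/-- The soldering form `T_yN → 𝔤/𝔥` of a local gauge. -/
def gaugeSolder (𝒢 : CartanGeometry m N P (F := F)) (s : N → P) (y : N) :
    TangentSpace (𝓡 (m + 1)) y →ₗ[ℝ] ℝ × EuclideanSpace ℝ (Fin m) :=
  projGH m ∘ₗ 𝒢.gaugeForm s y

theorem ell_eq_of_projGH (A : lieG m) :
    A.1 (ell m) = ((projGH m A).1, (projGH m A).2, 0) :=
  Prod.ext rfl (Prod.ext rfl (lieG_ell A))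

theorem gaugeSolder_injective {s : N → P} {U : Set N} (hs : 𝒢.IsGauge s U) {y : N} (hy : y ∈ U) :
    Function.Injective (𝒢.gaugeSolder s y) := by
  rw [injective_iff_map_eq_zero]
  intro w hw
  refine PhiL_injective (𝒢 := 𝒢) y ?_
  rw [map_zero]
  refine Tractor.ext_at (hs.fib hy) ?_
  have hw' : projGH m (𝒢.gaugeForm s y w) = 0 := hw
  rw [PhiL_apply_fib hs hy, ell_eq_of_projGH, hw']
  rfl

instance (x : N) : FiniteDimensional ℝ (TangentSpace (𝓡 (m + 1)) x) :=
  inferInstanceAs (FiniteDimensional ℝ (EuclideanSpace ℝ (Fin (m + 1))))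

theorem gaugeSolder_bijective {s : N → P} {U : Set N} (hs : 𝒢.IsGauge s U) {y : N} (hy : y ∈ U) :
    Function.Bijective (𝒢.gaugeSolder s y) := by
  refine ⟨gaugeSolder_injective hs hy, ?_⟩
  refine (LinearMap.injective_iff_surjective_of_finrank_eq_finrank ?_).1
    (gaugeSolder_injective hs hy)
  have : Module.finrank ℝ (TangentSpace (𝓡 (m + 1)) y) =
      Module.finrank ℝ (EuclideanSpace ℝ (Fin (m + 1))) := rfl
  rw [this]
  simp [add_comm]

/-- `Φ` maps onto the orthogonal complement of `ξ`. -/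
theorem exists_PhiL_eq {x : N} {t : 𝒢.Tractor x} (ht : 𝒢.metricForm x t (𝒢.xi x) = 0) :
    ∃ w, 𝒢.PhiL x w = t := by
  obtain ⟨U₀, hy₀, hs₀, -⟩ := 𝒢.exists_localSection x
  obtain ⟨w, hw⟩ := (gaugeSolder_bijective hs₀ hy₀).2
    ((t.1 (hs₀.fib hy₀)).1, (t.1 (hs₀.fib hy₀)).2.1)
  refine ⟨w, Tractor.ext_at (hs₀.fib hy₀) ?_⟩
  have hw' : projGH m (𝒢.gaugeForm _ _ w) = _ := hw
  rw [metricForm_xi_right (hs₀.fib hy₀)] at ht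
  rw [PhiL_apply_fib, ell_eq_of_projGH, hw']
  exact Prod.ext rfl (Prod.ext rfl ht.symm)

/-- A linear left inverse of `Φ`; on the orthogonal complement of `ξ` it is the inverse of `Φ`. -/
def PhiInv (𝒢 : CartanGeometry m N P (F := F)) (x : N) :
    𝒢.Tractor x →ₗ[ℝ] TangentSpace (𝓡 (m + 1)) x :=
  (LinearMap.exists_leftInverse_of_injective (𝒢.PhiL x)
    (LinearMap.ker_eq_bot.2 (PhiL_injective x))).choose

theorem PhiInv_PhiL (x : N) (w : TangentSpace (𝓡 (m + 1)) x) : 𝒢.PhiInv x (𝒢.PhiL x w) = w :=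
  LinearMap.congr_fun (LinearMap.exists_leftInverse_of_injective (𝒢.PhiL x)
    (LinearMap.ker_eq_bot.2 (PhiL_injective x))).choose_spec w

theorem PhiL_PhiInv {x : N} {t : 𝒢.Tractor x} (ht : 𝒢.metricForm x t (𝒢.xi x) = 0) :
    𝒢.PhiL x (𝒢.PhiInv x t) = t := by
  obtain ⟨w, rfl⟩ := exists_PhiL_eq ht
  rw [PhiInv_PhiL]

theorem h_eq (x : N) (v w : TangentSpace (𝓡 (m + 1)) x) :
    𝒢.h x v w = 𝒢.metricForm x (𝒢.PhiL x v) (𝒢.PhiL x w) := by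
  obtain ⟨U₀, hy₀, hs₀, -⟩ := 𝒢.exists_localSection x
  rw [metricForm_eq (hs₀.fib hy₀), PhiL_apply_fib, PhiL_apply_fib, lor_apply, lieG_ell, lieG_ell]
  simp only [mul_zero, zero_mul, zero_add, add_zero]
  rfl

theorem PhiL_Z (x : N) : 𝒢.PhiL x (𝒢.Z x) = 𝒢.xi x := by
  refine Tractor.ext_at ⟨𝒢.localSection x x, 𝒢.proj_localSection x⟩ ?_
  refine (PhiL_mfderiv_proj (𝒢.proj_localSection x) _).trans ?_
  have := (LinearEquiv.ofBijective (𝒢.conn (𝒢.localSection x x))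
      (𝒢.conn_bijective (𝒢.localSection x x))).apply_symm_apply (gradingElement m)
  rw [LinearEquiv.ofBijective_apply] at this
  rw [this]
  simp [gradingElement, ell, xi]

theorem h_symm (x : N) (v w : TangentSpace (𝓡 (m + 1)) x) : 𝒢.h x v w = 𝒢.h x w v := by
  rw [h_eq, h_eq, metricForm_comm]

theorem h_Z_left (x : N) (w : TangentSpace (𝓡 (m + 1)) x) : 𝒢.h x (𝒢.Z x) w = 0 := by
  rw [h_eq, PhiL_Z, metricForm_comm, metricForm_PhiL_xi]

theorem h_Z_right (x : N) (w : TangentSpace (𝓡 (m + 1)) x) : 𝒢.h x w (𝒢.Z x) = 0 := by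
  rw [h_symm, h_Z_left]

theorem h_apply_gauge {s : N → P} {U : Set N} (hs : 𝒢.IsGauge s U) {y : N} (hy : y ∈ U)
    (v w : TangentSpace (𝓡 (m + 1)) y) :
    𝒢.h y v w = inner ℝ (𝒢.gaugeSolder s y v).2 (𝒢.gaugeSolder s y w).2 := by
  rw [h_eq, metricForm_eq (hs.fib hy), PhiL_apply_fib, PhiL_apply_fib, lor_apply, lieG_ell,
    lieG_ell]
  simp only [mul_zero, zero_mul, zero_add, add_zero]
  rfl

theorem h_nonneg (x : N) (v : TangentSpace (𝓡 (m + 1)) x) : 0 ≤ 𝒢.h x v v := by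
  obtain ⟨U₀, hy₀, hs₀, -⟩ := 𝒢.exists_localSection x
  rw [h_apply_gauge hs₀ hy₀]
  exact real_inner_self_nonneg

theorem gaugeSolder_Z {s : N → P} {U : Set N} (hs : 𝒢.IsGauge s U) {y : N} (hy : y ∈ U) :
    𝒢.gaugeSolder s y (𝒢.Z y) = (1, 0) := by
  have h := PhiL_apply_fib hs hy (𝒢.Z y)
  rw [PhiL_Z, ell_eq_of_projGH] at h
  have h' : ell m = ((𝒢.gaugeSolder s y (𝒢.Z y)).1, (𝒢.gaugeSolder s y (𝒢.Z y)).2, 0) := h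
  exact Prod.ext (congrArg Prod.fst h').symm (congrArg (fun v => v.2.1) h').symm

/-- A vector of zero length is a multiple of `Z^ω`. -/
theorem exists_eq_smul_Z {x : N} {v : TangentSpace (𝓡 (m + 1)) x} (hv : 𝒢.h x v v = 0) :
    ∃ c : ℝ, v = c • 𝒢.Z x := by
  obtain ⟨U₀, hy₀, hs₀, -⟩ := 𝒢.exists_localSection x
  rw [h_apply_gauge hs₀ hy₀, inner_self_eq_zero] at hv
  refine ⟨(𝒢.gaugeSolder (𝒢.localSection x) x v).1, gaugeSolder_injective hs₀ hy₀ ?_⟩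
  rw [map_smul, gaugeSolder_Z hs₀ hy₀]
  exact Prod.ext (by simp) (by simp [hv])

theorem ker_h (x : N) : LinearMap.ker (𝒢.h x) = Submodule.span ℝ {𝒢.Z x} := by
  ext v
  rw [LinearMap.mem_ker, Submodule.mem_span_singleton]
  constructor
  · intro hv
    obtain ⟨c, hc⟩ := exists_eq_smul_Z (v := v) (by rw [hv]; rfl)
    exact ⟨c, hc.symm⟩
  · rintro ⟨c, rfl⟩
    ext w
    simp [h_Z_left]

theorem Z_ne_zero (x : N) : 𝒢.Z x ≠ 0 := by
  intro h
  obtain ⟨U₀, hy₀, hs₀, -⟩ := 𝒢.exists_localSection x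
  have h1 := gaugeSolder_Z hs₀ hy₀
  rw [h, map_zero] at h1
  exact zero_ne_one (congrArg Prod.fst h1)

theorem finrank_ker_h (x : N) : Module.finrank ℝ (LinearMap.ker (𝒢.h x)) = 1 := by
  rw [ker_h, finrank_span_singleton (Z_ne_zero x)]

theorem h_mfderiv_proj (u : P) (X Y : TangentSpace 𝓘(ℝ, F) u) :
    𝒢.h (𝒢.proj u) (mfderiv 𝓘(ℝ, F) (𝓡 (m + 1)) 𝒢.proj u X)
        (mfderiv 𝓘(ℝ, F) (𝓡 (m + 1)) 𝒢.proj u Y) =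
      qform m (projGH m (𝒢.conn u X)) (projGH m (𝒢.conn u Y)) := by
  rw [h_eq, metricForm_eq ⟨u, rfl⟩, PhiL_mfderiv_proj rfl, PhiL_mfderiv_proj rfl, lor_apply,
    lieG_ell, lieG_ell]
  simp only [mul_zero, zero_mul, zero_add, add_zero]
  rfl

theorem mfderiv_proj_eq_Z (u : P) (X : TangentSpace 𝓘(ℝ, F) u)
    (hX : 𝒢.conn u X = gradingElement m) :
    mfderiv 𝓘(ℝ, F) (𝓡 (m + 1)) 𝒢.proj u X = 𝒢.Z (𝒢.proj u) := by
  refine PhiL_injective _ (Tractor.ext_at ⟨u, rfl⟩ ?_)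
  refine (PhiL_mfderiv_proj rfl X).trans ?_
  rw [PhiL_Z, hX]
  simp [gradingElement, ell, xi]

/-! ### Screen forms: the null section `η^τ` and the screen projection -/

theorem metricForm_xi_PhiL (x : N) (w : TangentSpace (𝓡 (m + 1)) x) :
    𝒢.metricForm x (𝒢.xi x) (𝒢.PhiL x w) = 0 := by
  rw [metricForm_comm, metricForm_PhiL_xi]

/-- The orthogonal complement of `Φ(T_xN) = ξ^⊥` is spanned by `ξ`. -/
theorem exists_eq_smul_xi {x : N} {t : 𝒢.Tractor x}
    (ht : ∀ v, 𝒢.metricForm x (𝒢.PhiL x v) t = 0) : ∃ c : ℝ, t = c • 𝒢.xi x := by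
  have h1 : 𝒢.metricForm x t (𝒢.xi x) = 0 := by
    rw [metricForm_comm, ← PhiL_Z, ht]
  obtain ⟨w, rfl⟩ := exists_PhiL_eq h1
  obtain ⟨c, hc⟩ := exists_eq_smul_Z (𝒢 := 𝒢) (v := w) (by rw [h_eq, ht])
  exact ⟨c, by rw [hc, map_smul, PhiL_Z]⟩

/-- The Euclidean part of the coordinates of `η^τ` in a gauge `s`: its entries are the values of `τ`
on the vectors that the soldering form of `s` maps to `(0, e_i)`. -/
def etaGauge (s : N → P) (τ : 𝒢.ScreenForm) {U : Set N} (hs : 𝒢.IsGauge s U) {y : N} (hy : y ∈ U) :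
    EuclideanSpace ℝ (Fin m) :=
  ∑ i, τ.form y ((LinearEquiv.ofBijective _ (gaugeSolder_bijective hs hy)).symm
    (0, EuclideanSpace.basisFun (Fin m) ℝ i)) • EuclideanSpace.basisFun (Fin m) ℝ i

/-- The null vector of `ℝ^{m+2}` with `n`-component `1` and Euclidean component `y`. -/
def nullVector (y : EuclideanSpace ℝ (Fin m)) : LorentzSpace m := (-(1 / 2) * inner ℝ y y, y, 1)

namespace ScreenForm

variable (τ : 𝒢.ScreenForm)

/-- In a gauge, `τ` is `(a, X) ↦ a + ⟨X, y⟩` with `y` the vector of components of `τ`. -/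
theorem form_eq_gauge {s : N → P} {U : Set N} (hs : 𝒢.IsGauge s U) {y : N} (hy : y ∈ U)
    (v : TangentSpace (𝓡 (m + 1)) y) :
    τ.form y v = (𝒢.gaugeSolder s y v).1 +
      inner ℝ (𝒢.gaugeSolder s y v).2 (etaGauge s τ hs hy) := by
  set e := LinearEquiv.ofBijective _ (gaugeSolder_bijective hs hy) with he
  have hev : ∀ v, e v = 𝒢.gaugeSolder s y v := fun v => rfl
  obtain ⟨p, rfl⟩ := e.symm.surjective v
  rw [← hev, e.apply_symm_apply]
  have h1 : p = p.1 • ((1, 0) : ℝ × EuclideanSpace ℝ (Fin m)) +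
      ∑ i, inner ℝ (EuclideanSpace.basisFun (Fin m) ℝ i) p.2 •
        ((0, EuclideanSpace.basisFun (Fin m) ℝ i) : ℝ × EuclideanSpace ℝ (Fin m)) := by
    refine Prod.ext ?_ ?_
    · simp [Prod.fst_sum]
    · rw [Prod.snd_add, Prod.snd_sum]
      simp only [Prod.smul_snd, smul_zero, zero_add]
      exact ((EuclideanSpace.basisFun (Fin m) ℝ).sum_repr' p.2).symm
  have h2 : e.symm (1, 0) = 𝒢.Z y := by
    rw [LinearEquiv.symm_apply_eq, hev, gaugeSolder_Z hs hy]
  conv_lhs => rw [h1]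
  rw [map_add, map_add, map_smul, map_smul, h2, τ.form_Z, map_sum, map_sum, etaGauge, inner_sum]
  simp only [map_smul, smul_eq_mul, mul_one, inner_smul_right]
  congr 1
  refine Finset.sum_congr rfl fun i _ => ?_
  rw [real_inner_comm, mul_comm]

theorem nullVector_spec {s : N → P} {U : Set N} (hs : 𝒢.IsGauge s U) {y : N} (hy : y ∈ U) :
    𝒢.metricForm y (𝒢.cls (hs.fib hy) (nullVector (etaGauge s τ hs hy)))
      (𝒢.cls (hs.fib hy) (nullVector (etaGauge s τ hs hy))) = 0 ∧
    𝒢.metricForm y (𝒢.xi y) (𝒢.cls (hs.fib hy) (nullVector (etaGauge s τ hs hy))) = 1 ∧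
    ∀ v, 𝒢.metricForm y (𝒢.PhiL y v) (𝒢.cls (hs.fib hy) (nullVector (etaGauge s τ hs hy))) =
      τ.form y v := by
  refine ⟨?_, ?_, fun v => ?_⟩
  · rw [metricForm_eq (hs.fib hy), cls_apply_self, lor_apply]
    simp only [nullVector]
    ring
  · rw [metricForm_comm, metricForm_xi_right (hs.fib hy), cls_apply_self]
    rfl
  · rw [metricForm_eq (hs.fib hy), cls_apply_self, PhiL_apply_fib, ell_eq_of_projGH, lor_apply,
      τ.form_eq_gauge hs hy]
    simp [nullVector, gaugeSolder]

/-- The defining properties of `η^τ`; the last one is equivalent to `𝐡(Φ(An τ), η^τ) = 0` because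
`Φ(Z^ω) = ξ`. -/
theorem eta_unique {x : N} {t t' : 𝒢.Tractor x} (h1 : 𝒢.metricForm x t t = 0)
    (h2 : ∀ v, 𝒢.metricForm x (𝒢.PhiL x v) t = τ.form x v)
    (h1' : 𝒢.metricForm x t' t' = 0)
    (h2' : ∀ v, 𝒢.metricForm x (𝒢.PhiL x v) t' = τ.form x v) : t = t' := by
  obtain ⟨c, hc⟩ := exists_eq_smul_xi (t := t - t') fun v => by rw [map_sub, h2, h2', sub_self]
  have ht : t = t' + c • 𝒢.xi x := by rw [← hc]; abel
  have h3 := h2' (𝒢.Z x)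
  rw [PhiL_Z, τ.form_Z] at h3
  rw [ht] at h1
  simp only [map_add, map_smul, LinearMap.add_apply, LinearMap.smul_apply, h1', metricForm_xi_xi,
    metricForm_comm t' (𝒢.xi x), h3, smul_eq_mul] at h1
  have : c = 0 := by linarith
  rw [ht, this, zero_smul, add_zero]

theorem form_eq_add_proj (x : N) (v : TangentSpace (𝓡 (m + 1)) x) :
    v = τ.form x v • 𝒢.Z x + τ.proj x v := by
  rw [proj]; abel

theorem form_proj (x : N) (v : TangentSpace (𝓡 (m + 1)) x) : τ.form x (τ.proj x v) = 0 := by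
  rw [proj, map_sub, map_smul, τ.form_Z, smul_eq_mul, mul_one, sub_self]

theorem proj_of_form_eq_zero {x : N} {v : TangentSpace (𝓡 (m + 1)) x} (hv : τ.form x v = 0) :
    τ.proj x v = v := by
  rw [proj, hv, zero_smul, sub_zero]

theorem eta_spec (x : N) : 𝒢.metricForm x (τ.eta x) (τ.eta x) = 0 ∧
    𝒢.metricForm x (𝒢.xi x) (τ.eta x) = 1 ∧
      ∀ v, 𝒢.metricForm x (𝒢.PhiL x v) (τ.eta x) = τ.form x v := by
  obtain ⟨U₀, hy₀, hs₀, -⟩ := 𝒢.exists_localSection x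
  obtain ⟨h1, h2, h3⟩ := τ.nullVector_spec hs₀ hy₀
  have h := Classical.epsilon_spec (p := fun t : 𝒢.Tractor x =>
    𝒢.tractorMetric x t t = 0 ∧ 𝒢.tractorMetric x (𝒢.xi x) t = 1 ∧
      ∀ v, τ.form x v = 0 → 𝒢.tractorMetric x (𝒢.Phi x v) t = 0)
    ⟨𝒢.cls (hs₀.fib hy₀) (nullVector (etaGauge _ τ hs₀ hy₀)), h1, h2,
      fun v hv => (h3 v).trans hv⟩
  refine ⟨h.1, h.2.1, fun v => ?_⟩
  have h4 : 𝒢.metricForm x (𝒢.PhiL x (τ.proj x v)) (τ.eta x) = 0 := h.2.2 _ (τ.form_proj x v)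
  have h5 : 𝒢.metricForm x (𝒢.xi x) (τ.eta x) = 1 := h.2.1
  conv_lhs => rw [τ.form_eq_add_proj x v]
  rw [map_add, map_smul, PhiL_Z, LinearMap.map_add₂, h4, LinearMap.map_smul₂, h5]
  simp

theorem metricForm_eta_eta (x : N) : 𝒢.metricForm x (τ.eta x) (τ.eta x) = 0 := (τ.eta_spec x).1

theorem metricForm_xi_eta (x : N) : 𝒢.metricForm x (𝒢.xi x) (τ.eta x) = 1 := (τ.eta_spec x).2.1

theorem metricForm_eta_xi (x : N) : 𝒢.metricForm x (τ.eta x) (𝒢.xi x) = 1 := by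
  rw [metricForm_comm, metricForm_xi_eta]

theorem metricForm_PhiL_eta (x : N) (v : TangentSpace (𝓡 (m + 1)) x) :
    𝒢.metricForm x (𝒢.PhiL x v) (τ.eta x) = τ.form x v := (τ.eta_spec x).2.2 v

theorem metricForm_eta_PhiL (x : N) (v : TangentSpace (𝓡 (m + 1)) x) :
    𝒢.metricForm x (τ.eta x) (𝒢.PhiL x v) = τ.form x v := by
  rw [metricForm_comm, metricForm_PhiL_eta]

/-- In every gauge, `η^τ` is the null vector determined by the components of `τ`. -/
theorem coord_eta {s : N → P} {U : Set N} (hs : 𝒢.IsGauge s U) {y : N} (hy : y ∈ U) :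
    𝒢.coord τ.eta (s y) = nullVector (etaGauge s τ hs hy) := by
  obtain ⟨h1, -, h3⟩ := τ.nullVector_spec hs hy
  rw [← hs.apply_fib hy, τ.eta_unique (τ.metricForm_eta_eta y) (τ.metricForm_PhiL_eta y) h1 h3,
    cls_apply_self]

/-- The screen part of a tractor, as a linear map. -/
def screenL (x : N) : 𝒢.Tractor x →ₗ[ℝ] TangentSpace (𝓡 (m + 1)) x :=
  𝒢.PhiInv x ∘ₗ (LinearMap.id - (𝒢.metricForm x (τ.eta x)).smulRight (𝒢.xi x) -
    (𝒢.metricForm x (𝒢.xi x)).smulRight (τ.eta x))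

theorem PhiL_screenL (x : N) (t : 𝒢.Tractor x) :
    𝒢.PhiL x (τ.screenL x t) =
      t - 𝒢.metricForm x t (τ.eta x) • 𝒢.xi x - 𝒢.metricForm x t (𝒢.xi x) • τ.eta x := by
  have h : 𝒢.metricForm x (t - 𝒢.metricForm x (τ.eta x) t • 𝒢.xi x -
      𝒢.metricForm x (𝒢.xi x) t • τ.eta x) (𝒢.xi x) = 0 := by
    simp only [map_sub, map_smul, LinearMap.sub_apply, LinearMap.smul_apply, metricForm_xi_xi,
      metricForm_eta_xi, metricForm_comm (𝒢.xi x) t, smul_eq_mul]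
    ring
  refine (PhiL_PhiInv h).trans ?_
  rw [metricForm_comm (τ.eta x), metricForm_comm (𝒢.xi x)]

theorem form_screenL (x : N) (t : 𝒢.Tractor x) : τ.form x (τ.screenL x t) = 0 := by
  rw [← metricForm_PhiL_eta, PhiL_screenL]
  simp only [map_sub, map_smul, LinearMap.sub_apply, LinearMap.smul_apply, metricForm_xi_eta,
    metricForm_eta_eta, smul_eq_mul]
  ring

theorem screenPart_eq (x : N) (t : 𝒢.Tractor x) : τ.screenPart x t = τ.screenL x t := by
  have h := Classical.epsilon_spec (p := fun X : TangentSpace (𝓡 (m + 1)) x =>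
    τ.form x X = 0 ∧
      t = 𝒢.tractorMetric x t (τ.eta x) • 𝒢.xi x + 𝒢.Phi x X +
        𝒢.tractorMetric x t (𝒢.xi x) • τ.eta x)
    ⟨τ.screenL x t, τ.form_screenL x t, by
      rw [← PhiL_apply, τ.PhiL_screenL, tractorMetric_eq_metricForm, tractorMetric_eq_metricForm]
      abel⟩
  refine PhiL_injective (𝒢 := 𝒢) x ?_
  have h2 : t = 𝒢.metricForm x t (τ.eta x) • 𝒢.xi x + 𝒢.PhiL x (τ.screenPart x t) +
      𝒢.metricForm x t (𝒢.xi x) • τ.eta x := h.2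
  rw [τ.PhiL_screenL, eq_sub_iff_add_eq, eq_sub_iff_add_eq]
  refine Eq.trans ?_ h2.symm
  abel

theorem screenL_PhiL (x : N) (v : TangentSpace (𝓡 (m + 1)) x) :
    τ.screenL x (𝒢.PhiL x v) = τ.proj x v := by
  refine PhiL_injective (𝒢 := 𝒢) x ?_
  rw [PhiL_screenL, metricForm_PhiL_eta, metricForm_PhiL_xi, proj, map_sub, map_smul, PhiL_Z,
    zero_smul, sub_zero]

theorem screenL_xi (x : N) : τ.screenL x (𝒢.xi x) = 0 := by
  rw [← PhiL_Z, screenL_PhiL, proj, τ.form_Z, one_smul, sub_self]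

theorem screenL_eta (x : N) : τ.screenL x (τ.eta x) = 0 := by
  refine PhiL_injective (𝒢 := 𝒢) x ?_
  rw [PhiL_screenL, metricForm_eta_eta, metricForm_eta_xi]
  simp

end ScreenForm

end CartanGeometry

/-! ### Smoothness of vector fields and bundle maps -/

section Smoothness

open Bundle

variable {E' : Type*} [NormedAddCommGroup E'] [NormedSpace ℝ E']
  {H' : Type*} [TopologicalSpace H'] {I' : ModelWithCorners ℝ E' H'}
  {M : Type*} [TopologicalSpace M] [ChartedSpace H' M]
  {E₁ E₂ : Type*} [NormedAddCommGroup E₁] [NormedSpace ℝ E₁] [NormedAddCommGroup E₂]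
  [NormedSpace ℝ E₂]

/-- A family of linear maps on a finite-dimensional space is smooth if it is pointwise smooth. -/
theorem contMDiffOn_clm_of_apply [FiniteDimensional ℝ E₁] {n : WithTop ℕ∞} {S : Set M}
    {f : M → E₁ →L[ℝ] E₂} (hf : ∀ v, ContMDiffOn I' 𝓘(ℝ, E₂) n (fun y => f y v) S) :
    ContMDiffOn I' 𝓘(ℝ, E₁ →L[ℝ] E₂) n f S := by
  set b := Module.finBasis ℝ E₁
  have h : f = fun y => ∑ i, ContinuousLinearMap.smulRightL ℝ E₁ E₂
      (LinearMap.toContinuousLinearMap (b.coord i)) (f y (b i)) := by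
    funext y
    ext v
    conv_lhs => rw [← b.sum_repr v, map_sum]
    simp
  rw [h]
  refine contMDiffOn_finsetSum fun i _ => ?_
  exact (ContinuousLinearMap.contMDiff _).comp_contMDiffOn (hf (b i))

/-- The derivative of a smooth function along a smooth vector field is smooth. -/
theorem contMDiffOn_dirDeriv {W : Type*} [NormedAddCommGroup W] [NormedSpace ℝ W] {f : N → W}
    {U : Set N} (hU : IsOpen U) (hf : ContMDiffOn (𝓡 (m + 1)) 𝓘(ℝ, W) ∞ f U)
    {V : ∀ x : N, TangentSpace (𝓡 (m + 1)) x} (hV : IsSmoothFieldOn V U) :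
    ContMDiffOn (𝓡 (m + 1)) 𝓘(ℝ, W) ∞ (fun x => mvfderiv (𝓡 (m + 1)) f x (V x)) U := by
  have h1 := hf.contMDiffOn_tangentMapWithin (m := ∞) (by simp) hU.uniqueMDiffOn
  have h2 := (contMDiff_snd_tangentBundle_modelSpace W 𝓘(ℝ, W) (n := ∞)).comp_contMDiffOn
    (h1.comp hV fun x hx => hx)
  refine h2.congr fun x hx => ?_
  change mfderiv (𝓡 (m + 1)) 𝓘(ℝ, W) f x (V x) =
    mfderivWithin (𝓡 (m + 1)) 𝓘(ℝ, W) f U x (V x)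
  rw [mfderivWithin_of_isOpen hU hx]

/-- The constant section of the trivialization of `TN` at `x₀` is smooth. -/
theorem isSmoothFieldOn_symmL (x₀ : N) (v : EuclideanSpace ℝ (Fin (m + 1))) :
    IsSmoothFieldOn (fun y => (trivializationAt (EuclideanSpace ℝ (Fin (m + 1)))
      (TangentSpace (𝓡 (m + 1)) : N → Type _) x₀).symmL ℝ y v)
      (trivializationAt (EuclideanSpace ℝ (Fin (m + 1)))
      (TangentSpace (𝓡 (m + 1)) : N → Type _) x₀).baseSet := by
  set e := trivializationAt (EuclideanSpace ℝ (Fin (m + 1)))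
      (TangentSpace (𝓡 (m + 1)) : N → Type _) x₀
  refine (e.contMDiffOn_section_iff e.open_baseSet subset_rfl).2 ?_
  refine (contMDiffOn_const (c := v)).congr fun y hy => ?_
  rw [← e.continuousLinearMapAt_apply_of_mem (R := ℝ) hy, e.continuousLinearMapAt_symmL hy]

/-- A family of endomorphisms of `TN` that maps smooth local vector fields to smooth local vector
fields is a smooth section of the endomorphism bundle. -/
theorem contMDiff_hom_of_apply
    {D : ∀ x : N, TangentSpace (𝓡 (m + 1)) x →L[ℝ] TangentSpace (𝓡 (m + 1)) x}
    (hD : ∀ (U : Set N) (V : ∀ x : N, TangentSpace (𝓡 (m + 1)) x), IsOpen U →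
      IsSmoothFieldOn V U → IsSmoothFieldOn (fun x => D x (V x)) U) :
    ContMDiff (𝓡 (m + 1)) ((𝓡 (m + 1)).prod 𝓘(ℝ, EuclideanSpace ℝ (Fin (m + 1)) →L[ℝ]
      EuclideanSpace ℝ (Fin (m + 1)))) ∞
      (fun x => (⟨x, D x⟩ : TotalSpace (EuclideanSpace ℝ (Fin (m + 1)) →L[ℝ]
      EuclideanSpace ℝ (Fin (m + 1))) fun x : N =>
        TangentSpace (𝓡 (m + 1)) x →L[ℝ] TangentSpace (𝓡 (m + 1)) x)) := by
  intro x₀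
  rw [contMDiffAt_hom_bundle]
  refine ⟨contMDiffAt_id, ?_⟩
  set e := trivializationAt (EuclideanSpace ℝ (Fin (m + 1)))
      (TangentSpace (𝓡 (m + 1)) : N → Type _) x₀ with he
  have hx₀ : x₀ ∈ e.baseSet := FiberBundle.mem_baseSet_trivializationAt _ _ _
  refine ContMDiffOn.contMDiffAt (s := e.baseSet) ?_ (e.open_baseSet.mem_nhds hx₀)
  refine contMDiffOn_clm_of_apply fun v => ?_
  have h := (e.contMDiffOn_section_iff (n := ∞) (IB := 𝓡 (m + 1)) e.open_baseSet subset_rfl).1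
    (hD _ _ e.open_baseSet (isSmoothFieldOn_symmL x₀ v))
  refine h.congr fun y hy => ?_
  rw [← e.continuousLinearMapAt_apply_of_mem (R := ℝ) hy]
  rfl

theorem isBundleMorphism_of_apply
    {D : ∀ x : N, TangentSpace (𝓡 (m + 1)) x →L[ℝ] TangentSpace (𝓡 (m + 1)) x}
    (hD : ∀ (U : Set N) (V : ∀ x : N, TangentSpace (𝓡 (m + 1)) x), IsOpen U →
      IsSmoothFieldOn V U → IsSmoothFieldOn (fun x => D x (V x)) U) :
    IsBundleMorphism fun x v => D x v := by
  refine ⟨fun x => (D x).toLinearMap.isLinear, ?_⟩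
  have h := (contMDiff_hom_of_apply hD).comp
    (contMDiff_proj (F := EuclideanSpace ℝ (Fin (m + 1))) (n := ∞) (IB := 𝓡 (m + 1))
      (TangentSpace (𝓡 (m + 1)) : N → Type _))
  exact ContMDiff.clm_bundle_apply (b := fun v : TangentBundle (𝓡 (m + 1)) N => v.1)
    (v := fun v => v.2) h contMDiff_id

theorem contMDiffOn_oneForm {τ : ∀ x : N, TangentSpace (𝓡 (m + 1)) x →ₗ[ℝ] ℝ}
    (hτ : IsSmoothOneForm τ) {U : Set N} {V : ∀ x : N, TangentSpace (𝓡 (m + 1)) x}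
    (hV : IsSmoothFieldOn V U) :
    ContMDiffOn (𝓡 (m + 1)) 𝓘(ℝ, ℝ) ∞ (fun x => τ x (V x)) U :=
  hτ.comp_contMDiffOn hV

theorem mdifferentiableAt_oneForm {τ : ∀ x : N, TangentSpace (𝓡 (m + 1)) x →ₗ[ℝ] ℝ}
    (hτ : IsSmoothOneForm τ) {x : N} {V : ∀ x : N, TangentSpace (𝓡 (m + 1)) x}
    (hV : MDifferentiableAt (𝓡 (m + 1)) (𝓡 (m + 1)).tangent
      (fun x => (⟨x, V x⟩ : TangentBundle (𝓡 (m + 1)) N)) x) :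
    MDifferentiableAt (𝓡 (m + 1)) 𝓘(ℝ, ℝ) (fun x => τ x (V x)) x :=
  ((hτ _).mdifferentiableAt (by simp)).comp x hV

end Smoothness

namespace CartanGeometry

variable {𝒢 : CartanGeometry m N P (F := F)}

/-- The pullback `s^*ω` is smooth on the tangent bundle of the domain of the gauge. -/
theorem contMDiffOn_gaugeForm_total {s : N → P} {U : Set N} (hs : 𝒢.IsGauge s U) :
    ContMDiffOn (𝓡 (m + 1)).tangent 𝓘(ℝ, LorentzSpace m →L[ℝ] LorentzSpace m) ∞
      (fun v : TangentBundle (𝓡 (m + 1)) N => (𝒢.gaugeForm s v.1 v.2).1)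
      (Bundle.TotalSpace.proj ⁻¹' U) := by
  have h1 := hs.smooth.contMDiffOn_tangentMapWithin (m := ∞) (by simp) hs.isOpen.uniqueMDiffOn
  have h2 := 𝒢.smooth_conn.comp_contMDiffOn h1
  have h3 := ((lieG m).subtypeL.contMDiff (n := ∞)).comp_contMDiffOn h2
  refine h3.congr fun v hv => ?_
  change _ = (𝒢.conn (s v.1) (mfderivWithin (𝓡 (m + 1)) 𝓘(ℝ, F) s U v.1 v.2)).1
  rw [mfderivWithin_of_isOpen hs.isOpen hv]
  rfl

theorem contMDiffOn_gaugeForm {s : N → P} {U : Set N} (hs : 𝒢.IsGauge s U) {U' : Set N}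
    (hU' : U' ⊆ U) {V : ∀ x : N, TangentSpace (𝓡 (m + 1)) x} (hV : IsSmoothFieldOn V U') :
    ContMDiffOn (𝓡 (m + 1)) 𝓘(ℝ, LorentzSpace m →L[ℝ] LorentzSpace m) ∞
      (fun x => (𝒢.gaugeForm s x (V x)).1) U' :=
  (contMDiffOn_gaugeForm_total hs).comp hV fun _ hx => hU' hx

theorem mdifferentiableAt_gaugeForm {s : N → P} {U : Set N} (hs : 𝒢.IsGauge s U) {x : N}
    (hx : x ∈ U) {V : ∀ x : N, TangentSpace (𝓡 (m + 1)) x}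
    (hV : MDifferentiableAt (𝓡 (m + 1)) (𝓡 (m + 1)).tangent
      (fun x => (⟨x, V x⟩ : TangentBundle (𝓡 (m + 1)) N)) x) :
    MDifferentiableAt (𝓡 (m + 1)) 𝓘(ℝ, LorentzSpace m →L[ℝ] LorentzSpace m)
      (fun x => (𝒢.gaugeForm s x (V x)).1) x := by
  have hU : IsOpen (Bundle.TotalSpace.proj ⁻¹' U : Set (TangentBundle (𝓡 (m + 1)) N)) :=
    hs.isOpen.preimage (FiberBundle.continuous_proj _ _)
  have h := ((contMDiffOn_gaugeForm_total hs).contMDiffAt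
    (hU.mem_nhds (x := ⟨x, V x⟩) hx)).mdifferentiableAt (by simp)
  exact MDifferentiableAt.comp (f := fun x => (⟨x, V x⟩ : TangentBundle (𝓡 (m + 1)) N))
    (g := fun v : TangentBundle (𝓡 (m + 1)) N => (𝒢.gaugeForm s v.1 v.2).1) x h hV

theorem contMDiffOn_gaugeSolder {s : N → P} {U : Set N} (hs : 𝒢.IsGauge s U) {U' : Set N}
    (hU' : U' ⊆ U) {V : ∀ x : N, TangentSpace (𝓡 (m + 1)) x} (hV : IsSmoothFieldOn V U') :
    ContMDiffOn (𝓡 (m + 1)) 𝓘(ℝ, ℝ × EuclideanSpace ℝ (Fin m)) ∞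
      (fun x => 𝒢.gaugeSolder s x (V x)) U' := by
  have h1 := (contMDiffOn_gaugeForm hs hU' hV).clm_apply (contMDiffOn_const (c := ell m))
  have h2 : ContMDiffOn (𝓡 (m + 1)) 𝓘(ℝ, ℝ × EuclideanSpace ℝ (Fin m)) ∞
      (fun x => (((ContinuousLinearMap.fst ℝ ℝ (EuclideanSpace ℝ (Fin m) × ℝ)).prod
      ((ContinuousLinearMap.fst ℝ (EuclideanSpace ℝ (Fin m)) ℝ).comp
        (ContinuousLinearMap.snd ℝ ℝ (EuclideanSpace ℝ (Fin m) × ℝ))) :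
          LorentzSpace m →L[ℝ] ℝ × EuclideanSpace ℝ (Fin m))
        ((𝒢.gaugeForm s x (V x)).1 (ell m)))) U' :=
    (ContinuousLinearMap.contMDiff _).comp_contMDiffOn h1
  exact h2

/-- A local vector field is smooth if its image under the soldering form of a gauge is smooth. -/
theorem isSmoothFieldOn_of_gaugeSolder {s : N → P} {U : Set N} (hs : 𝒢.IsGauge s U)
    {V : ∀ x : N, TangentSpace (𝓡 (m + 1)) x} {U' : Set N} (hU'o : IsOpen U') (hU' : U' ⊆ U)
    (hV : ContMDiffOn (𝓡 (m + 1)) 𝓘(ℝ, ℝ × EuclideanSpace ℝ (Fin m)) ∞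
      (fun x => 𝒢.gaugeSolder s x (V x)) U') : IsSmoothFieldOn V U' := by
  intro x₀ hx₀
  set e := trivializationAt (EuclideanSpace ℝ (Fin (m + 1)))
      (TangentSpace (𝓡 (m + 1)) : N → Type _) x₀ with he
  have hxe : x₀ ∈ e.baseSet := FiberBundle.mem_baseSet_trivializationAt _ _ _
  have hO : IsOpen (U' ∩ e.baseSet) := hU'o.inter e.open_baseSet
  -- the soldering form read in the trivialization, a smooth family of invertible maps
  set S : N → (EuclideanSpace ℝ (Fin (m + 1)) →L[ℝ] ℝ × EuclideanSpace ℝ (Fin m)) :=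
    fun y => LinearMap.toContinuousLinearMap (𝒢.gaugeSolder s y ∘ₗ (e.symmL ℝ y).toLinearMap)
    with hS
  have hSs : ContMDiffOn (𝓡 (m + 1)) 𝓘(ℝ, EuclideanSpace ℝ (Fin (m + 1)) →L[ℝ]
      ℝ × EuclideanSpace ℝ (Fin m)) ∞ S (U' ∩ e.baseSet) :=
    contMDiffOn_clm_of_apply fun v => contMDiffOn_gaugeSolder hs
      (Set.inter_subset_left.trans hU') ((isSmoothFieldOn_symmL x₀ v).mono Set.inter_subset_right)
  have hSinv : ∀ y ∈ U' ∩ e.baseSet, ∃ E : EuclideanSpace ℝ (Fin (m + 1)) ≃L[ℝ]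
      ℝ × EuclideanSpace ℝ (Fin m), (E : _ →L[ℝ] _) = S y := fun y hy => by
    have he' : Function.Bijective (e.symmL ℝ y) := by
      rw [← e.symm_continuousLinearEquivAt_eq hy.2]
      exact (e.continuousLinearEquivAt ℝ y hy.2).symm.bijective
    have hb : Function.Bijective (S y) := (gaugeSolder_bijective hs (hU' hy.1)).comp he'
    exact ⟨(LinearEquiv.ofBijective (S y).toLinearMap hb).toContinuousLinearEquiv,
      ContinuousLinearMap.ext fun v => rfl⟩
  have hinv : ContMDiffOn (𝓡 (m + 1)) 𝓘(ℝ, (ℝ × EuclideanSpace ℝ (Fin m)) →L[ℝ]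
      EuclideanSpace ℝ (Fin (m + 1))) ∞ (fun y => (S y).inverse) (U' ∩ e.baseSet) := by
    intro y hy
    obtain ⟨E, hE⟩ := hSinv y hy
    have h1 := contDiffAt_map_inverse (n := ∞) E
    rw [hE] at h1
    exact h1.contMDiffAt.comp_contMDiffWithinAt y (hSs y hy)
  have hfin := hinv.clm_apply (hV.mono Set.inter_subset_left)
  refine ((e.contMDiffAt_section_iff hxe).2 ?_).contMDiffWithinAt
  refine (hfin.contMDiffAt (hO.mem_nhds ⟨hx₀, hxe⟩)).congr_of_eventuallyEq ?_
  filter_upwards [hO.mem_nhds ⟨hx₀, hxe⟩] with y hy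
  obtain ⟨E, hE⟩ := hSinv y hy
  rw [← e.continuousLinearMapAt_apply_of_mem (R := ℝ) hy.2, ← hE,
    ContinuousLinearMap.inverse_equiv]
  change _ = E.symm _
  rw [ContinuousLinearEquiv.eq_symm_apply]
  have h2 : E (e.continuousLinearMapAt ℝ y (V y)) = S y (e.continuousLinearMapAt ℝ y (V y)) := by
    rw [← hE]; rfl
  rw [h2]
  change 𝒢.gaugeSolder s y (e.symmL ℝ y (e.continuousLinearMapAt ℝ y (V y))) = _
  rw [e.symmL_continuousLinearMapAt hy.2]

/-! ### Differentiable sections of the tractor bundle -/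

/-- A section of `𝒯` is smooth on `V` if its coordinates in all gauges over subsets of `V` are. -/
def TSmoothOn (σ : ∀ x, 𝒢.Tractor x) (V : Set N) : Prop :=
  ∀ (s : N → P) (U : Set N), 𝒢.IsGauge s U → U ⊆ V →
    ContMDiffOn (𝓡 (m + 1)) 𝓘(ℝ, LorentzSpace m) ∞ (fun y => 𝒢.coord σ (s y)) U

/-- A section of `𝒯` is differentiable at `x` if its coordinates in all gauges near `x` are. -/
def TDiffAt (σ : ∀ x, 𝒢.Tractor x) (x : N) : Prop :=
  ∀ (s : N → P) (U : Set N), 𝒢.IsGauge s U → x ∈ U →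
    MDifferentiableAt (𝓡 (m + 1)) 𝓘(ℝ, LorentzSpace m) (fun y => 𝒢.coord σ (s y)) x

/-- Differentiability of a vector field at a point. -/
abbrev FieldDiffAt (W : ∀ x : N, TangentSpace (𝓡 (m + 1)) x) (x : N) : Prop :=
  MDifferentiableAt (𝓡 (m + 1)) (𝓡 (m + 1)).tangent
    (fun x => (⟨x, W x⟩ : TangentBundle (𝓡 (m + 1)) N)) x

theorem _root_.Lightlike.IsSmoothFieldOn.fieldDiffAt {W : ∀ x : N, TangentSpace (𝓡 (m + 1)) x}
    {V : Set N} (hW : IsSmoothFieldOn W V) (hV : IsOpen V) {x : N} (hx : x ∈ V) :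
    FieldDiffAt W x :=
  (hW.contMDiffAt (hV.mem_nhds hx)).mdifferentiableAt (by simp)

theorem TSmoothOn.tDiffAt {σ : ∀ x, 𝒢.Tractor x} {V : Set N} (h : TSmoothOn σ V) (hV : IsOpen V)
    {x : N} (hx : x ∈ V) : TDiffAt σ x := fun s U hs hxU =>
  ((h s (U ∩ V) (hs.mono (hs.isOpen.inter hV) Set.inter_subset_left)
    Set.inter_subset_right).contMDiffAt
      ((hs.isOpen.inter hV).mem_nhds ⟨hxU, hx⟩)).mdifferentiableAt (by simp)

theorem coord_add (σ σ' : ∀ x, 𝒢.Tractor x) (u : P) :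
    𝒢.coord (fun x => σ x + σ' x) u = 𝒢.coord σ u + 𝒢.coord σ' u := rfl

theorem IsGauge.coord_smul {s : N → P} {U : Set N} (hs : 𝒢.IsGauge s U) {y : N} (hy : y ∈ U)
    (f : N → ℝ) (σ : ∀ x, 𝒢.Tractor x) :
    𝒢.coord (fun x => f x • σ x) (s y) = f y • 𝒢.coord σ (s y) := by
  rw [← hs.apply_fib hy, ← hs.apply_fib hy]; rfl

theorem IsGauge.coord_PhiL {s : N → P} {U : Set N} (hs : 𝒢.IsGauge s U) {y : N} (hy : y ∈ U)
    (W : ∀ x : N, TangentSpace (𝓡 (m + 1)) x) :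
    𝒢.coord (fun x => 𝒢.PhiL x (W x)) (s y) = (𝒢.gaugeForm s y (W y)).1 (ell m) := by
  rw [← hs.apply_fib hy, PhiL_apply_fib]

theorem IsGauge.eventuallyEq {s : N → P} {U : Set N} (hs : 𝒢.IsGauge s U) {x : N} (hx : x ∈ U)
    {W : Type*} {f g : N → W} (h : ∀ y ∈ U, f y = g y) : f =ᶠ[𝓝 x] g :=
  Filter.eventually_of_mem (hs.isOpen.mem_nhds hx) h

theorem tSmoothOn_xi (V : Set N) : TSmoothOn 𝒢.xi V := fun _ _ _ _ => contMDiffOn_const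

theorem tDiffAt_xi (x : N) : TDiffAt 𝒢.xi x := fun _ _ _ _ => mdifferentiableAt_const

theorem TSmoothOn.add {σ σ' : ∀ x, 𝒢.Tractor x} {V : Set N} (h : TSmoothOn σ V)
    (h' : TSmoothOn σ' V) : TSmoothOn (fun x => σ x + σ' x) V := fun s U hs hU =>
  (h s U hs hU).add (h' s U hs hU)

theorem TSmoothOn.sub {σ σ' : ∀ x, 𝒢.Tractor x} {V : Set N} (h : TSmoothOn σ V)
    (h' : TSmoothOn σ' V) : TSmoothOn (fun x => σ x - σ' x) V := fun s U hs hU =>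
  (h s U hs hU).sub (h' s U hs hU)

theorem TSmoothOn.smul {f : N → ℝ} {σ : ∀ x, 𝒢.Tractor x} {V : Set N}
    (hf : ContMDiffOn (𝓡 (m + 1)) 𝓘(ℝ, ℝ) ∞ f V) (h : TSmoothOn σ V) :
    TSmoothOn (fun x => f x • σ x) V := fun s U hs hU =>
  ((hf.mono hU).smul (h s U hs hU)).congr fun _ hy => hs.coord_smul hy f σ

theorem TDiffAt.add {σ σ' : ∀ x, 𝒢.Tractor x} {x : N} (h : TDiffAt σ x)
    (h' : TDiffAt σ' x) : TDiffAt (fun x => σ x + σ' x) x := fun s U hs hU =>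
  (h s U hs hU).add (h' s U hs hU)

theorem TDiffAt.smul {f : N → ℝ} {σ : ∀ x, 𝒢.Tractor x} {x : N}
    (hf : MDifferentiableAt (𝓡 (m + 1)) 𝓘(ℝ, ℝ) f x) (h : TDiffAt σ x) :
    TDiffAt (fun x => f x • σ x) x := fun s U hs hU =>
  (hf.smul (h s U hs hU)).congr_of_eventuallyEq
    (hs.eventuallyEq hU fun _ hy => hs.coord_smul hy f σ)

theorem tSmoothOn_PhiL {W : ∀ x : N, TangentSpace (𝓡 (m + 1)) x} {V : Set N}
    (hW : IsSmoothFieldOn W V) : TSmoothOn (fun x => 𝒢.PhiL x (W x)) V := fun _ _ hs hU =>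
  ((contMDiffOn_gaugeForm hs subset_rfl (hW.mono hU)).clm_apply
    (contMDiffOn_const (c := ell m))).congr fun _ hy => hs.coord_PhiL hy W

theorem tDiffAt_PhiL {W : ∀ x : N, TangentSpace (𝓡 (m + 1)) x} {x : N}
    (hW : FieldDiffAt W x) : TDiffAt (fun x => 𝒢.PhiL x (W x)) x := fun _ _ hs hU =>
  (MDifferentiableAt.bilinear (ContinuousLinearMap.id ℝ _) (mdifferentiableAt_gaugeForm hs hU hW)
    (mdifferentiableAt_const (c := ell m))).congr_of_eventuallyEq
    (hs.eventuallyEq hU fun _ hy => hs.coord_PhiL hy W)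

theorem IsGauge.metricForm_coord {s : N → P} {U : Set N} (hs : 𝒢.IsGauge s U) {y : N} (hy : y ∈ U)
    (σ σ' : ∀ x, 𝒢.Tractor x) :
    𝒢.metricForm y (σ y) (σ' y) = lorL m (𝒢.coord σ (s y)) (𝒢.coord σ' (s y)) := by
  rw [metricForm_eq (hs.fib hy), hs.apply_fib, hs.apply_fib, lorL_apply]

theorem TSmoothOn.metricForm {σ σ' : ∀ x, 𝒢.Tractor x} {V : Set N} (hV : IsOpen V)
    (h : TSmoothOn σ V) (h' : TSmoothOn σ' V) :
    ContMDiffOn (𝓡 (m + 1)) 𝓘(ℝ, ℝ) ∞ (fun y => 𝒢.metricForm y (σ y) (σ' y)) V := by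
  intro x hx
  obtain ⟨U₀, hx₀, hs₀, -⟩ := 𝒢.exists_localSection x
  have hs := hs₀.mono (hs₀.isOpen.inter hV) Set.inter_subset_left
  have h1 := ContMDiffOn.bilinear (lorL m) (h _ _ hs Set.inter_subset_right)
    (h' _ _ hs Set.inter_subset_right)
  exact ((h1.congr fun y hy => hs.metricForm_coord hy σ σ').contMDiffAt
    (hs.isOpen.mem_nhds ⟨hx₀, hx⟩)).contMDiffWithinAt

theorem TSmoothOn.covDeriv {σ : ∀ x, 𝒢.Tractor x} {V : Set N} (hV : IsOpen V)
    (h : TSmoothOn σ V) {W : ∀ x : N, TangentSpace (𝓡 (m + 1)) x} (hW : IsSmoothFieldOn W V) :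
    TSmoothOn (fun x => 𝒢.covDeriv σ x (W x)) V := fun s U hs hU => by
  have h1 := h s U hs hU
  have h2 := (contMDiffOn_dirDeriv hs.isOpen h1 (hW.mono hU)).add
    ((contMDiffOn_gaugeForm hs subset_rfl (hW.mono hU)).clm_apply h1)
  refine h2.congr fun y hy => ?_
  rw [← hs.apply_fib hy]
  exact covDeriv_apply_fib hs hy σ (h.tDiffAt hV (hU hy) s U hs hy) (W y)

/-- `Φ⁻¹` of a smooth section orthogonal to `ξ` is a smooth vector field. -/
theorem TSmoothOn.phiInv {σ : ∀ x, 𝒢.Tractor x} {V : Set N} (hV : IsOpen V)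
    (h : TSmoothOn σ V) (hσ : ∀ x ∈ V, 𝒢.metricForm x (σ x) (𝒢.xi x) = 0) :
    IsSmoothFieldOn (fun x => 𝒢.PhiInv x (σ x)) V := by
  intro x hx
  obtain ⟨U₀, hx₀, hs₀, -⟩ := 𝒢.exists_localSection x
  have hs := hs₀.mono (hs₀.isOpen.inter hV) Set.inter_subset_left
  have h1 := h _ _ hs Set.inter_subset_right
  have h2 : ContMDiffOn (𝓡 (m + 1)) 𝓘(ℝ, ℝ × EuclideanSpace ℝ (Fin m)) ∞
      (fun y => (((ContinuousLinearMap.fst ℝ ℝ (EuclideanSpace ℝ (Fin m) × ℝ)).prod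
      ((ContinuousLinearMap.fst ℝ (EuclideanSpace ℝ (Fin m)) ℝ).comp
        (ContinuousLinearMap.snd ℝ ℝ (EuclideanSpace ℝ (Fin m) × ℝ))) :
          LorentzSpace m →L[ℝ] ℝ × EuclideanSpace ℝ (Fin m))
        (𝒢.coord σ (𝒢.localSection x y)))) (U₀ ∩ V) :=
    (ContinuousLinearMap.contMDiff _).comp_contMDiffOn h1
  refine ((isSmoothFieldOn_of_gaugeSolder hs hs.isOpen subset_rfl (h2.congr fun y hy => ?_))
    |>.contMDiffAt (hs.isOpen.mem_nhds ⟨hx₀, hx⟩)).contMDiffWithinAt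
  have h3 := PhiL_apply_fib hs hy (𝒢.PhiInv y (σ y))
  rw [PhiL_PhiInv (hσ y hy.2), hs.apply_fib hy, ell_eq_of_projGH] at h3
  rw [h3]
  rfl

/-! ### Calculus of the tractor connection -/

theorem covDeriv_add {σ σ' : ∀ x, 𝒢.Tractor x} {x : N} (h : TDiffAt σ x) (h' : TDiffAt σ' x)
    (w : TangentSpace (𝓡 (m + 1)) x) :
    𝒢.covDeriv (fun y => σ y + σ' y) x w = 𝒢.covDeriv σ x w + 𝒢.covDeriv σ' x w := by
  obtain ⟨U₀, hx₀, hs, -⟩ := 𝒢.exists_localSection x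
  refine Tractor.ext_at (hs.fib hx₀) ?_
  change _ = (𝒢.covDeriv σ x w).1 _ + (𝒢.covDeriv σ' x w).1 _
  rw [covDeriv_apply_fib hs hx₀ _ (h.add h' _ _ hs hx₀), covDeriv_apply_fib hs hx₀ _ (h _ _ hs hx₀),
    covDeriv_apply_fib hs hx₀ _ (h' _ _ hs hx₀)]
  have h1 : mvfderiv (𝓡 (m + 1)) (fun z => 𝒢.coord (fun y => σ y + σ' y) (𝒢.localSection x z)) x w =
      mvfderiv (𝓡 (m + 1)) (fun z => 𝒢.coord σ (𝒢.localSection x z)) x w +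
      mvfderiv (𝓡 (m + 1)) (fun z => 𝒢.coord σ' (𝒢.localSection x z)) x w :=
    congrArg (fun L : EuclideanSpace ℝ (Fin (m + 1)) →L[ℝ] LorentzSpace m => L w)
      (mvfderiv_add (h _ _ hs hx₀) (h' _ _ hs hx₀))
  rw [h1, coord_add, map_add]
  abel

theorem covDeriv_smul {f : N → ℝ} {σ : ∀ x, 𝒢.Tractor x} {x : N}
    (hf : MDifferentiableAt (𝓡 (m + 1)) 𝓘(ℝ, ℝ) f x) (h : TDiffAt σ x)
    (w : TangentSpace (𝓡 (m + 1)) x) :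
    𝒢.covDeriv (fun y => f y • σ y) x w =
      dirDeriv f x w • σ x + f x • 𝒢.covDeriv σ x w := by
  obtain ⟨U₀, hx₀, hs, -⟩ := 𝒢.exists_localSection x
  refine Tractor.ext_at (hs.fib hx₀) ?_
  change _ = dirDeriv f x w • (σ x).1 _ + f x • (𝒢.covDeriv σ x w).1 _
  rw [covDeriv_apply_fib hs hx₀ _ (h.smul hf _ _ hs hx₀),
    covDeriv_apply_fib hs hx₀ _ (h _ _ hs hx₀), hs.apply_fib hx₀, hs.coord_smul hx₀, map_smul,
    mvfderiv_congr_of_eventuallyEq (hs.eventuallyEq hx₀ fun _ hy => hs.coord_smul hy f σ)]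
  have := mvfderiv_bilinear (ContinuousLinearMap.lsmul ℝ ℝ : ℝ →L[ℝ] LorentzSpace m →L[ℝ] _)
    hf (h _ _ hs hx₀) w
  simp only [ContinuousLinearMap.lsmul_apply] at this
  rw [this, dirDeriv_eq, smul_add]
  abel

/-- The tractor connection is metric. -/
theorem dirDeriv_metricForm {σ σ' : ∀ x, 𝒢.Tractor x} {x : N} (h : TDiffAt σ x)
    (h' : TDiffAt σ' x) (w : TangentSpace (𝓡 (m + 1)) x) :
    dirDeriv (fun y => 𝒢.metricForm y (σ y) (σ' y)) x w =
      𝒢.metricForm x (𝒢.covDeriv σ x w) (σ' x) + 𝒢.metricForm x (σ x) (𝒢.covDeriv σ' x w) := by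
  obtain ⟨U₀, hx₀, hs, -⟩ := 𝒢.exists_localSection x
  rw [metricForm_eq (hs.fib hx₀), metricForm_eq (hs.fib hx₀), dirDeriv_eq,
    covDeriv_apply_fib hs hx₀ _ (h _ _ hs hx₀), covDeriv_apply_fib hs hx₀ _ (h' _ _ hs hx₀),
    mvfderiv_congr_of_eventuallyEq
      (hs.eventuallyEq hx₀ fun y hy => hs.metricForm_coord hy σ σ'),
    mvfderiv_bilinear (lorL m) (h _ _ hs hx₀) (h' _ _ hs hx₀), hs.apply_fib hx₀, hs.apply_fib hx₀]
  simp only [lorL_apply, map_add, LinearMap.add_apply]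
  have := (𝒢.gaugeForm (𝒢.localSection x) x w).2 (𝒢.coord σ (𝒢.localSection x x))
    (𝒢.coord σ' (𝒢.localSection x x))
  linarith

theorem covDeriv_congr {σ σ' : ∀ x, 𝒢.Tractor x} (h : ∀ x, σ x = σ' x) (x : N)
    (w : TangentSpace (𝓡 (m + 1)) x) : 𝒢.covDeriv σ x w = 𝒢.covDeriv σ' x w := by
  rw [funext h]

/-! ### Smoothness of `Z^ω`, `h^ω` and `η^τ` -/

theorem isSmoothField_Z (𝒢 : CartanGeometry m N P (F := F)) : IsSmoothField 𝒢.Z := by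
  intro x
  obtain ⟨U₀, hx₀, hs, -⟩ := 𝒢.exists_localSection x
  have h : IsSmoothFieldOn 𝒢.Z U₀ := isSmoothFieldOn_of_gaugeSolder hs hs.isOpen subset_rfl
    ((contMDiffOn_const (c := ((1, 0) : ℝ × EuclideanSpace ℝ (Fin m)))).congr fun y hy =>
      gaugeSolder_Z hs hy)
  exact h.contMDiffAt (hs.isOpen.mem_nhds hx₀)

theorem _root_.Lightlike.IsSmoothField.on {V : ∀ x : N, TangentSpace (𝓡 (m + 1)) x}
    (hV : IsSmoothField V) (U : Set N) : IsSmoothFieldOn V U := ContMDiff.contMDiffOn hV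

theorem _root_.Lightlike.IsSmoothField.fieldDiffAt {V : ∀ x : N, TangentSpace (𝓡 (m + 1)) x}
    (hV : IsSmoothField V) (x : N) : FieldDiffAt V x := (hV x).mdifferentiableAt (by simp)

theorem isLightlikeMetric_h (𝒢 : CartanGeometry m N P (F := F)) : IsLightlikeMetric 𝒢.h where
  smooth U V W hU hV hW := by
    simp only [h_eq]
    exact (tSmoothOn_PhiL hV).metricForm hU (tSmoothOn_PhiL hW)
  symm := h_symm
  nonneg := h_nonneg
  radical := finrank_ker_h

theorem ScreenForm.tSmoothOn_eta (τ : 𝒢.ScreenForm) (V : Set N) : TSmoothOn τ.eta V := by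
  classical
  intro s U hs _
  have h1 : ∀ i, ContMDiffOn (𝓡 (m + 1)) 𝓘(ℝ, ℝ) ∞ (fun y => if hy : y ∈ U then
      (τ.form y ((LinearEquiv.ofBijective _ (gaugeSolder_bijective hs hy)).symm
        (0, EuclideanSpace.basisFun (Fin m) ℝ i))) else 0) U := by
    intro i
    let W : ∀ y : N, TangentSpace (𝓡 (m + 1)) y := fun y => if hy : y ∈ U then
      ((LinearEquiv.ofBijective _ (gaugeSolder_bijective hs hy)).symm
        (0, EuclideanSpace.basisFun (Fin m) ℝ i)) else 0
    have hW : IsSmoothFieldOn W U := by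
      refine isSmoothFieldOn_of_gaugeSolder hs hs.isOpen subset_rfl ((contMDiffOn_const
        (c := ((0, EuclideanSpace.basisFun (Fin m) ℝ i) :
          ℝ × EuclideanSpace ℝ (Fin m)))).congr fun y hy => ?_)
      simp only [W, dif_pos hy]
      exact (LinearEquiv.ofBijective _ (gaugeSolder_bijective hs hy)).apply_symm_apply _
    refine (contMDiffOn_oneForm τ.smooth hW).congr fun y hy => ?_
    simp only [W, dif_pos hy]
  have h2 : ContMDiffOn (𝓡 (m + 1)) 𝓘(ℝ, EuclideanSpace ℝ (Fin m)) ∞ (fun y =>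
      ∑ i, (if hy : y ∈ U then
      (τ.form y ((LinearEquiv.ofBijective _ (gaugeSolder_bijective hs hy)).symm
        (0, EuclideanSpace.basisFun (Fin m) ℝ i))) else 0) •
          EuclideanSpace.basisFun (Fin m) ℝ i) U :=
    contMDiffOn_finsetSum fun i _ => (h1 i).smul contMDiffOn_const
  have h3 : ContDiff ℝ ∞ (nullVector (m := m)) := by
    exact (contDiff_const.mul (contDiff_id.inner ℝ contDiff_id)).prodMk
      (contDiff_id.prodMk contDiff_const)
  refine (h3.contMDiff.comp_contMDiffOn h2).congr fun y hy => ?_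
  rw [τ.coord_eta hs hy]
  simp only [etaGauge, Function.comp_apply, dif_pos hy]

theorem ScreenForm.tDiffAt_eta (τ : 𝒢.ScreenForm) (x : N) : TDiffAt τ.eta x :=
  (τ.tSmoothOn_eta Set.univ).tDiffAt isOpen_univ trivial

/-! ### Linear connections on `TN` induced by the tractor connection -/

instance (x : N) : T2Space (TangentSpace (𝓡 (m + 1)) x) :=
  inferInstanceAs (T2Space (EuclideanSpace ℝ (Fin (m + 1))))

theorem _root_.Lightlike.IsSmoothFieldOn.congr {V W : ∀ x : N, TangentSpace (𝓡 (m + 1)) x}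
    {U : Set N} (hV : IsSmoothFieldOn V U) (h : ∀ x ∈ U, W x = V x) : IsSmoothFieldOn W U :=
  ContMDiffOn.congr hV fun x hx => by rw [h x hx]

/-- `∇ξ = Φ` and the metricity of the tractor connection determine the `ξ`-component of
`∇_v Φ(W)`. -/
theorem metricForm_covDeriv_PhiL_xi {W : ∀ x : N, TangentSpace (𝓡 (m + 1)) x} {x : N}
    (hW : FieldDiffAt W x) (v : TangentSpace (𝓡 (m + 1)) x) :
    𝒢.metricForm x (𝒢.xi x) (𝒢.covDeriv (fun y => 𝒢.PhiL y (W y)) x v) = -𝒢.h x v (W x) := by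
  have h := dirDeriv_metricForm (tDiffAt_xi (𝒢 := 𝒢) x) (tDiffAt_PhiL hW) v
  simp only [metricForm_xi_PhiL] at h
  rw [h_eq]
  have h0 : dirDeriv (fun _ : N => (0 : ℝ)) x v = 0 := by
    rw [dirDeriv_eq, mvfderiv_const]; rfl
  rw [h0] at h
  have h1 : 𝒢.covDeriv 𝒢.xi x v = 𝒢.PhiL x v := rfl
  rw [h1] at h
  linarith

/-- The connection on `TN` obtained from `∇_v Φ(W)` by removing its component transverse to
`Φ(TN)` with the help of a section `e` with `𝐡(ξ, e) = 1`, and adding `B(v, W) ξ`. -/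
def connOp (𝒢 : CartanGeometry m N P (F := F)) (e : ∀ x, 𝒢.Tractor x)
    (B : ∀ x : N, TangentSpace (𝓡 (m + 1)) x →ₗ[ℝ] TangentSpace (𝓡 (m + 1)) x →ₗ[ℝ] ℝ)
    (W : ∀ x : N, TangentSpace (𝓡 (m + 1)) x) (x : N) :
    TangentSpace (𝓡 (m + 1)) x →L[ℝ] TangentSpace (𝓡 (m + 1)) x :=
  LinearMap.toContinuousLinearMap (𝒢.PhiInv x ∘ₗ
    ((LinearMap.id - (𝒢.metricForm x (𝒢.xi x)).smulRight (e x)) ∘ₗ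
        covDerivL (fun y => 𝒢.PhiL y (W y)) x +
      ((B x).flip (W x)).smulRight (𝒢.xi x)))

section connOp

variable (e : ∀ x, 𝒢.Tractor x)
  (B : ∀ x : N, TangentSpace (𝓡 (m + 1)) x →ₗ[ℝ] TangentSpace (𝓡 (m + 1)) x →ₗ[ℝ] ℝ)

theorem connOp_apply (W : ∀ x : N, TangentSpace (𝓡 (m + 1)) x) (x : N)
    (v : TangentSpace (𝓡 (m + 1)) x) :
    𝒢.connOp e B W x v = 𝒢.PhiInv x (𝒢.covDeriv (fun y => 𝒢.PhiL y (W y)) x v -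
      𝒢.metricForm x (𝒢.xi x) (𝒢.covDeriv (fun y => 𝒢.PhiL y (W y)) x v) • e x +
      B x v (W x) • 𝒢.xi x) := rfl

theorem PhiL_connOp {W : ∀ x : N, TangentSpace (𝓡 (m + 1)) x} {x : N}
    (hW : FieldDiffAt W x) (he : 𝒢.metricForm x (𝒢.xi x) (e x) = 1)
    (v : TangentSpace (𝓡 (m + 1)) x) :
    𝒢.PhiL x (𝒢.connOp e B W x v) = 𝒢.covDeriv (fun y => 𝒢.PhiL y (W y)) x v +
      𝒢.h x v (W x) • e x + B x v (W x) • 𝒢.xi x := by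
  rw [connOp_apply, PhiL_PhiInv]
  · rw [metricForm_covDeriv_PhiL_xi hW]
    module
  · rw [metricForm_comm]
    simp only [map_add, map_sub, map_smul, he, metricForm_xi_xi, smul_eq_mul]
    ring

theorem connOp_add {σ σ' : ∀ x : N, TangentSpace (𝓡 (m + 1)) x} {x : N}
    (hσ : FieldDiffAt σ x) (hσ' : FieldDiffAt σ' x) (v : TangentSpace (𝓡 (m + 1)) x) :
    𝒢.connOp e B (fun y => σ y + σ' y) x v = 𝒢.connOp e B σ x v + 𝒢.connOp e B σ' x v := by
  have h1 := covDeriv_add (tDiffAt_PhiL (𝒢 := 𝒢) hσ) (tDiffAt_PhiL (𝒢 := 𝒢) hσ') v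
  have h2 := (covDeriv_congr (fun y => map_add (𝒢.PhiL y) (σ y) (σ' y)) x v).trans h1
  rw [connOp_apply, connOp_apply, connOp_apply, h2, ← map_add]
  congr 1
  simp only [map_add]
  module

theorem connOp_smul {σ : ∀ x : N, TangentSpace (𝓡 (m + 1)) x} {g : N → ℝ} {x : N}
    (hσ : FieldDiffAt σ x) (hg : MDifferentiableAt (𝓡 (m + 1)) 𝓘(ℝ, ℝ) g x)
    (v : TangentSpace (𝓡 (m + 1)) x) :
    𝒢.connOp e B (fun y => g y • σ y) x v =
      g x • 𝒢.connOp e B σ x v + dirDeriv g x v • σ x := by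
  have h1 := covDeriv_smul hg (tDiffAt_PhiL (𝒢 := 𝒢) hσ) v
  have h2 := (covDeriv_congr (fun y => map_smul (𝒢.PhiL y) (g y) (σ y)) x v).trans h1
  have h3 : dirDeriv g x v • σ x = 𝒢.PhiInv x (dirDeriv g x v • 𝒢.PhiL x (σ x)) := by
    rw [map_smul, PhiInv_PhiL]
  rw [connOp_apply, connOp_apply, h2, h3, ← map_smul (𝒢.PhiInv x), ← map_add (𝒢.PhiInv x)]
  congr 1
  simp only [map_add, map_smul, metricForm_xi_PhiL, smul_eq_mul, mul_zero, zero_add]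
  module

theorem isCovariantDerivativeOn_connOp :
    IsCovariantDerivativeOn (I := 𝓡 (m + 1)) (EuclideanSpace ℝ (Fin (m + 1)))
      (V := (TangentSpace (𝓡 (m + 1)) : N → Type _)) (𝒢.connOp e B) Set.univ where
  add hσ hσ' _ := ContinuousLinearMap.ext fun v => connOp_add e B hσ hσ' v
  leibniz hσ hg _ := ContinuousLinearMap.ext fun v => connOp_smul e B hσ hg v

end connOp

/-! ### The tensor `T^ω` -/

/-- A section of `𝒯`, not necessarily continuous, with `𝐡(ξ, ·) = 1`. -/
def transversal (𝒢 : CartanGeometry m N P (F := F)) (x : N) : 𝒢.Tractor x :=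
  𝒢.cls ⟨𝒢.localSection x x, 𝒢.proj_localSection x⟩ (nvec m)

theorem metricForm_xi_transversal (x : N) :
    𝒢.metricForm x (𝒢.xi x) (𝒢.transversal x) = 1 := by
  rw [metricForm_comm, metricForm_xi_right ⟨𝒢.localSection x x, 𝒢.proj_localSection x⟩,
    transversal, cls_apply_self]
  rfl

/-- The tensor `T^ω` with `R^𝒯 ξ = Φ ∘ T^ω`, constructed as the torsion of a connection on `TN`
whose difference from `∇ ∘ Φ` is symmetric. -/
def torsionTensor (𝒢 : CartanGeometry m N P (F := F)) (x : N) :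
    TangentSpace (𝓡 (m + 1)) x →ₗ[ℝ] TangentSpace (𝓡 (m + 1)) x →ₗ[ℝ]
      TangentSpace (𝓡 (m + 1)) x :=
  ContinuousLinearMap.coeLM ℝ ∘ₗ ContinuousLinearMap.toLinearMap
    ((isCovariantDerivativeOn_connOp 𝒢.transversal fun _ => 0).torsion x)

/-- `Φ ∘ T^ω = R^𝒯 ξ`; only differentiability of the fields at the point is needed. -/
theorem PhiL_torsionTensor {V W : ∀ x : N, TangentSpace (𝓡 (m + 1)) x} {x : N}
    (hV : FieldDiffAt V x) (hW : FieldDiffAt W x) :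
    𝒢.PhiL x (𝒢.torsionTensor x (V x) (W x)) = 𝒢.curvature V W 𝒢.xi x := by
  have h1 : 𝒢.torsionTensor x (V x) (W x) = _ :=
    (isCovariantDerivativeOn_connOp 𝒢.transversal fun _ => 0).torsion_apply hV hW
  rw [h1, map_sub, map_sub, PhiL_connOp _ _ hW (metricForm_xi_transversal x),
    PhiL_connOp _ _ hV (metricForm_xi_transversal x), h_symm x (W x)]
  simp only [LinearMap.zero_apply, zero_smul, add_zero, add_sub_add_right_eq_sub]
  rfl

theorem isSmoothFieldOn_mlieBracket {V W : ∀ x : N, TangentSpace (𝓡 (m + 1)) x} {U : Set N}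
    (hU : IsOpen U) (hV : IsSmoothFieldOn V U) (hW : IsSmoothFieldOn W U) :
    IsSmoothFieldOn (VectorField.mlieBracket (𝓡 (m + 1)) V W) U := by
  intro x hx
  have : IsManifold (𝓡 (m + 1)) (minSmoothness ℝ 2) N := by
    rw [minSmoothness_of_isRCLikeNormedField]; infer_instance
  have : IsManifold (𝓡 (m + 1)) (((⊤ : ℕ∞) : WithTop ℕ∞) + 1) N :=
    inferInstanceAs (IsManifold (𝓡 (m + 1)) ∞ N)
  exact (ContMDiffAt.mlieBracket_vectorField (m := ⊤) (n := ⊤) (hV.contMDiffAt (hU.mem_nhds hx))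
    (hW.contMDiffAt (hU.mem_nhds hx)) (by simp)).contMDiffWithinAt

theorem isVectorValuedTwoForm_torsionTensor (𝒢 : CartanGeometry m N P (F := F)) :
    IsVectorValuedTwoForm 𝒢.torsionTensor where
  smooth U V W hU hV hW := by
    have hc : TSmoothOn (𝒢.curvature V W 𝒢.xi) U :=
      (((tSmoothOn_PhiL hW).covDeriv hU hV).sub ((tSmoothOn_PhiL hV).covDeriv hU hW)).sub
        (tSmoothOn_PhiL (isSmoothFieldOn_mlieBracket hU hV hW))
    have hT : ∀ x ∈ U, 𝒢.PhiL x (𝒢.torsionTensor x (V x) (W x)) = 𝒢.curvature V W 𝒢.xi x :=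
      fun x hx => PhiL_torsionTensor (hV.fieldDiffAt hU hx) (hW.fieldDiffAt hU hx)
    have h := hc.phiInv hU fun x hx => by rw [← hT x hx, metricForm_PhiL_xi]
    refine IsSmoothFieldOn.congr h fun x hx => ?_
    rw [← hT x hx, PhiInv_PhiL]
  alternating x v := (isCovariantDerivativeOn_connOp 𝒢.transversal fun _ => 0).torsion_self v

namespace ScreenForm

variable (τ : 𝒢.ScreenForm)

/-! ### The bundle map `D^τ` -/

theorem dirDeriv_const {W : Type*} [NormedAddCommGroup W] [NormedSpace ℝ W] (c : W) (x : N)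
    (v : TangentSpace (𝓡 (m + 1)) x) : dirDeriv (fun _ : N => c) x v = 0 := by
  rw [dirDeriv_eq, mvfderiv_const]; rfl

/-- The bundle map `D^τ` as a family of continuous linear maps. -/
def DL (x : N) : TangentSpace (𝓡 (m + 1)) x →L[ℝ] TangentSpace (𝓡 (m + 1)) x :=
  LinearMap.toContinuousLinearMap (τ.screenL x ∘ₗ covDerivL τ.eta x)

theorem DL_apply (x : N) (w : TangentSpace (𝓡 (m + 1)) x) :
    τ.DL x w = τ.screenL x (𝒢.covDeriv τ.eta x w) := rfl

theorem D_eq (x : N) (w : TangentSpace (𝓡 (m + 1)) x) : τ.D x w = τ.DL x w :=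
  τ.screenPart_eq x _

theorem form_DL (x : N) (w : TangentSpace (𝓡 (m + 1)) x) : τ.form x (τ.DL x w) = 0 :=
  τ.form_screenL x _

/-- `∇_w η^τ = Φ(D^τ(w)) - τ(w) η^τ`: the `ξ`-component vanishes because `η^τ` is null. -/
theorem PhiL_DL (x : N) (w : TangentSpace (𝓡 (m + 1)) x) :
    𝒢.PhiL x (τ.DL x w) = 𝒢.covDeriv τ.eta x w + τ.form x w • τ.eta x := by
  have h1 := dirDeriv_metricForm (τ.tDiffAt_eta x) (τ.tDiffAt_eta x) w
  simp only [metricForm_eta_eta, dirDeriv_const] at h1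
  rw [metricForm_comm (τ.eta x)] at h1
  have h1' : 𝒢.metricForm x (𝒢.covDeriv τ.eta x w) (τ.eta x) = 0 := by linarith
  have h2 := dirDeriv_metricForm (τ.tDiffAt_eta x) (tDiffAt_xi (𝒢 := 𝒢) x) w
  simp only [metricForm_eta_xi, dirDeriv_const] at h2
  have h3 : 𝒢.metricForm x (τ.eta x) (𝒢.covDeriv 𝒢.xi x w) = τ.form x w :=
    τ.metricForm_eta_PhiL x w
  have h2' : 𝒢.metricForm x (𝒢.covDeriv τ.eta x w) (𝒢.xi x) = -τ.form x w := by linarith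
  rw [DL_apply, PhiL_screenL, h1', h2', zero_smul, sub_zero]
  module

theorem isSmoothFieldOn_DL {U : Set N} {V : ∀ x : N, TangentSpace (𝓡 (m + 1)) x} (hU : IsOpen U)
    (hV : IsSmoothFieldOn V U) : IsSmoothFieldOn (fun x => τ.DL x (V x)) U := by
  have h : TSmoothOn (fun x => 𝒢.PhiL x (τ.DL x (V x))) U := by
    simp only [PhiL_DL]
    exact ((τ.tSmoothOn_eta U).covDeriv hU hV).add
      ((τ.tSmoothOn_eta U).smul (contMDiffOn_oneForm τ.smooth hV))
  exact IsSmoothFieldOn.congr (h.phiInv hU fun x _ => metricForm_PhiL_xi x _) fun x _ =>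
    (PhiInv_PhiL x _).symm

theorem isBundleMorphism_D : IsBundleMorphism τ.D := by
  have h := isBundleMorphism_of_apply (D := τ.DL) fun U V hU hV => τ.isSmoothFieldOn_DL hU hV
  have h2 : τ.D = fun x v => τ.DL x v := funext fun x => funext fun v => τ.D_eq x v
  rwa [h2]

/-! ### The Galilean connection of a screen form -/

/-- The coefficient `h(W, D^τ V) - τ(V) τ(W)` of `ξ` in `Φ(∇̃^τ_V W) - ∇_V Φ(W)`, where
`∇` is the tractor connection. -/
def shift (x : N) : TangentSpace (𝓡 (m + 1)) x →ₗ[ℝ] TangentSpace (𝓡 (m + 1)) x →ₗ[ℝ] ℝ :=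
  𝒢.h x ∘ₗ (τ.DL x).toLinearMap - (τ.form x).smulRight (τ.form x)

theorem shift_apply (x : N) (v w : TangentSpace (𝓡 (m + 1)) x) :
    τ.shift x v w = 𝒢.h x (τ.DL x v) w - τ.form x v * τ.form x w := rfl

/-- The extended connection `∇̃^τ` as a covariant derivative on `TN`. -/
def galileanConnection : CovariantDerivative (𝓡 (m + 1)) (EuclideanSpace ℝ (Fin (m + 1)))
    (TangentSpace (𝓡 (m + 1)) : N → Type _) :=
  ⟨𝒢.connOp τ.eta τ.shift, isCovariantDerivativeOn_connOp _ _⟩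

variable {x : N} {W : ∀ x : N, TangentSpace (𝓡 (m + 1)) x}

theorem PhiL_galileanConnection (hW : FieldDiffAt W x) (v : TangentSpace (𝓡 (m + 1)) x) :
    𝒢.PhiL x (τ.galileanConnection W x v) = 𝒢.covDeriv (fun y => 𝒢.PhiL y (W y)) x v +
      𝒢.h x v (W x) • τ.eta x + τ.shift x v (W x) • 𝒢.xi x :=
  PhiL_connOp _ _ hW (τ.metricForm_xi_eta x) v

/-- The form `τ` is parallel for `∇̃^τ`. -/
theorem dirDeriv_form (hW : FieldDiffAt W x) (v : TangentSpace (𝓡 (m + 1)) x) :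
    dirDeriv (fun y => τ.form y (W y)) x v = τ.form x (τ.galileanConnection W x v) := by
  have h := dirDeriv_metricForm (tDiffAt_PhiL (𝒢 := 𝒢) hW) (τ.tDiffAt_eta x) v
  simp only [metricForm_PhiL_eta] at h
  rw [h, ← metricForm_PhiL_eta, τ.PhiL_galileanConnection hW, eq_sub_of_add_eq (τ.PhiL_DL x v).symm,
    map_sub, ← h_eq, map_smul, metricForm_PhiL_eta]
  simp only [map_add, map_smul, LinearMap.add_apply, LinearMap.smul_apply, metricForm_eta_eta,
    metricForm_xi_eta, shift_apply, smul_eq_mul, h_symm x (W x)]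
  ring

theorem proj_galileanConnection (hW : FieldDiffAt W x) (v : TangentSpace (𝓡 (m + 1)) x) :
    τ.proj x (τ.galileanConnection W x v) =
      τ.screenL x (𝒢.covDeriv (fun y => 𝒢.PhiL y (W y)) x v) := by
  rw [← screenL_PhiL, τ.PhiL_galileanConnection hW, map_add, map_add, map_smul, map_smul,
    screenL_eta, screenL_xi]
  simp

theorem galileanConnection_eq (hW : FieldDiffAt W x) (v : TangentSpace (𝓡 (m + 1)) x) :
    τ.galileanConnection W x v = dirDeriv (fun y => τ.form y (W y)) x v • 𝒢.Z x +
      τ.screenL x (𝒢.covDeriv (fun y => 𝒢.PhiL y (W y)) x v) := by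
  rw [τ.dirDeriv_form hW, ← τ.proj_galileanConnection hW]
  exact τ.form_eq_add_proj x _

theorem galileanConnection_eq_extendedConnection (V : ∀ x : N, TangentSpace (𝓡 (m + 1)) x)
    (hW : FieldDiffAt W x) :
    τ.galileanConnection W x (V x) = τ.extendedConnection V W x := by
  have hf := mdifferentiableAt_oneForm τ.smooth hW
  have h1 : 𝒢.covDeriv (fun y => 𝒢.PhiL y (W y)) x (V x) =
      𝒢.covDeriv (fun y => 𝒢.PhiL y (τ.proj y (W y)) + τ.form y (W y) • 𝒢.xi y) x (V x) := by
    refine covDeriv_congr (fun y => ?_) x _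
    rw [proj, map_sub, map_smul, PhiL_Z]
    abel
  have hP : TDiffAt (fun y => 𝒢.PhiL y (τ.proj y (W y))) x := by
    have h2 := (tDiffAt_PhiL (𝒢 := 𝒢) hW).add
      ((tDiffAt_xi x).smul (hf.const_smul (-1 : ℝ)))
    convert h2 using 2 with y
    rw [proj, map_sub, map_smul, PhiL_Z]
    change _ = _ + ((-1 : ℝ) * τ.form y (W y)) • 𝒢.xi y
    module
  have h3 : 𝒢.covDeriv 𝒢.xi x (V x) = 𝒢.PhiL x (V x) := rfl
  rw [τ.galileanConnection_eq hW, h1, covDeriv_add hP ((tDiffAt_xi x).smul hf),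
    covDeriv_smul hf (tDiffAt_xi x), h3, map_add, map_add, map_smul, map_smul, screenL_xi,
    screenL_PhiL, smul_zero, zero_add, extendedConnection, screenConnection, screenPart_eq]
  simp only [← PhiL_apply]
  abel

theorem galileanConnection_Z (v : TangentSpace (𝓡 (m + 1)) x) :
    τ.galileanConnection 𝒢.Z x v = τ.proj x v := by
  have h1 : 𝒢.covDeriv (fun y => 𝒢.PhiL y (𝒢.Z y)) x v = 𝒢.PhiL x v :=
    covDeriv_congr (fun y => PhiL_Z y) x v
  rw [τ.galileanConnection_eq (𝒢.isSmoothField_Z.fieldDiffAt x), h1, screenL_PhiL]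
  simp only [τ.form_Z, dirDeriv_const, zero_smul, zero_add]

theorem isSmoothFieldOn_galileanConnection {U : Set N} {V : ∀ x : N, TangentSpace (𝓡 (m + 1)) x}
    (hU : IsOpen U) (hV : IsSmoothFieldOn V U) (hW : IsSmoothFieldOn W U) :
    IsSmoothFieldOn (fun x => τ.galileanConnection W x (V x)) U := by
  have h1 : TSmoothOn (fun x => 𝒢.covDeriv (fun y => 𝒢.PhiL y (W y)) x (V x) +
      𝒢.h x (V x) (W x) • τ.eta x + τ.shift x (V x) (W x) • 𝒢.xi x) U := by
    refine (((tSmoothOn_PhiL hW).covDeriv hU hV).add ((τ.tSmoothOn_eta U).smul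
      (𝒢.isLightlikeMetric_h.smooth U V W hU hV hW))).add ((tSmoothOn_xi U).smul ?_)
    exact (𝒢.isLightlikeMetric_h.smooth U _ W hU (τ.isSmoothFieldOn_DL hU hV) hW).sub
      ((contMDiffOn_oneForm τ.smooth hV).mul (contMDiffOn_oneForm τ.smooth hW))
  have h2 : ∀ x ∈ U, 𝒢.PhiL x (τ.galileanConnection W x (V x)) = _ := fun x hx =>
    τ.PhiL_galileanConnection (hW.fieldDiffAt hU hx) (V x)
  refine IsSmoothFieldOn.congr (h1.phiInv hU fun x hx => ?_) fun x hx => ?_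
  · rw [← h2 x hx, metricForm_PhiL_xi]
  · rw [← h2 x hx, PhiInv_PhiL]

theorem isGalilean_galileanConnection : τ.IsGalilean τ.galileanConnection where
  smooth := ⟨⟨fun {σ} hσ => (contMDiff_hom_of_apply fun U V hU hV =>
    τ.isSmoothFieldOn_galileanConnection hU hV
      (ContMDiffOn.mono hσ (Set.subset_univ U))).contMDiffOn⟩⟩
  parallel W hW x v := τ.dirDeriv_form (hW.fieldDiffAt x) v
  metric X Y hX hY hX0 hY0 x v := by
    have h := dirDeriv_metricForm (tDiffAt_PhiL (𝒢 := 𝒢) (hX.fieldDiffAt x))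
      (tDiffAt_PhiL (𝒢 := 𝒢) (hY.fieldDiffAt x)) v
    simp only [← h_eq] at h
    rw [h, h_eq, h_eq x (X x), τ.PhiL_galileanConnection (hX.fieldDiffAt x),
      τ.PhiL_galileanConnection (hY.fieldDiffAt x)]
    simp only [map_add, map_smul, LinearMap.add_apply, LinearMap.smul_apply, metricForm_xi_PhiL,
      metricForm_PhiL_xi, metricForm_eta_PhiL, metricForm_PhiL_eta, hX0, hY0, smul_zero, add_zero]

theorem satisfiesConditions_galileanConnection :
    τ.SatisfiesConditions 𝒢.torsionTensor τ.galileanConnection where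
  gravitational x := by
    rw [galileanConnection_Z, proj, τ.form_Z, one_smul, sub_self]
  vorticity x v w hv hw := by
    rw [galileanConnection_Z, galileanConnection_Z, τ.proj_of_form_eq_zero hv,
      τ.proj_of_form_eq_zero hw, sub_self]
  torsion V W hV hW x := by
    have h1 := τ.galileanConnection.torsion_apply (hV.fieldDiffAt x) (hW.fieldDiffAt x)
    refine ((τ.form_eq_add_proj x _).trans (add_comm _ _)).trans ?_
    congr 1
    · rw [← screenL_PhiL, ← screenL_PhiL, PhiL_torsionTensor (hV.fieldDiffAt x) (hW.fieldDiffAt x),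
        h1, map_sub, map_sub, map_sub (𝒢.PhiL x),
        τ.PhiL_galileanConnection (hW.fieldDiffAt x),
        τ.PhiL_galileanConnection (hV.fieldDiffAt x)]
      simp only [map_add, map_sub, map_smul, screenL_eta, screenL_xi, smul_zero, add_zero,
        curvature]
      rfl
    · congr 1
      rw [h1, map_sub, map_sub, extDerivOneForm, τ.dirDeriv_form (hW.fieldDiffAt x),
        τ.dirDeriv_form (hV.fieldDiffAt x)]

end ScreenForm

namespace ScreenForm

variable (τ : 𝒢.ScreenForm)

/-! ### Uniqueness of the Galilean connection -/

/-- Tangent vectors extend to global smooth vector fields. -/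
theorem _root_.Lightlike.exists_isSmoothField_apply_eq [T2Space N] (x : N)
    (v : TangentSpace (𝓡 (m + 1)) x) :
    ∃ V : ∀ x : N, TangentSpace (𝓡 (m + 1)) x, IsSmoothField V ∧ V x = v := by
  obtain ⟨s, hs, hV⟩ := FiberBundle.exists_contMDiffOn_extend (k := ∞) (𝓡 (m + 1))
    (EuclideanSpace ℝ (Fin (m + 1))) (V := (TangentSpace (𝓡 (m + 1)) : N → Type _)) v
  obtain ⟨f, -, hf⟩ := (SmoothBumpFunction.nhds_basis_tsupport (I := 𝓡 (m + 1)) x).mem_iff.1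
    (interior_mem_nhds.2 hs)
  refine ⟨fun y => f y • FiberBundle.extend (EuclideanSpace ℝ (Fin (m + 1))) v y,
    ContMDiffOn.smul_section_of_tsupport f.contMDiff.contMDiffOn isOpen_interior hf
      (hV.mono interior_subset), ?_⟩
  simp only [f.eq_one, one_smul, FiberBundle.extend_apply_self]

theorem isSmoothField_proj {V : ∀ x : N, TangentSpace (𝓡 (m + 1)) x} (hV : IsSmoothField V) :
    IsSmoothField fun y => τ.proj y (V y) :=
  ContMDiff.sub_section hV (ContMDiff.smul_section
    (contMDiffOn_univ.1 (contMDiffOn_oneForm τ.smooth (hV.on Set.univ))) 𝒢.isSmoothField_Z)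

theorem exists_isSmoothField_of_form_eq_zero [T2Space N] {x : N} {v : TangentSpace (𝓡 (m + 1)) x}
    (hv : τ.form x v = 0) : ∃ V : ∀ x : N, TangentSpace (𝓡 (m + 1)) x, IsSmoothField V ∧
      (∀ y, τ.form y (V y) = 0) ∧ V x = v := by
  obtain ⟨V, hV, rfl⟩ := exists_isSmoothField_apply_eq x v
  exact ⟨_, τ.isSmoothField_proj hV, fun y => τ.form_proj y _, τ.proj_of_form_eq_zero hv⟩

theorem eq_zero_of_h_self {x : N} {v : TangentSpace (𝓡 (m + 1)) x} (hv : τ.form x v = 0)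
    (h : 𝒢.h x v v = 0) : v = 0 := by
  obtain ⟨c, rfl⟩ := exists_eq_smul_Z h
  rw [map_smul, τ.form_Z, smul_eq_mul, mul_one] at hv
  rw [hv, zero_smul]

/-- A Koszul-type rigidity: a bilinear map with values in `An τ` that is symmetric, skew with
respect to `h^ω` on `An τ`, and has no gravitational and no rotational part, vanishes. -/
theorem eq_zero_of_skew_of_symm {x : N} (A : TangentSpace (𝓡 (m + 1)) x →L[ℝ]
      TangentSpace (𝓡 (m + 1)) x →L[ℝ] TangentSpace (𝓡 (m + 1)) x)
    (hform : ∀ w v, τ.form x (A w v) = 0) (hsymm : ∀ w v, A w v = A v w)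
    (hskew : ∀ w w', τ.form x w = 0 → τ.form x w' = 0 → ∀ v,
      𝒢.h x (A w v) w' + 𝒢.h x w (A w' v) = 0)
    (hgrav : A (𝒢.Z x) (𝒢.Z x) = 0)
    (hrot : ∀ v w, τ.form x v = 0 → τ.form x w = 0 →
      𝒢.h x (A (𝒢.Z x) v) w = 𝒢.h x v (A (𝒢.Z x) w)) (w v : TangentSpace (𝓡 (m + 1)) x) :
    A w v = 0 := by
  have h1 : ∀ v w, τ.form x v = 0 → τ.form x w = 0 → A w v = 0 := by
    intro v w hv hw
    refine τ.eq_zero_of_h_self (hform w v) ?_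
    set u := A w v with hu
    have hu0 : τ.form x u = 0 := hform w v
    -- cyclic permutation of the skew-symmetry, as for the Levi-Civita connection
    have e1 := hskew w u hw hu0 v
    have e2 := hskew v u hv hu0 w
    have e3 := hskew v w hv hw u
    rw [hsymm u v] at e1
    rw [hsymm u w, hsymm v w] at e2
    rw [h_symm x w] at e1
    rw [h_symm x v] at e2
    rw [h_symm x v] at e3
    rw [← hu] at e1 e2
    linarith
  have h2 : ∀ v, τ.form x v = 0 → A (𝒢.Z x) v = 0 := by
    intro v hv
    refine τ.eq_zero_of_h_self (hform _ v) ?_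
    set u := A (𝒢.Z x) v with hu
    have hu0 : τ.form x u = 0 := hform _ v
    -- `A Z` is both skew and symmetric on `An τ`
    have e1 := hskew v u hv hu0 (𝒢.Z x)
    have e2 := hrot v u hv hu0
    rw [hsymm v, hsymm u] at e1
    rw [← hu] at e1 e2
    linarith
  rw [τ.form_eq_add_proj x w, τ.form_eq_add_proj x v]
  simp only [map_add, map_smul, add_apply, smul_apply, hgrav, h2 _ (τ.form_proj x _),
    hsymm (τ.proj x w) (𝒢.Z x), h1 _ _ (τ.form_proj x v) (τ.form_proj x w), smul_zero, add_zero]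

/-- A Galilean connection is determined by the gravitational field, the vorticity and the
torsion: the difference of two of them satisfies the hypotheses of `eq_zero_of_skew_of_symm`. -/
theorem eq_of_isGalilean [T2Space N]
    {T : ∀ x : N, TangentSpace (𝓡 (m + 1)) x →ₗ[ℝ] TangentSpace (𝓡 (m + 1)) x →ₗ[ℝ]
      TangentSpace (𝓡 (m + 1)) x}
    {nab nab' : CovariantDerivative (𝓡 (m + 1)) (EuclideanSpace ℝ (Fin (m + 1)))
      (TangentSpace (𝓡 (m + 1)) : N → Type _)}
    (hG : τ.IsGalilean nab) (hS : τ.SatisfiesConditions T nab)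
    (hG' : τ.IsGalilean nab') (hS' : τ.SatisfiesConditions T nab')
    {V W : ∀ x : N, TangentSpace (𝓡 (m + 1)) x} (hW : IsSmoothField W) (x : N) :
    nab' W x (V x) = nab W x (V x) := by
  set A := nab'.isCovariantDerivativeOnUniv.difference nab.isCovariantDerivativeOnUniv x with hA
  have hAW : ∀ W : ∀ x : N, TangentSpace (𝓡 (m + 1)) x, IsSmoothField W → ∀ v,
      A (W x) v = nab' W x v - nab W x v := fun W hW v =>
    congrArg (fun L : TangentSpace (𝓡 (m + 1)) x →L[ℝ] TangentSpace (𝓡 (m + 1)) x => L v)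
      (nab'.isCovariantDerivativeOnUniv.difference_apply nab.isCovariantDerivativeOnUniv
        (x := x) trivial (hW.fieldDiffAt x))
  rw [← sub_eq_zero, ← hAW W hW]
  refine τ.eq_zero_of_skew_of_symm A (fun w v => ?_) (fun w v => ?_)
    (fun w w' hw hw' v => ?_) ?_ (fun v w hv hw => ?_) _ _
  · obtain ⟨W, hW, rfl⟩ := exists_isSmoothField_apply_eq x w
    rw [hAW W hW, map_sub, ← hG.parallel W hW, ← hG'.parallel W hW, sub_self]
  · obtain ⟨W, hW, rfl⟩ := exists_isSmoothField_apply_eq x w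
    obtain ⟨V, hV, rfl⟩ := exists_isSmoothField_apply_eq x v
    rw [hAW W hW, hAW V hV]
    have h := (hS'.torsion V W hV hW x).trans (hS.torsion V W hV hW x).symm
    rw [nab.torsion_apply (hV.fieldDiffAt x) (hW.fieldDiffAt x),
      nab'.torsion_apply (hV.fieldDiffAt x) (hW.fieldDiffAt x), sub_left_inj] at h
    rw [sub_eq_sub_iff_add_eq_add] at h ⊢
    exact h.trans (add_comm _ _)
  · obtain ⟨X, hX, hX0, rfl⟩ := τ.exists_isSmoothField_of_form_eq_zero hw
    obtain ⟨Y, hY, hY0, rfl⟩ := τ.exists_isSmoothField_of_form_eq_zero hw'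
    have h := (hG'.metric X Y hX hY hX0 hY0 x v).symm.trans (hG.metric X Y hX hY hX0 hY0 x v)
    rw [hAW X hX, hAW Y hY, map_sub, map_sub, LinearMap.sub_apply]
    linarith
  · rw [hAW _ 𝒢.isSmoothField_Z, hS.gravitational, hS'.gravitational, sub_self]
  · have h := hS.vorticity x v w hv hw
    have h' := hS'.vorticity x v w hv hw
    rw [hAW _ 𝒢.isSmoothField_Z, hAW _ 𝒢.isSmoothField_Z, map_sub, map_sub, LinearMap.sub_apply]
    linarith

/-! ### The change of screen form -/

theorem exists_isOrthonormalFrame (x : N) : ∃ E, τ.IsOrthonormalFrame x E := by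
  obtain ⟨U₀, hy₀, hs, -⟩ := 𝒢.exists_localSection x
  set θ := LinearEquiv.ofBijective _ (gaugeSolder_bijective hs hy₀)
  have hθ : ∀ p, 𝒢.gaugeSolder (𝒢.localSection x) x (θ.symm p) = p := θ.apply_symm_apply
  refine ⟨fun i => τ.proj x (θ.symm (0, EuclideanSpace.basisFun (Fin m) ℝ i)),
    fun i => τ.form_proj x _, fun i j => ?_⟩
  have h1 : ∀ v w, 𝒢.h x (τ.proj x v) (τ.proj x w) = 𝒢.h x v w := fun v w => by
    simp [proj, h_Z_left, h_Z_right]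
  rw [h1, h_apply_gauge hs hy₀, hθ, hθ]
  exact (orthonormal_iff_ite.1 (EuclideanSpace.basisFun (Fin m) ℝ).orthonormal) i j

/-- The expansion of a tangent vector with respect to `Z^ω` and an orthonormal frame. -/
theorem IsOrthonormalFrame.eq_sum {x : N} {E : Fin m → TangentSpace (𝓡 (m + 1)) x}
    (hE : τ.IsOrthonormalFrame x E) (v : TangentSpace (𝓡 (m + 1)) x) :
    v = τ.form x v • 𝒢.Z x + ∑ i, 𝒢.h x (E i) v • E i := by
  -- the components of a vector, a linear map between spaces of the same dimension
  let c : TangentSpace (𝓡 (m + 1)) x →ₗ[ℝ] ℝ × (Fin m → ℝ) :=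
    (τ.form x).prod (LinearMap.pi fun i => 𝒢.h x (E i))
  have hc : ∀ (a : ℝ) (b : Fin m → ℝ), c (a • 𝒢.Z x + ∑ i, b i • E i) = (a, b) := by
    intro a b
    refine Prod.ext ?_ (funext fun i => ?_)
    · change τ.form x _ = a
      simp [map_sum, τ.form_Z, hE.1]
    · change 𝒢.h x (E i) _ = b i
      simp [map_sum, h_Z_right, hE.2]
  have hsurj : Function.Surjective c := fun p => ⟨_, hc p.1 p.2⟩
  have hdim : Module.finrank ℝ (TangentSpace (𝓡 (m + 1)) x) =
      Module.finrank ℝ (ℝ × (Fin m → ℝ)) := by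
    have h1 : Module.finrank ℝ (TangentSpace (𝓡 (m + 1)) x) =
      Module.finrank ℝ (EuclideanSpace ℝ (Fin (m + 1))) := rfl
    rw [h1]
    simp [add_comm]
  exact (LinearMap.injective_iff_surjective_of_finrank_eq_finrank hdim).2 hsurj (hc _ _).symm

variable (τ' : 𝒢.ScreenForm)

theorem form_L (x : N) : τ'.form x (τ.L τ' x) = 0 := by
  have hE := Classical.epsilon_spec (τ'.exists_isOrthonormalFrame x)
  simp [L, map_sum, hE.1]

/-- `L_{τ,τ'}` is the vector in `An τ'` that represents `τ - τ'`. -/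
theorem h_L (x : N) (v : TangentSpace (𝓡 (m + 1)) x) :
    𝒢.h x (τ.L τ' x) v = τ.form x v - τ'.form x v := by
  have hE := Classical.epsilon_spec (τ'.exists_isOrthonormalFrame x)
  have h1 := congrArg (τ.form x) (hE.eq_sum τ' v)
  simp only [map_add, map_smul, map_sum, τ.form_Z, smul_eq_mul, mul_one] at h1
  rw [h1, L]
  simp only [map_sum, map_smul, LinearMap.sum_apply, LinearMap.smul_apply, smul_eq_mul,
    add_sub_cancel_left]
  exact Finset.sum_congr rfl fun i _ => mul_comm _ _

/-- The change of the null section: the right-hand side is null and pairs with `Φ` as `τ'`. -/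
theorem eta_change (x : N) : τ'.eta x = τ.eta x - 𝒢.PhiL x (τ.L τ' x) +
    ((1 / 2 : ℝ) * 𝒢.h x (τ.L τ' x) (τ.L τ' x)) • 𝒢.xi x := by
  refine τ'.eta_unique (τ'.metricForm_eta_eta x) (τ'.metricForm_PhiL_eta x) ?_ fun v => ?_
  · have h1 := τ.h_L τ' x (τ.L τ' x)
    rw [form_L, sub_zero] at h1
    simp only [map_add, map_sub, map_smul, LinearMap.add_apply, LinearMap.sub_apply,
      LinearMap.smul_apply, metricForm_eta_eta, metricForm_xi_xi, metricForm_eta_xi,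
      metricForm_xi_eta, metricForm_xi_PhiL, metricForm_PhiL_xi, metricForm_eta_PhiL,
      metricForm_PhiL_eta, ← h_eq, smul_eq_mul, ← h1]
    ring
  · rw [map_add, map_sub, map_smul, metricForm_PhiL_eta, metricForm_PhiL_xi, ← h_eq, h_symm, h_L,
      smul_zero, add_zero, sub_sub_cancel]

/-- `L_{τ,τ'}` is smooth, as `Φ(L_{τ,τ'}) = η^τ - η^{τ'} - 𝐡(η^τ, η^{τ'}) ξ`. -/
theorem isSmoothField_L : IsSmoothField (τ.L τ') := by
  have h1 : TSmoothOn (fun x => τ.eta x - τ'.eta x -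
      𝒢.metricForm x (τ.eta x) (τ'.eta x) • 𝒢.xi x) Set.univ :=
    ((τ.tSmoothOn_eta _).sub (τ'.tSmoothOn_eta _)).sub ((tSmoothOn_xi _).smul
      ((τ.tSmoothOn_eta _).metricForm isOpen_univ (τ'.tSmoothOn_eta _)))
  have h2 : ∀ x, 𝒢.PhiL x (τ.L τ' x) = τ.eta x - τ'.eta x -
      𝒢.metricForm x (τ.eta x) (τ'.eta x) • 𝒢.xi x := by
    intro x
    have h3 : 𝒢.metricForm x (τ.eta x) (τ'.eta x) =
        -((1 / 2 : ℝ) * 𝒢.h x (τ.L τ' x) (τ.L τ' x)) := by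
      have h4 := τ.h_L τ' x (τ.L τ' x)
      rw [form_L, sub_zero] at h4
      rw [τ.eta_change τ', map_add, map_sub, map_smul, metricForm_eta_eta, metricForm_eta_PhiL,
        metricForm_eta_xi, h4, smul_eq_mul]
      ring
    rw [h3, τ.eta_change τ']
    module
  refine contMDiffOn_univ.1 (IsSmoothFieldOn.congr
    (h1.phiInv isOpen_univ fun x _ => ?_) fun x _ => ?_)
  · rw [← h2, metricForm_PhiL_xi]
  · rw [← h2, PhiInv_PhiL]

theorem screenL_eta_change (x : N) : τ'.screenL x (τ.eta x) = τ.L τ' x := by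
  have h : τ.eta x = τ'.eta x + 𝒢.PhiL x (τ.L τ' x) -
      ((1 / 2 : ℝ) * 𝒢.h x (τ.L τ' x) (τ.L τ' x)) • 𝒢.xi x := by
    rw [τ.eta_change τ']; abel
  rw [h, map_sub, map_add, map_smul, screenL_eta, screenL_xi, screenL_PhiL,
    τ'.proj_of_form_eq_zero (τ.form_L τ' x), smul_zero, sub_zero, zero_add]

theorem D_change (x : N) (w : TangentSpace (𝓡 (m + 1)) x) :
    τ'.D x w =
      τ'.proj x (τ.D x w + ((1 / 2 : ℝ) * 𝒢.h x (τ.L τ' x) (τ.L τ' x)) • w) -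
        τ.form x w • τ.L τ' x - τ'.galileanConnection (τ.L τ') x w := by
  have hL := τ.isSmoothField_L τ'
  have hLL : MDifferentiableAt (𝓡 (m + 1)) 𝓘(ℝ, ℝ)
      (fun y => (1 / 2 : ℝ) * 𝒢.h y (τ.L τ' y) (τ.L τ' y)) x := by
    have h := (𝒢.isLightlikeMetric_h.smooth Set.univ _ _ isOpen_univ (hL.on _)
      (hL.on _)).contMDiffAt (x := x) Filter.univ_mem
    exact (h.mdifferentiableAt (by simp)).const_smul (1 / 2 : ℝ)
  have hΦ : TDiffAt (fun y => (-1 : ℝ) • 𝒢.PhiL y (τ.L τ' y)) x :=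
    (tDiffAt_PhiL (hL.fieldDiffAt x)).smul mdifferentiableAt_const
  have h1 : 𝒢.covDeriv τ'.eta x w = 𝒢.covDeriv τ.eta x w -
      𝒢.covDeriv (fun y => 𝒢.PhiL y (τ.L τ' y)) x w +
      (dirDeriv (fun y => (1 / 2 : ℝ) * 𝒢.h y (τ.L τ' y) (τ.L τ' y)) x w • 𝒢.xi x +
      ((1 / 2 : ℝ) * 𝒢.h x (τ.L τ' x) (τ.L τ' x)) • 𝒢.PhiL x w) := by
    rw [covDeriv_congr (fun y => (τ.eta_change τ' y).trans (congrArg₂ _ ((sub_eq_add_neg _ _).trans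
      (congrArg₂ _ rfl (neg_one_smul ℝ _).symm)) rfl)) x w,
      covDeriv_add ((τ.tDiffAt_eta x).add hΦ) ((tDiffAt_xi x).smul hLL),
      covDeriv_add (τ.tDiffAt_eta x) hΦ, covDeriv_smul hLL (tDiffAt_xi x),
      covDeriv_smul mdifferentiableAt_const (tDiffAt_PhiL (hL.fieldDiffAt x)), dirDeriv_const]
    have h3 : 𝒢.covDeriv 𝒢.xi x w = 𝒢.PhiL x w := rfl
    rw [h3]
    module
  have h2 : τ'.galileanConnection (τ.L τ') x w =
      τ'.screenL x (𝒢.covDeriv (fun y => 𝒢.PhiL y (τ.L τ' y)) x w) := by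
    rw [τ'.galileanConnection_eq (hL.fieldDiffAt x)]
    simp only [form_L, dirDeriv_const, zero_smul, zero_add]
  rw [τ'.D_eq, DL_apply, h1, h2, τ.D_eq, ← screenL_PhiL, map_add (𝒢.PhiL x), PhiL_DL]
  simp only [map_add, map_sub, map_smul, screenL_xi, screenL_PhiL, screenL_eta_change, smul_zero]
  module

end ScreenForm

end CartanGeometry

end Lightlike

end

theorem mainTheorem3 (m : ℕ) (hm : 2 ≤ m)
    {N : Type*} [TopologicalSpace N] [T2Space N] [SecondCountableTopology N]
    [ChartedSpace (EuclideanSpace ℝ (Fin (m + 1))) N] [IsManifold (𝓡 (m + 1)) ∞ N]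
    {F : Type*} [NormedAddCommGroup F] [NormedSpace ℝ F] [FiniteDimensional ℝ F]
    {P : Type*} [TopologicalSpace P] [T2Space P] [SecondCountableTopology P]
    [ChartedSpace F P] [IsManifold 𝓘(ℝ, F) ∞ P]
    (𝒢 : Lightlike.CartanGeometry m N P (F := F)) :
    -- (1) the lightlike metric `h^ω` and the vector field `Z^ω` spanning its radical
    (∀ (u : P) (X Y : TangentSpace 𝓘(ℝ, F) u),
      𝒢.h (𝒢.proj u) (mfderiv 𝓘(ℝ, F) (𝓡 (m + 1)) 𝒢.proj u X)
          (mfderiv 𝓘(ℝ, F) (𝓡 (m + 1)) 𝒢.proj u Y) =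
        Lightlike.qform m (Lightlike.projGH m (𝒢.conn u X))
          (Lightlike.projGH m (𝒢.conn u Y))) ∧
    (∀ (u : P) (X : TangentSpace 𝓘(ℝ, F) u), 𝒢.conn u X = Lightlike.gradingElement m →
      mfderiv 𝓘(ℝ, F) (𝓡 (m + 1)) 𝒢.proj u X = 𝒢.Z (𝒢.proj u)) ∧
    Lightlike.IsLightlikeMetric 𝒢.h ∧
    Lightlike.IsSmoothField 𝒢.Z ∧
    (∀ x, LinearMap.ker (𝒢.h x) = Submodule.span ℝ {𝒢.Z x}) ∧
    -- (2) the tensor field `T^ω` and the Galilean connections it determines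
    ∃ T : ∀ x : N, TangentSpace (𝓡 (m + 1)) x →ₗ[ℝ] TangentSpace (𝓡 (m + 1)) x →ₗ[ℝ]
        TangentSpace (𝓡 (m + 1)) x,
      Lightlike.IsVectorValuedTwoForm T ∧
      (∀ V W, Lightlike.IsSmoothField V → Lightlike.IsSmoothField W → ∀ x,
        𝒢.curvature V W 𝒢.xi x = 𝒢.Phi x (T x (V x) (W x))) ∧
      ∃ nab : 𝒢.ScreenForm → CovariantDerivative (𝓡 (m + 1)) (EuclideanSpace ℝ (Fin (m + 1)))
          (TangentSpace (𝓡 (m + 1)) : N → Type _),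
        (∀ τ : 𝒢.ScreenForm,
          τ.IsGalilean (nab τ) ∧ τ.SatisfiesConditions T (nab τ) ∧
          (∀ nab', τ.IsGalilean nab' → τ.SatisfiesConditions T nab' →
            ∀ V W, Lightlike.IsSmoothField V → Lightlike.IsSmoothField W → ∀ x,
              nab' W x (V x) = nab τ W x (V x)) ∧
          (∀ V W, Lightlike.IsSmoothField V → Lightlike.IsSmoothField W → ∀ x,
            nab τ W x (V x) = τ.extendedConnection V W x)) ∧
        -- (3) the bundle morphisms `D^τ : TN → An τ` and their change law
        (∀ τ : 𝒢.ScreenForm,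
          Lightlike.IsBundleMorphism τ.D ∧ ∀ x w, τ.form x (τ.D x w) = 0) ∧
        ∀ (τ τ' : 𝒢.ScreenForm),
          Lightlike.IsSmoothField (τ.L τ') ∧
          ∀ (x : N) (w : TangentSpace (𝓡 (m + 1)) x),
            τ'.D x w =
              τ'.proj x (τ.D x w + ((1 / 2 : ℝ) * 𝒢.h x (τ.L τ' x) (τ.L τ' x)) • w) -
                τ.form x w • τ.L τ' x - nab τ' (τ.L τ') x w := by
  refine ⟨Lightlike.CartanGeometry.h_mfderiv_proj, Lightlike.CartanGeometry.mfderiv_proj_eq_Z,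
    𝒢.isLightlikeMetric_h, 𝒢.isSmoothField_Z, Lightlike.CartanGeometry.ker_h,
    𝒢.torsionTensor, 𝒢.isVectorValuedTwoForm_torsionTensor, fun V W hV hW x =>
      (Lightlike.CartanGeometry.PhiL_torsionTensor (hV.fieldDiffAt x) (hW.fieldDiffAt x)).symm,
    fun τ => τ.galileanConnection, fun τ => ⟨τ.isGalilean_galileanConnection,
      τ.satisfiesConditions_galileanConnection, fun nab' hG hS V W _ hW x =>
        τ.eq_of_isGalilean τ.isGalilean_galileanConnection
          τ.satisfiesConditions_galileanConnection hG hS hW x,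
      fun V W _ hW x => τ.galileanConnection_eq_extendedConnection V (hW.fieldDiffAt x)⟩,
    fun τ => ⟨τ.isBundleMorphism_D, fun x w => ?_⟩,
    fun τ τ' => ⟨τ.isSmoothField_L τ', fun x w => τ.D_change τ' x w⟩⟩
  rw [τ.D_eq]
  exact τ.form_DL x w
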